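/- Let $p>-1/2$ be real. For $N\ge 1$ let $\rho_N(\theta)$ be the eigenvalue density (one-point correlation function, of total mass $N$) of the circular Jacobi $\beta$ ensemble with $\beta=2$, $q=0$, i.e. of the probability density on $[0,2\pi)^N$ proportional to $$\prod_{l=1}^N |1-e^{i\theta_l}|^{2p}\prod_{1\le j<k\le N}|e^{i\theta_k}-e^{i\theta_j}|^2 .$$ The bulk scaled density about the spectrum singularity, $$\rho_\infty(x)=\lim_{N\to\infty}\frac{2\pi}{N}\,\rho_N\big(2\pi\chi_{x<0}+2\pi x/N\big),$$ exists for every real $x\neq 0$, $\rho_\infty-1$ is integrable on $\mathbb R$, and we set $$c_\infty(\tau)=\int_{-\infty}^\infty(\rho_\infty(x)-1)\,e^{i\tau x}\,dx .$$ Define $c_0=0$, $c_2=-\frac{p^2}{2\pi^2}$, and $c_{2n}=-\frac1{\pi^{2n}}\frac{(2n-3)!!}{(2n)!!}\prod_{l=0}^{n-1}(p^2-l^2)$ for $n\ge2$. Then $$c_\infty(\tau)=\sum_{j=0}^\infty h_j\,\tau^j\,\mathrm{sgn}\,\tau+\sum_{j=0}^\infty\tilde h_j\,\tau^j,\qquad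 |\tau|<2\pi,$$ with both series convergent, where $\mathrm{sgn}\,0=0$ and $$h_{2j-1}=\frac{\pi(-1)^j c_{2j}}{(2j-1)!}\ (j\ge1),\qquad h_{2j}=0\ (j\ge0),\qquad \tilde h_0=-p,\qquad \tilde h_j=0\ (j\ge1).$$ In particular $\int_{-\infty}^\infty(\rho_\infty(x)-1)\,dx=-p$ (perfect screening). If $p$ is not an integer, then $\sum_j h_j\tau^j$ diverges for $|\tau|>2\pi$, so that its radius of convergence is exactly $2\pi$ (if $p$ is an integer, the series terminates and the expansion is claimed for $|\tau|<2\pi$). -/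

import Mathlib

open MeasureTheory Filter Topology
open scoped Nat

noncomputable section

/-- Weight of the generalised circular Jacobi ensemble on `[0, 2π)`:
`e^{q(θ-π)} |1 - e^{iθ}|^{βp}`, with the spectrum singularity at `θ = 0`. -/
def cJWeight (β p q θ : ℝ) : ℝ :=
  Real.exp (q * (θ - Real.pi)) * ‖1 - Complex.exp (Complex.I * θ)‖ ^ (β * p)

/-- Unnormalised joint eigenvalue density
`∏_l w(θ_l) ∏_{j<k} |e^{iθ_k} - e^{iθ_j}|^β`. -/
def cJUnnormalised (N : ℕ) (β p q : ℝ) (θ : Fin N → ℝ) : ℝ :=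
  (∏ l, cJWeight β p q (θ l)) *
    ∏ j, ∏ k ∈ Finset.Ioi j,
      ‖Complex.exp (Complex.I * θ k) - Complex.exp (Complex.I * θ j)‖ ^ β

/-- The box `[0, 2π)^n` of eigenvalue angles. -/
def angleBox (n : ℕ) : Set (Fin n → ℝ) :=
  Set.univ.pi fun _ => Set.Ico 0 (2 * Real.pi)

/-- Normalisation constant of the joint density. -/
def cJPartition (N : ℕ) (β p q : ℝ) : ℝ :=
  ∫ θ in angleBox N, cJUnnormalised N β p q θ

/-- Normalised joint eigenvalue density of the circular Jacobi `β` ensemble. -/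
def cJPDF (N : ℕ) (β p q : ℝ) (θ : Fin N → ℝ) : ℝ :=
  cJUnnormalised N β p q θ / cJPartition N β p q

/-- Eigenvalue density (one-point correlation function):
`N` times the integral of the joint density over all but the first variable. -/
def cJDensity : ℕ → ℝ → ℝ → ℝ → ℝ → ℝ
  | 0, _, _, _, _ => 0
  | n + 1, β, p, q, θ =>
      ((n : ℝ) + 1) * ∫ η in angleBox n, cJPDF (n + 1) β p q (Fin.cons θ η : Fin (n + 1) → ℝ)

/-- The density about the singularity in the coordinate `x`, where `θ = 2πx/N` for `x ≥ 0` and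
`θ = 2π + 2πx/N` for `x < 0`; the mean spacing is one. -/
def cJScaledDensity (N : ℕ) (β p q x : ℝ) : ℝ :=
  2 * Real.pi / N *
    cJDensity N β p q ((if x < 0 then 2 * Real.pi else 0) + 2 * Real.pi * x / N)

/-- Bulk scaled density about the spectrum singularity: the `N → ∞` limit. -/
def cJBulkDensity (β p q x : ℝ) : ℝ :=
  limUnder atTop fun N : ℕ => cJScaledDensity N β p q x

/-- `∫ (ρ(x) - 1) e^{iτx} dx` for the bulk scaled density `ρ`. -/
def cJFourier (β p q τ : ℝ) : ℂ :=
  ∫ x : ℝ, ((cJBulkDensity β p q x - 1 : ℝ) : ℂ) * Complex.exp (Complex.I * τ * x)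

/-- On `|τ| < r` both series converge and `c(τ) = ∑ h_j τ^j sgn τ + ∑ h̃_j τ^j`. -/
def HasSgnExpansion (c : ℝ → ℂ) (h ht : ℕ → ℂ) (r : ℝ) : Prop :=
  ∀ τ : ℝ, |τ| < r →
    Summable (fun j : ℕ => h j * (τ : ℂ) ^ j * (Real.sign τ : ℂ)) ∧
    Summable (fun j : ℕ => ht j * (τ : ℂ) ^ j) ∧
    c τ = ∑' j : ℕ, h j * (τ : ℂ) ^ j * (Real.sign τ : ℂ) + ∑' j : ℕ, ht j * (τ : ℂ) ^ j

/-- `evenCoeff p n` is `c_{2n}`: `c_0 = 0`, `c_2 = -p²/(2π²)` and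
`c_{2n} = -π^{-2n} (2n-3)!!/(2n)!! ∏_{l<n} (p² - l²)` for `n ≥ 2`. -/
def evenCoeff (p : ℝ) : ℕ → ℝ
  | 0 => 0
  | 1 => -(p ^ 2 / (2 * Real.pi ^ 2))
  | n + 2 => -(1 / Real.pi ^ (2 * (n + 2))) *
      (((2 * (n + 2) - 3)‼ : ℝ) / ((2 * (n + 2))‼ : ℝ)) *
      ∏ l ∈ Finset.range (n + 2), (p ^ 2 - (l : ℝ) ^ 2)

end

/-!
Write `y = 2πx`. At `β = 2`, `q = 0` the ensemble is determinantal, so the density is the weight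
times the Christoffel–Darboux diagonal of the polynomials orthogonal on the circle with respect to
`|1 - z|^{2p}` (`cJDensity_eq_sum`). These satisfy the Szegő recursion with Verblunsky parameters
`p/(n+p)`; it gives them explicitly as hypergeometric sums in `z - 1`, and gives a summed form of
the diagonal in which only `Φ_N` and its reverse occur (`szego_christoffel_darboux`). Letting
`N → ∞` with `z = exp (iy/N)` the sums become the confluent functions
`A = ₁F₁(p+1; 2p+1; iy)` and `B = ₁F₁(p; 2p+1; iy)`, and the limiting density is
`ρ(y) = κ |y|^{2p} (|A|² - (2p/y) Im (A² e^{-iy}))` (`tendsto_cJScaledDensity`).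

The function `|A|²` and the real and imaginary parts of `A² e^{-iy}` satisfy a linear first-order
system (`hasDerivAt_kummer_system`). On the one hand the system yields `ρ(y) = L + O(y⁻²)` for some
constant `L` (`system_asymptotics`), hence integrability of `ρ - L`. On the other hand, read for
formal power series, it yields the Taylor coefficients of `ρ` in closed form
(`hasSum_bulkFactor`).

The Fourier transform is found from the Laplace transform. For large `s` the latter may be
integrated termwise, and comparison of coefficients, by means of the Wallis integrals
`I(m) = ∫_0^{π/2} cos^m` and `(m+1) I(m) I(m+1) = π/2`, shows that
`s ∫_0^∞ ρ(y) e^{-sy} dy = ∫_0^{π/2} cos α · L(s / cos α) dα`, `L(x) = (x + √(1 + x²))^{-2p}`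
(`laplace_bulkLimit_eq_of_large`). Both sides are holomorphic for `Re s > 0`, so that the identity
holds there. The limit `s → 0⁺` identifies the limit of `ρ` at infinity as `1`, and then
`∫_0^∞ (ρ - 1) e^{-sy} dy = -∫_0^{π/2} (1 - L(s/cos α)) / (s/cos α) dα`; by dominated convergence
this persists for `s = -iτ`, `τ > 0` (`fourier_bulkLimit_sub_one_eq`).

For `0 < τ < 1` the contour `[0, π/2]` is moved in the half strip `0 ≤ Re α ≤ π/2`, `Im α ≥ 0`. The
edge at infinity contributes `pπ`, the edge `Re α = π/2` contributes nothing to the real part,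
and the edge `α = ib` leaves the integral of `(1 - cos (2p arcsin (τ / cosh b))) cosh b / τ` over
`b > 0` (`tendsto_integral_one_sub_cos`). The Taylor series of `cos (2p arcsin w)` and the integrals
of odd powers of `1 / cosh` give the expansion in odd powers of `τ`
(`hasSum_integral_one_sub_cos`). The factor `sgn τ` comes from the evenness of `ρ`, the value at
`τ = 0` from continuity, and the radius of convergence from the ratio test.
-/

/-! ### Correlation functions of orthogonal polynomial ensembles -/

/-- The square of a determinant of functions, with the weight distributed over the variables,
as a double sum over permutations of products of one-variable functions. -/
lemma weighted_det_mul_conj_det {n : ℕ} (W : ℝ → ℂ) (f : Fin n → ℝ → ℂ) (x : Fin n → ℝ) :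
    (∏ i, W (x i)) * ((Matrix.of fun j i => f j (x i)).det *
        (starRingEnd ℂ) (Matrix.of fun j i => f j (x i)).det) =
      ∑ σ : Equiv.Perm (Fin n), ∑ τ : Equiv.Perm (Fin n),
        ((Equiv.Perm.sign σ : ℤ) : ℂ) * ((Equiv.Perm.sign τ : ℤ) : ℂ) *
          ∏ i, W (x i) * (f (σ i) (x i) * (starRingEnd ℂ) (f (τ i) (x i))) := by
  rw [Matrix.det_apply', map_sum, Finset.sum_mul_sum, Finset.mul_sum]
  refine Finset.sum_congr rfl fun σ _ => ?_
  rw [Finset.mul_sum]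
  refine Finset.sum_congr rfl fun τ _ => ?_
  simp only [Matrix.of_apply, map_mul, map_prod, Finset.prod_mul_distrib, map_intCast]
  ring

lemma sum_perm_apply_zero {n : ℕ} (F : Fin (n + 1) → ℂ) :
    ∑ σ : Equiv.Perm (Fin (n + 1)), F (σ 0) = (n ! : ℂ) * ∑ k, F k := by
  rw [← Equiv.sum_comp Equiv.Perm.decomposeFin.symm, Fintype.sum_prod_type, Finset.mul_sum]
  refine Finset.sum_congr rfl fun k _ => ?_
  simp [Fintype.card_perm]

lemma perm_eq_of_succ {n : ℕ} {σ τ : Equiv.Perm (Fin (n + 1))}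
    (h : ∀ i : Fin n, σ i.succ = τ i.succ) : σ = τ := by
  have h0 : σ 0 = τ 0 := by
    obtain ⟨j, hj⟩ := σ.surjective (τ 0)
    rcases Fin.eq_zero_or_eq_succ j with rfl | ⟨i, rfl⟩
    · exact hj
    · rw [h i] at hj
      exact absurd (τ.injective hj) (Fin.succ_ne_zero i)
  ext j
  rcases Fin.eq_zero_or_eq_succ j with rfl | ⟨i, rfl⟩
  · rw [h0]
  · rw [h i]

lemma intSign_mul_self {n : ℕ} (σ : Equiv.Perm (Fin n)) :
    ((Equiv.Perm.sign σ : ℤ) : ℂ) * ((Equiv.Perm.sign σ : ℤ) : ℂ) = 1 := by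
  rw [← Int.cast_mul, Int.units_coe_mul_self, Int.cast_one]

section Determinantal

variable {n : ℕ} {μ : Measure ℝ} [SigmaFinite μ] {W : ℝ → ℂ}

/-- The integral of the squared determinant over all variables. -/
lemma integral_weighted_det {f : Fin n → ℝ → ℂ} {h : Fin n → ℂ}
    (hint : ∀ j k, Integrable (fun x => W x * (f j x * (starRingEnd ℂ) (f k x))) μ)
    (horth : ∀ j k, ∫ x, W x * (f j x * (starRingEnd ℂ) (f k x)) ∂μ = if j = k then h j else 0) :
    ∫ x, (∏ i, W (x i)) * ((Matrix.of fun j i => f j (x i)).det *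
        (starRingEnd ℂ) (Matrix.of fun j i => f j (x i)).det) ∂(Measure.pi fun _ => μ) =
      (n ! : ℂ) * ∏ k, h k := by
  simp_rw [weighted_det_mul_conj_det]
  have hI : ∀ σ τ : Equiv.Perm (Fin n), Integrable (fun x : Fin n → ℝ =>
      ∏ i, W (x i) * (f (σ i) (x i) * (starRingEnd ℂ) (f (τ i) (x i))))
      (Measure.pi fun _ => μ) := fun σ τ =>
    Integrable.fintype_prod (f := fun i y => W y * (f (σ i) y * (starRingEnd ℂ) (f (τ i) y)))
      fun i => hint _ _
  rw [integral_finsetSum _ fun σ _ => integrable_finsetSum _ fun τ _ => (hI σ τ).const_mul _]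
  have key : ∀ σ : Equiv.Perm (Fin n),
      ∫ x : Fin n → ℝ, ∑ τ : Equiv.Perm (Fin n),
        ((Equiv.Perm.sign σ : ℤ) : ℂ) * ((Equiv.Perm.sign τ : ℤ) : ℂ) *
          ∏ i, W (x i) * (f (σ i) (x i) * (starRingEnd ℂ) (f (τ i) (x i)))
            ∂(Measure.pi fun _ => μ) = ∏ k, h k := by
    intro σ
    rw [integral_finsetSum _ fun τ _ => (hI σ τ).const_mul _]
    rw [Finset.sum_eq_single σ]
    · rw [integral_const_mul, intSign_mul_self, one_mul,
        integral_fintype_prod_eq_prod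
          (f := fun i y => W y * (f (σ i) y * (starRingEnd ℂ) (f (σ i) y)))]
      simp_rw [horth, if_true]
      exact Equiv.prod_comp σ h
    · intro τ _ hτ
      rw [integral_const_mul, integral_fintype_prod_eq_prod
          (f := fun i y => W y * (f (σ i) y * (starRingEnd ℂ) (f (τ i) y)))]
      obtain ⟨i, hi⟩ : ∃ i, σ i ≠ τ i := by
        by_contra! hc
        exact hτ (Equiv.ext fun i => (hc i).symm)
      rw [Finset.prod_eq_zero (Finset.mem_univ i), mul_zero]
      rw [horth, if_neg hi]
    · simp
  simp_rw [key]
  simp [Fintype.card_perm]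

/-- The integral of the squared determinant over all variables but the first. -/
lemma integral_weighted_det_cons {f : Fin (n + 1) → ℝ → ℂ} {h : Fin (n + 1) → ℂ}
    (hint : ∀ j k, Integrable (fun x => W x * (f j x * (starRingEnd ℂ) (f k x))) μ)
    (horth : ∀ j k, ∫ x, W x * (f j x * (starRingEnd ℂ) (f k x)) ∂μ = if j = k then h j else 0)
    (hne : ∀ k, h k ≠ 0) (θ : ℝ) :
    ∫ η, (∏ i, W ((Fin.cons θ η : Fin (n + 1) → ℝ) i)) *
        ((Matrix.of fun j i => f j ((Fin.cons θ η : Fin (n + 1) → ℝ) i)).det *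
        (starRingEnd ℂ) (Matrix.of fun j i => f j ((Fin.cons θ η : Fin (n + 1) → ℝ) i)).det)
          ∂(Measure.pi fun _ => μ) =
      (n ! : ℂ) * (∏ k, h k) *
        (W θ * ∑ k, f k θ * (starRingEnd ℂ) (f k θ) / h k) := by
  simp_rw [weighted_det_mul_conj_det, Fin.prod_univ_succ, Fin.cons_zero, Fin.cons_succ]
  have hI : ∀ σ τ : Equiv.Perm (Fin (n + 1)), Integrable (fun x : Fin n → ℝ =>
      ∏ i : Fin n, W (x i) * (f (σ i.succ) (x i) * (starRingEnd ℂ) (f (τ i.succ) (x i))))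
      (Measure.pi fun _ => μ) := fun σ τ =>
    Integrable.fintype_prod
      (f := fun i : Fin n => fun y => W y * (f (σ i.succ) y * (starRingEnd ℂ) (f (τ i.succ) y)))
      fun i => hint _ _
  rw [integral_finsetSum _ fun σ _ => integrable_finsetSum _ fun τ _ =>
    ((hI σ τ).const_mul _).const_mul _]
  have key : ∀ σ : Equiv.Perm (Fin (n + 1)),
      ∫ x : Fin n → ℝ, ∑ τ : Equiv.Perm (Fin (n + 1)),
        ((Equiv.Perm.sign σ : ℤ) : ℂ) * ((Equiv.Perm.sign τ : ℤ) : ℂ) *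
          (W θ * (f (σ 0) θ * (starRingEnd ℂ) (f (τ 0) θ)) *
          ∏ i : Fin n, W (x i) * (f (σ i.succ) (x i) * (starRingEnd ℂ) (f (τ i.succ) (x i))))
            ∂(Measure.pi fun _ => μ) =
        (fun k => (∏ k, h k) * (W θ * (f k θ * (starRingEnd ℂ) (f k θ) / h k))) (σ 0) := by
    intro σ
    rw [integral_finsetSum _ fun τ _ => ((hI σ τ).const_mul _).const_mul _]
    rw [Finset.sum_eq_single σ]
    · rw [integral_const_mul, intSign_mul_self, one_mul, integral_const_mul,
        integral_fintype_prod_eq_prod (f := fun i : Fin n => fun y =>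
          W y * (f (σ i.succ) y * (starRingEnd ℂ) (f (σ i.succ) y)))]
      simp_rw [horth, if_true]
      have hp : (∏ k, h k) = h (σ 0) * ∏ i : Fin n, h (σ i.succ) := by
        rw [← Equiv.prod_comp σ h, Fin.prod_univ_succ]
      rw [hp]
      field_simp [hne (σ 0)]
    · intro τ _ hτ
      rw [integral_const_mul, integral_const_mul, integral_fintype_prod_eq_prod
          (f := fun i : Fin n => fun y =>
            W y * (f (σ i.succ) y * (starRingEnd ℂ) (f (τ i.succ) y)))]
      obtain ⟨i, hi⟩ : ∃ i : Fin n, σ i.succ ≠ τ i.succ := by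
        by_contra! hc
        exact hτ (perm_eq_of_succ hc).symm
      rw [Finset.prod_eq_zero (Finset.mem_univ i), mul_zero, mul_zero]
      rw [horth, if_neg hi]
    · simp
  refine (Finset.sum_congr rfl fun σ _ => key σ).trans ((sum_perm_apply_zero
    fun k => (∏ k, h k) * (W θ * (f k θ * (starRingEnd ℂ) (f k θ) / h k))).trans ?_)
  rw [← Fin.prod_univ_succ, ← Finset.mul_sum, ← Finset.mul_sum, mul_assoc]

end Determinantal

/-- The squared Vandermonde factor of the joint density at `β = 2`, through any sequence of monic
polynomials of degrees `0, 1, …, n - 1`. -/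
lemma cJUnnormalised_two_eq_det {n : ℕ} (p : ℝ) (P : ℕ → Polynomial ℂ)
    (hmon : ∀ k, (P k).Monic) (hdeg : ∀ k, (P k).natDegree = k) (x : Fin n → ℝ) :
    ((cJUnnormalised n 2 p 0 x : ℝ) : ℂ) =
      (∏ i, (cJWeight 2 p 0 (x i) : ℂ)) *
        ((Matrix.of fun j i : Fin n => (P j).eval (Complex.exp (Complex.I * x i))).det *
        (starRingEnd ℂ)
          (Matrix.of fun j i : Fin n => (P j).eval (Complex.exp (Complex.I * x i))).det) := by
  have hdet : (Matrix.of fun j i : Fin n => (P j).eval (Complex.exp (Complex.I * x i))).det =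
      ∏ i : Fin n, ∏ j ∈ Finset.Ioi i,
        (Complex.exp (Complex.I * x j) - Complex.exp (Complex.I * x i)) := by
    rw [← Matrix.det_vandermonde,
      Matrix.det_eval_matrixOfPolynomials_eq_det_vandermonde _ (fun i : Fin n => P i)
        (fun i => hdeg i) (fun i => hmon i), ← Matrix.det_transpose]
    rfl
  rw [hdet, Complex.mul_conj, Complex.normSq_eq_norm_sq, norm_prod]
  simp_rw [norm_prod]
  unfold cJUnnormalised
  rw [Complex.ofReal_mul, Complex.ofReal_prod, ← Finset.prod_pow]
  simp_rw [← Finset.prod_pow, Real.rpow_two]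

lemma angleBox_restrict (n : ℕ) :
    (volume : Measure (Fin n → ℝ)).restrict (angleBox n) =
      Measure.pi fun _ => (volume : Measure ℝ).restrict (Set.Ico 0 (2 * Real.pi)) :=
  Measure.restrict_pi_pi _ _

/-- One-point function of the circular Jacobi ensemble at `β = 2`: the weight times the diagonal
of the reproducing kernel of the orthogonal polynomials. -/
lemma cJDensity_eq_sum (p : ℝ) (P : ℕ → Polynomial ℂ) (h : ℕ → ℝ)
    (hmon : ∀ k, (P k).Monic) (hdeg : ∀ k, (P k).natDegree = k) (hpos : ∀ k, 0 < h k)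
    (hint : ∀ j k, IntegrableOn (fun x : ℝ => (cJWeight 2 p 0 x : ℂ) *
      ((P j).eval (Complex.exp (Complex.I * x)) *
        (starRingEnd ℂ) ((P k).eval (Complex.exp (Complex.I * x))))) (Set.Ico 0 (2 * Real.pi)))
    (horth : ∀ j k, ∫ x : ℝ in Set.Ico 0 (2 * Real.pi), (cJWeight 2 p 0 x : ℂ) *
      ((P j).eval (Complex.exp (Complex.I * x)) *
        (starRingEnd ℂ) ((P k).eval (Complex.exp (Complex.I * x)))) =
          if j = k then (h j : ℂ) else 0) (n : ℕ) (θ : ℝ) :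
    cJDensity n 2 p 0 θ = cJWeight 2 p 0 θ *
      ∑ k ∈ Finset.range n, ‖(P k).eval (Complex.exp (Complex.I * θ))‖ ^ 2 / h k := by
  rcases n with _ | n
  · simp [cJDensity]
  set W : ℝ → ℂ := fun x => (cJWeight 2 p 0 x : ℂ) with hW
  have hZ : ((cJPartition (n + 1) 2 p 0 : ℝ) : ℂ) =
      ((n + 1)! : ℂ) * ∏ k : Fin (n + 1), (h k : ℂ) := by
    unfold cJPartition
    rw [← integral_complex_ofReal, angleBox_restrict]
    simp_rw [cJUnnormalised_two_eq_det p P hmon hdeg]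
    refine integral_weighted_det (W := W) (h := fun k : Fin (n + 1) => (h k : ℂ))
      (f := fun j : Fin (n + 1) => fun x => (P j).eval (Complex.exp (Complex.I * x)))
      (fun j k => hint j k) fun j k => ?_
    rw [horth]
    simp [Fin.ext_iff]
  have hN : ((∫ η in angleBox n,
      cJUnnormalised (n + 1) 2 p 0 (Fin.cons θ η : Fin (n + 1) → ℝ) : ℝ) : ℂ) =
      (n ! : ℂ) * (∏ k : Fin (n + 1), (h k : ℂ)) *
        (W θ * ∑ k : Fin (n + 1), (P k).eval (Complex.exp (Complex.I * θ)) *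
          (starRingEnd ℂ) ((P k).eval (Complex.exp (Complex.I * θ))) / (h k : ℂ)) := by
    rw [← integral_complex_ofReal, angleBox_restrict]
    simp_rw [cJUnnormalised_two_eq_det p P hmon hdeg]
    refine integral_weighted_det_cons (W := W) (h := fun k : Fin (n + 1) => (h k : ℂ))
      (f := fun j : Fin (n + 1) => fun x => (P j).eval (Complex.exp (Complex.I * x)))
      (fun j k => hint j k) (fun j k => ?_) (fun k => ?_) θ
    · rw [horth]
      simp [Fin.ext_iff]
    · exact_mod_cast (hpos k).ne'
  have hprod : (∏ k : Fin (n + 1), (h k : ℂ)) ≠ 0 :=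
    Finset.prod_ne_zero_iff.2 fun k _ => by exact_mod_cast (hpos k).ne'
  have hfac : (n ! : ℂ) ≠ 0 := by exact_mod_cast (Nat.factorial_pos n).ne'
  have hn1 : (n : ℂ) + 1 ≠ 0 := by exact_mod_cast Nat.succ_ne_zero n
  have : ((cJDensity (n + 1) 2 p 0 θ : ℝ) : ℂ) = ((cJWeight 2 p 0 θ *
      ∑ k ∈ Finset.range (n + 1), ‖(P k).eval (Complex.exp (Complex.I * θ))‖ ^ 2 / h k : ℝ) : ℂ) := by
    simp only [cJDensity, cJPDF]
    rw [integral_div, Complex.ofReal_mul, Complex.ofReal_div, hZ, hN, Finset.sum_range]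
    push_cast
    simp_rw [Complex.mul_conj, Complex.normSq_eq_norm_sq, Nat.factorial_succ, hW]
    push_cast
    field_simp
  exact_mod_cast this

/-! ### Orthogonal polynomials of the circular Jacobi weight -/

/-- The Verblunsky-type parameter `p / (n + 1 + p)` of the step from degree `n` to `n + 1`. -/
noncomputable def szegoGamma (p : ℝ) (n : ℕ) : ℝ := p / (n + 1 + p)

/-- The pair `(Φ_n, Φ_n^*)` generated by the Szegő recursion
`Φ_{n+1} = z Φ_n + γ_{n+1} Φ_n^*`, `Φ_{n+1}^* = Φ_n^* + γ_{n+1} z Φ_n` with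
`γ_n = p / (n + p)`: the monic orthogonal polynomial of the weight `|1 - e^{iθ}|^{2p}` and its
reversal. -/
noncomputable def szegoPair (p : ℝ) : ℕ → Polynomial ℂ × Polynomial ℂ
  | 0 => (1, 1)
  | n + 1 =>
    (Polynomial.X * (szegoPair p n).1 + Polynomial.C (szegoGamma p n : ℂ) * (szegoPair p n).2,
      (szegoPair p n).2 + Polynomial.C (szegoGamma p n : ℂ) * (Polynomial.X * (szegoPair p n).1))

/-- The monic orthogonal polynomial `Φ_n`. -/
noncomputable def szegoPhi (p : ℝ) (n : ℕ) : Polynomial ℂ := (szegoPair p n).1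

/-- The reversed polynomial `Φ_n^*`. -/
noncomputable def szegoPsi (p : ℝ) (n : ℕ) : Polynomial ℂ := (szegoPair p n).2

@[simp] lemma szegoPhi_zero (p : ℝ) : szegoPhi p 0 = 1 := rfl

@[simp] lemma szegoPsi_zero (p : ℝ) : szegoPsi p 0 = 1 := rfl

lemma szegoPhi_succ (p : ℝ) (n : ℕ) : szegoPhi p (n + 1) =
    Polynomial.X * szegoPhi p n + Polynomial.C (szegoGamma p n : ℂ) * szegoPsi p n := rfl

lemma szegoPsi_succ (p : ℝ) (n : ℕ) : szegoPsi p (n + 1) =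
    szegoPsi p n + Polynomial.C (szegoGamma p n : ℂ) * (Polynomial.X * szegoPhi p n) := rfl

lemma szegoPhi_eval_succ (p : ℝ) (n : ℕ) (z : ℂ) : (szegoPhi p (n + 1)).eval z =
    z * (szegoPhi p n).eval z + szegoGamma p n * (szegoPsi p n).eval z := by
  simp [szegoPhi_succ]

lemma szegoPsi_eval_succ (p : ℝ) (n : ℕ) (z : ℂ) : (szegoPsi p (n + 1)).eval z =
    (szegoPsi p n).eval z + szegoGamma p n * (z * (szegoPhi p n).eval z) := by
  simp [szegoPsi_succ]

lemma szegoPhi_monic_and_degree (p : ℝ) (n : ℕ) :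
    ((szegoPhi p n).Monic ∧ (szegoPhi p n).natDegree = n) ∧ (szegoPsi p n).natDegree ≤ n := by
  induction n with
  | zero => simp
  | succ n ih =>
    obtain ⟨⟨hm, hd⟩, hs⟩ := ih
    have hmX : (Polynomial.X * szegoPhi p n).Monic := Polynomial.monic_X.mul hm
    have hdX : (Polynomial.X * szegoPhi p n).natDegree = n + 1 := by
      rw [Polynomial.natDegree_X_mul hm.ne_zero, hd]
    have hlt : (Polynomial.C (szegoGamma p n : ℂ) * szegoPsi p n).degree <
        (Polynomial.X * szegoPhi p n).degree := by
      rw [Polynomial.degree_eq_natDegree hmX.ne_zero, hdX]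
      refine lt_of_le_of_lt (Polynomial.degree_le_of_natDegree_le
        ((Polynomial.natDegree_C_mul_le _ _).trans hs)) ?_
      exact_mod_cast Nat.lt_succ_self n
    refine ⟨⟨?_, ?_⟩, ?_⟩
    · rw [szegoPhi_succ]
      exact hmX.add_of_left hlt
    · rw [szegoPhi_succ, Polynomial.natDegree_add_eq_left_of_degree_lt hlt, hdX]
    · rw [szegoPsi_succ]
      refine (Polynomial.natDegree_add_le _ _).trans (max_le (hs.trans n.le_succ) ?_)
      exact (Polynomial.natDegree_C_mul_le _ _).trans hdX.le

lemma szegoPhi_monic (p : ℝ) (n : ℕ) : (szegoPhi p n).Monic := (szegoPhi_monic_and_degree p n).1.1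

lemma szegoPhi_natDegree (p : ℝ) (n : ℕ) : (szegoPhi p n).natDegree = n :=
  (szegoPhi_monic_and_degree p n).1.2

lemma szegoPsi_natDegree_le (p : ℝ) (n : ℕ) : (szegoPsi p n).natDegree ≤ n :=
  (szegoPhi_monic_and_degree p n).2

/-- On the unit circle `Φ_n^*(z) = z^n conj (Φ_n(z))`. -/
lemma szegoPsi_eval_eq (p : ℝ) (n : ℕ) {z : ℂ} (hz : z * (starRingEnd ℂ) z = 1) :
    (szegoPsi p n).eval z = z ^ n * (starRingEnd ℂ) ((szegoPhi p n).eval z) := by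
  induction n with
  | zero => simp
  | succ n ih =>
    have h1 : (z ^ n) * (starRingEnd ℂ) (z ^ n) = 1 := by
      rw [map_pow, ← mul_pow, hz, one_pow]
    rw [szegoPsi_eval_succ, szegoPhi_eval_succ, ih]
    simp only [map_add, map_mul, Complex.conj_conj, Complex.conj_ofReal]
    rw [pow_succ]
    linear_combination (-z ^ n * (starRingEnd ℂ) ((szegoPhi p n).eval z)) * hz -
      (szegoGamma p n * z * (szegoPhi p n).eval z) * h1

lemma add_param_pos {p : ℝ} (hp : -(1 / 2) < p) (n : ℕ) : (0 : ℝ) < n + 1 + p := by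
  have : (0 : ℝ) ≤ n := n.cast_nonneg
  linarith

lemma szegoGamma_mul {p : ℝ} (hp : -(1 / 2) < p) (n : ℕ) :
    (szegoGamma p n : ℂ) * (n + 1 + p) = p := by
  have := (add_param_pos hp n).ne'
  rw [szegoGamma]
  have h2 : (n : ℂ) + 1 + p ≠ 0 := by exact_mod_cast this
  push_cast
  field_simp

/-- The differential (ladder) relations of the pair `(Φ_n, Φ_n^*)`. -/
lemma szego_ladder {p : ℝ} (hp : -(1 / 2) < p) (n : ℕ) (z : ℂ) :
    z * (z - 1) * (szegoPhi p n).derivative.eval z =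
        (n * (z - 1) - p) * (szegoPhi p n).eval z + p * (szegoPsi p n).eval z ∧
      (z - 1) * (szegoPsi p n).derivative.eval z =
        p * ((szegoPhi p n).eval z - (szegoPsi p n).eval z) := by
  induction n with
  | zero => simp
  | succ n ih =>
    obtain ⟨h1, h2⟩ := ih
    have hγ := szegoGamma_mul hp n
    have d1 : (szegoPhi p (n + 1)).derivative.eval z = (szegoPhi p n).eval z +
        z * (szegoPhi p n).derivative.eval z +
          szegoGamma p n * (szegoPsi p n).derivative.eval z := by
      simp [szegoPhi_succ, Polynomial.derivative_mul]
    have d2 : (szegoPsi p (n + 1)).derivative.eval z = (szegoPsi p n).derivative.eval z +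
        szegoGamma p n * ((szegoPhi p n).eval z + z * (szegoPhi p n).derivative.eval z) := by
      simp [szegoPsi_succ, Polynomial.derivative_mul]
    rw [d1, d2, szegoPhi_eval_succ, szegoPsi_eval_succ]
    push_cast
    generalize (szegoGamma p n : ℂ) = γ at *
    generalize (szegoPhi p n).eval z = F at *
    generalize (szegoPsi p n).eval z = G at *
    generalize (szegoPhi p n).derivative.eval z = F' at *
    generalize (szegoPsi p n).derivative.eval z = G' at *
    constructor
    · linear_combination z * h1 + γ * z * h2 - (z - 1) * G * hγ
    · linear_combination h2 + γ * h1 + (z - 1) * F * hγ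

/-- The squared norm of `Φ_n`, relative to that of `Φ_0`. -/
noncomputable def szegoNorm (p : ℝ) (n : ℕ) : ℝ :=
  ∏ k ∈ Finset.range n, (1 - szegoGamma p k ^ 2)

lemma szegoNorm_succ (p : ℝ) (n : ℕ) :
    szegoNorm p (n + 1) = szegoNorm p n * (1 - szegoGamma p n ^ 2) := Finset.prod_range_succ _ _

lemma one_sub_szegoGamma_sq {p : ℝ} (hp : -(1 / 2) < p) (n : ℕ) :
    1 - szegoGamma p n ^ 2 = (n + 1) * (n + 1 + 2 * p) / (n + 1 + p) ^ 2 := by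
  have := (add_param_pos hp n).ne'
  rw [szegoGamma]
  field_simp
  ring

lemma add_two_param_pos {p : ℝ} (hp : -(1 / 2) < p) (n : ℕ) : (0 : ℝ) < n + 1 + 2 * p := by
  have : (0 : ℝ) ≤ n := n.cast_nonneg
  linarith

lemma szegoNorm_pos {p : ℝ} (hp : -(1 / 2) < p) (n : ℕ) : 0 < szegoNorm p n := by
  refine Finset.prod_pos fun k _ => ?_
  rw [one_sub_szegoGamma_sq hp]
  have := add_param_pos hp k
  have := add_two_param_pos hp k
  positivity

/-- Christoffel–Darboux formula on the diagonal: the kernel in terms of the last polynomial. -/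
lemma szego_christoffel_darboux {p : ℝ} (hp : -(1 / 2) < p) (n : ℕ) {z : ℂ}
    (hz : z * (starRingEnd ℂ) z = 1) (hz1 : z ≠ 1) :
    ((∑ k ∈ Finset.range n, ‖(szegoPhi p k).eval z‖ ^ 2 / szegoNorm p k : ℝ) : ℂ) =
      ((n + p) * ((szegoPhi p n).eval z * (starRingEnd ℂ) ((szegoPhi p n).eval z)) -
        p * (z * ((szegoPhi p n).eval z * (starRingEnd ℂ) ((szegoPsi p n).eval z)) -
          (starRingEnd ℂ) ((szegoPhi p n).eval z) * (szegoPsi p n).eval z) / (z - 1)) /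
        szegoNorm p n := by
  have hz1' : z - 1 ≠ 0 := sub_ne_zero.2 hz1
  have hnorm : ∀ k, ((szegoNorm p k : ℝ) : ℂ) ≠ 0 := fun k => by
    exact_mod_cast (szegoNorm_pos hp k).ne'
  induction n with
  | zero =>
    simp only [szegoPhi_zero, szegoPsi_zero, szegoNorm]
    simp
    field_simp
    ring
  | succ n ih =>
    have hγ := szegoGamma_mul hp n
    rw [Finset.sum_range_succ, Complex.ofReal_add, ih]
    have h1 : ((‖(szegoPhi p n).eval z‖ ^ 2 / szegoNorm p n : ℝ) : ℂ) =
        (szegoPhi p n).eval z * (starRingEnd ℂ) ((szegoPhi p n).eval z) / szegoNorm p n := by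
      rw [Complex.mul_conj, Complex.normSq_eq_norm_sq]
      push_cast
      rfl
    have hq : 1 - (szegoGamma p n : ℂ) ^ 2 ≠ 0 := by
      have := hnorm (n + 1)
      rw [szegoNorm_succ] at this
      push_cast at this
      exact right_ne_zero_of_mul this
    have hGG : (szegoPsi p n).eval z * (starRingEnd ℂ) ((szegoPsi p n).eval z) =
        (szegoPhi p n).eval z * (starRingEnd ℂ) ((szegoPhi p n).eval z) := by
      rw [szegoPsi_eval_eq p n hz]
      simp only [map_mul, map_pow, Complex.conj_conj]
      rw [show ∀ a b c d : ℂ, a ^ n * b * (c ^ n * d) = (a * c) ^ n * (d * b) by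
        intros; rw [mul_pow]; ring, hz, one_pow, one_mul]
    rw [h1, szegoNorm_succ, szegoPhi_eval_succ, szegoPsi_eval_succ]
    have hn := hnorm n
    have hzc : z * ((starRingEnd ℂ) z) - 1 = 0 := by rw [hz, sub_self]
    simp only [map_add, map_mul, Complex.conj_ofReal]
    push_cast
    generalize ((szegoNorm p n : ℝ) : ℂ) = N at *
    generalize (szegoGamma p n : ℂ) = γ at *
    generalize (szegoPhi p n).eval z = F at *
    generalize (szegoPsi p n).eval z = G at *
    generalize (starRingEnd ℂ) F = F' at *
    generalize (starRingEnd ℂ) G = G' at *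
    generalize (starRingEnd ℂ) z = z' at *
    field_simp
    linear_combination (-2 * γ * (z - 1) * F * F' - z * (z - 1) * F * G' - (1 - z') * F' * G) * hγ -
      ((z - 1) * (n + 1 + p) * F * F' - p * z * γ * F * F' - p * γ ^ 2 * G * F' + p * γ * F * F' +
        (n + 1 + p) * γ * F' * G) * hz -
      (z - 1) * ((n + 1 + p) * γ ^ 2 - p * γ) * hGG

/-! ### The circular Jacobi weight and orthogonality -/

lemma intervalIntegrable_cos_rpow {m : ℝ} (hm : -1 < m) :
    IntervalIntegrable (fun α => Real.cos α ^ m) volume 0 (Real.pi / 2) := by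
  have hpi := Real.pi_pos
  rcases le_or_gt 0 m with h0 | h0
  · exact (Real.continuous_cos.rpow_const fun _ => Or.inr h0).intervalIntegrable _ _
  have h1 : IntervalIntegrable (fun α : ℝ => (2 / Real.pi) ^ m * (Real.pi / 2 - α) ^ m) volume
      0 (Real.pi / 2) := by
    have := (intervalIntegral.intervalIntegrable_rpow' (a := 0) (b := Real.pi / 2) hm).comp_sub_left
      (Real.pi / 2)
    simp only [sub_zero, sub_self] at this
    exact this.symm.const_mul _
  refine h1.mono_fun ?_ ?_
  · exact (Real.measurable_cos.pow_const m).aestronglyMeasurable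
  · rw [Set.uIoc_of_le (by positivity)]
    refine (ae_restrict_iff' measurableSet_Ioc).2 (Eventually.of_forall fun α hα => ?_)
    have hx : 0 ≤ Real.pi / 2 - α := by linarith [hα.2]
    have hc : 2 / Real.pi * (Real.pi / 2 - α) ≤ Real.cos α := by
      rw [← Real.sin_pi_div_two_sub]
      exact Real.mul_le_sin hx (by linarith [hα.1])
    have hc0 : 0 ≤ 2 / Real.pi * (Real.pi / 2 - α) := by positivity
    change ‖Real.cos α ^ m‖ ≤ ‖(2 / Real.pi) ^ m * (Real.pi / 2 - α) ^ m‖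
    rw [Real.norm_of_nonneg (Real.rpow_nonneg (hc0.trans hc) _),
      Real.norm_of_nonneg (by positivity), ← Real.mul_rpow (by positivity) hx]
    rcases hx.eq_or_lt with h | h
    · rw [← h]
      have : α = Real.pi / 2 := by linarith
      rw [this]
      simp
    · exact Real.rpow_le_rpow_of_nonpos (by positivity) hc h0.le

lemma intervalIntegrable_sin_rpow {m : ℝ} (hm : -1 < m) :
    IntervalIntegrable (fun α => Real.sin α ^ m) volume 0 Real.pi := by
  have hc := intervalIntegrable_cos_rpow hm
  have h1 : IntervalIntegrable (fun α => Real.sin α ^ m) volume 0 (Real.pi / 2) := by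
    have := hc.comp_sub_left (Real.pi / 2)
    simp only [sub_zero, sub_self, Real.cos_pi_div_two_sub] at this
    exact this.symm
  have h2 : IntervalIntegrable (fun α => Real.sin α ^ m) volume (Real.pi / 2) Real.pi := by
    have := h1.comp_sub_left Real.pi
    simp only [sub_zero, Real.sin_pi_sub] at this
    rw [show Real.pi - Real.pi / 2 = Real.pi / 2 by ring] at this
    exact this.symm
  exact h1.trans h2

lemma norm_one_sub_exp {θ : ℝ} (h0 : 0 ≤ θ) (h1 : θ ≤ 2 * Real.pi) :
    ‖1 - Complex.exp (Complex.I * θ)‖ = 2 * Real.sin (θ / 2) := by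
  have : 1 - Complex.exp (Complex.I * θ) =
      -(2 * Complex.I * Real.sin (θ / 2)) * Complex.exp ((θ / 2 : ℝ) * Complex.I) := by
    have e : Complex.exp (Complex.I * θ) = Complex.exp ((θ / 2 : ℝ) * Complex.I) *
        Complex.exp ((θ / 2 : ℝ) * Complex.I) := by
      rw [← Complex.exp_add]
      push_cast
      ring_nf
    have hm : Complex.exp (-((θ / 2 : ℝ) : ℂ) * Complex.I) *
        Complex.exp ((θ / 2 : ℝ) * Complex.I) = 1 := by
      rw [← Complex.exp_add]
      simp
    rw [e, Complex.ofReal_sin, Complex.sin]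
    linear_combination (-1 : ℂ) * hm + (Complex.exp (-((θ / 2 : ℝ) : ℂ) * Complex.I) *
      Complex.exp ((θ / 2 : ℝ) * Complex.I) - Complex.exp ((θ / 2 : ℝ) * Complex.I) *
        Complex.exp ((θ / 2 : ℝ) * Complex.I)) * Complex.I_sq
  rw [this, norm_mul, Complex.norm_exp_ofReal_mul_I, mul_one, norm_neg, norm_mul, norm_mul,
    Complex.norm_I, Complex.norm_real, Real.norm_of_nonneg]
  · simp
  · exact Real.sin_nonneg_of_nonneg_of_le_pi (by linarith) (by linarith)

lemma cJWeight_two_eq_norm (p θ : ℝ) :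
    cJWeight 2 p 0 θ = ‖1 - Complex.exp (Complex.I * θ)‖ ^ (2 * p) := by
  simp [cJWeight]

lemma cJWeight_two_eq (p : ℝ) {θ : ℝ} (h0 : 0 ≤ θ) (h1 : θ ≤ 2 * Real.pi) :
    cJWeight 2 p 0 θ = 2 ^ (2 * p) * Real.sin (θ / 2) ^ (2 * p) := by
  rw [cJWeight_two_eq_norm, norm_one_sub_exp h0 h1, Real.mul_rpow (by norm_num)]
  exact Real.sin_nonneg_of_nonneg_of_le_pi (by linarith) (by linarith)

lemma intervalIntegrable_cJWeight {p : ℝ} (hp : -(1 / 2) < p) :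
    IntervalIntegrable (fun θ => cJWeight 2 p 0 θ) volume 0 (2 * Real.pi) := by
  have h := (intervalIntegrable_sin_rpow (m := 2 * p) (by linarith)).comp_mul_left (c := 2⁻¹)
  simp only [div_inv_eq_mul, zero_mul] at h
  rw [mul_comm Real.pi 2] at h
  refine (h.const_mul (2 ^ (2 * p))).congr ?_
  intro θ hθ
  rw [Set.uIoc_of_le (by positivity)] at hθ
  simp only
  rw [cJWeight_two_eq p hθ.1.le hθ.2, inv_mul_eq_div]

/-- The integral `∫₀^{2π} |1 - e^{iθ}|^{2p} g(e^{iθ}) dθ`. -/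
noncomputable def circMean (p : ℝ) (g : ℂ → ℂ) : ℂ :=
  ∫ θ in (0 : ℝ)..2 * Real.pi, (cJWeight 2 p 0 θ : ℂ) * g (Complex.exp (Complex.I * θ))

lemma exp_I_mul_conj (θ : ℝ) : Complex.exp (Complex.I * θ) *
    (starRingEnd ℂ) (Complex.exp (Complex.I * θ)) = 1 := by
  rw [← Complex.exp_conj, ← Complex.exp_add]
  simp

lemma intervalIntegrable_circMean {p : ℝ} (hp : -(1 / 2) < p) {g : ℂ → ℂ} (hg : Continuous g) :
    IntervalIntegrable
      (fun θ : ℝ => (cJWeight 2 p 0 θ : ℂ) * g (Complex.exp (Complex.I * θ))) volume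
      0 (2 * Real.pi) := by
  have h : IntervalIntegrable (fun θ => (cJWeight 2 p 0 θ : ℂ)) volume 0 (2 * Real.pi) :=
    ⟨(intervalIntegrable_cJWeight hp).1.ofReal, (intervalIntegrable_cJWeight hp).2.ofReal⟩
  exact h.mul_continuousOn (by fun_prop)

lemma circMean_congr (p : ℝ) {g g' : ℂ → ℂ} (h : ∀ z, z * (starRingEnd ℂ) z = 1 → g z = g' z) :
    circMean p g = circMean p g' := by
  unfold circMean
  simp_rw [h _ (exp_I_mul_conj _)]

lemma circMean_add {p : ℝ} (hp : -(1 / 2) < p) {g g' : ℂ → ℂ} (hg : Continuous g)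
    (hg' : Continuous g') :
    circMean p (fun z => g z + g' z) = circMean p g + circMean p g' := by
  unfold circMean
  simp_rw [mul_add]
  exact intervalIntegral.integral_add (intervalIntegrable_circMean hp hg)
    (intervalIntegrable_circMean hp hg')

lemma circMean_const_mul (p : ℝ) (c : ℂ) (g : ℂ → ℂ) :
    circMean p (fun z => c * g z) = c * circMean p g := by
  unfold circMean
  simp_rw [mul_left_comm _ c]
  exact intervalIntegral.integral_const_mul _ _

lemma circMean_conj (p : ℝ) (g : ℂ → ℂ) :
    circMean p (fun z => (starRingEnd ℂ) (g z)) = (starRingEnd ℂ) (circMean p g) := by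
  unfold circMean
  rw [intervalIntegral.integral_of_le (by positivity),
    intervalIntegral.integral_of_le (by positivity), ← integral_conj]
  simp

/-- Integration by parts against the weight: the derivative of
`|1 - e^{iθ}|^{2p} (1 - e^{-iθ}) Φ_n(e^{iθ})` has integral zero. -/
lemma circMean_szegoPhi_relation {p : ℝ} (hp : -(1 / 2) < p) (n : ℕ) :
    (p + n) * circMean p (fun z => (szegoPhi p n).eval z) -
      (n - 1) * circMean p (fun z => (szegoPhi p n).eval z * (starRingEnd ℂ) z) +
      p * circMean p (fun z => (szegoPsi p n).eval z * (starRingEnd ℂ) z) = 0 := by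
  have c1 : Continuous fun z : ℂ => (szegoPhi p n).eval z := (szegoPhi p n).continuous
  have c2 : Continuous fun z : ℂ => (szegoPsi p n).eval z := (szegoPsi p n).continuous
  have c3 : Continuous fun z : ℂ => (starRingEnd ℂ) z := Complex.continuous_conj
  set g : ℂ → ℂ := fun z => (p + n) * (szegoPhi p n).eval z +
    ((-(n - 1 : ℂ)) * ((szegoPhi p n).eval z * (starRingEnd ℂ) z) +
      p * ((szegoPsi p n).eval z * (starRingEnd ℂ) z)) with hg
  have hgc : Continuous g := by fun_prop
  have hsplit : circMean p g = (p + n) * circMean p (fun z => (szegoPhi p n).eval z) -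
      (n - 1) * circMean p (fun z => (szegoPhi p n).eval z * (starRingEnd ℂ) z) +
      p * circMean p (fun z => (szegoPsi p n).eval z * (starRingEnd ℂ) z) := by
    rw [hg, circMean_add hp (by fun_prop) (by fun_prop), circMean_add hp (by fun_prop)
      (by fun_prop), circMean_const_mul, circMean_const_mul, circMean_const_mul]
    ring
  rw [← hsplit]
  set G : ℝ → ℂ := fun θ => (((2 * Real.sin (θ / 2)) ^ (2 * p + 1) : ℝ) : ℂ) *
    (Complex.I * Complex.exp (-(Complex.I * (θ / 2))) *
      (szegoPhi p n).eval (Complex.exp (Complex.I * θ))) with hG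
  have hGc : Continuous G := by
    have : Continuous fun θ : ℝ => (2 * Real.sin (θ / 2)) ^ (2 * p + 1) :=
      Continuous.rpow_const (by fun_prop) fun _ => Or.inr (by linarith)
    have h2 : Continuous fun θ : ℝ => (((2 * Real.sin (θ / 2)) ^ (2 * p + 1) : ℝ) : ℂ) :=
      Complex.continuous_ofReal.comp this
    exact h2.mul (by fun_prop)
  have hderiv : ∀ θ ∈ Set.Ioo (0 : ℝ) (2 * Real.pi), HasDerivAt G
      (Complex.I * ((cJWeight 2 p 0 θ : ℂ) * g (Complex.exp (Complex.I * θ)))) θ := by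
    intro θ hθ
    have hs : 0 < Real.sin (θ / 2) :=
      Real.sin_pos_of_pos_of_lt_pi (by linarith [hθ.1]) (by linarith [hθ.2])
    have d0 : HasDerivAt (fun θ : ℝ => 2 * Real.sin (θ / 2)) (Real.cos (θ / 2)) θ := by
      have := (((hasDerivAt_id θ).div_const 2).sin).const_mul 2
      refine this.congr_deriv ?_
      simp only [id]
      ring
    have d1 : HasDerivAt (fun θ : ℝ => (((2 * Real.sin (θ / 2)) ^ (2 * p + 1) : ℝ) : ℂ))
        (((Real.cos (θ / 2) * (2 * p + 1) * (2 * Real.sin (θ / 2)) ^ (2 * p + 1 - 1) : ℝ)) : ℂ)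
        θ := (d0.rpow_const (Or.inl (by positivity))).ofReal_comp
    have hid : HasDerivAt (fun θ : ℝ => (θ : ℂ)) 1 θ := (hasDerivAt_id θ).ofReal_comp
    have d2 : HasDerivAt (fun θ : ℝ => Complex.exp (-(Complex.I * ((θ : ℂ) / 2))))
        (Complex.exp (-(Complex.I * (θ / 2))) * (-(Complex.I * (1 / 2)))) θ :=
      ((hid.div_const 2).const_mul Complex.I).neg.cexp
    have d3 : HasDerivAt (fun θ : ℝ => Complex.exp (Complex.I * θ))
        (Complex.exp (Complex.I * θ) * (Complex.I * 1)) θ := (hid.const_mul Complex.I).cexp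
    have d4 : HasDerivAt (fun θ : ℝ => (szegoPhi p n).eval (Complex.exp (Complex.I * θ)))
        ((szegoPhi p n).derivative.eval (Complex.exp (Complex.I * θ)) *
          (Complex.exp (Complex.I * θ) * (Complex.I * 1))) θ :=
      ((szegoPhi p n).hasDerivAt _).comp θ d3
    have d5 := d1.mul ((d2.const_mul Complex.I).mul d4)
    refine d5.congr_deriv ?_
    have hlad := (szego_ladder hp n (Complex.exp (Complex.I * θ))).1
    have hw : cJWeight 2 p 0 θ = (2 * Real.sin (θ / 2)) ^ (2 * p) := by
      rw [cJWeight_two_eq_norm, norm_one_sub_exp hθ.1.le hθ.2.le]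
    have e1 : (2 * Real.sin (θ / 2)) ^ (2 * p + 1 - 1) = cJWeight 2 p 0 θ := by
      rw [hw]
      ring_nf
    have e2 : (2 * Real.sin (θ / 2)) ^ (2 * p + 1) =
        cJWeight 2 p 0 θ * (2 * Real.sin (θ / 2)) := by
      rw [hw, Real.rpow_add_one (by positivity)]
    have hz : Complex.exp (Complex.I * θ) = Complex.exp (Complex.I * (θ / 2)) *
        Complex.exp (Complex.I * (θ / 2)) := by
      rw [← Complex.exp_add]
      ring_nf
    have hzc : (starRingEnd ℂ) (Complex.exp (Complex.I * θ)) =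
        Complex.exp (-(Complex.I * (θ / 2))) * Complex.exp (-(Complex.I * (θ / 2))) := by
      rw [← Complex.exp_conj, ← Complex.exp_add]
      simp
      ring_nf
    have hinv : Complex.exp (Complex.I * (θ / 2)) * Complex.exp (-(Complex.I * (θ / 2))) = 1 := by
      rw [← Complex.exp_add]
      simp
    have hsin : Complex.sin ((θ : ℂ) / 2) = (Complex.exp (-(Complex.I * (θ / 2))) -
        Complex.exp (Complex.I * (θ / 2))) * Complex.I / 2 := by
      rw [Complex.sin]
      ring_nf
    have hcos : Complex.cos ((θ : ℂ) / 2) = (Complex.exp (Complex.I * (θ / 2)) +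
        Complex.exp (-(Complex.I * (θ / 2)))) / 2 := by
      rw [Complex.cos]
      ring_nf
    rw [e1, e2]
    simp only [hg, Pi.mul_apply]
    rw [hzc]
    push_cast
    rw [hsin, hcos]
    generalize (szegoPsi p n).eval (Complex.exp (Complex.I * θ)) = Ψ at *
    generalize (szegoPhi p n).eval (Complex.exp (Complex.I * θ)) = Φ at *
    generalize (szegoPhi p n).derivative.eval (Complex.exp (Complex.I * θ)) = Φ' at *
    rw [hz] at hlad ⊢
    generalize Complex.exp (Complex.I * (θ / 2)) = e at *
    generalize Complex.exp (-(Complex.I * (θ / 2))) = E at *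
    generalize (cJWeight 2 p 0 θ : ℂ) = w at *
    linear_combination (Complex.I * w * E ^ 2) * hlad +
      (w * Complex.I * Φ * (p + n * (e * E + 1)) - Complex.I * w * Φ' * e ^ 3 * E) * hinv +
      ((E - e) * E * e ^ 2 * w * Φ' * Complex.I - w * (E - e) * E * Φ * Complex.I / 2) *
        Complex.I_sq
  have hFTC := intervalIntegral.integral_eq_sub_of_hasDerivAt_of_le (by positivity)
    hGc.continuousOn hderiv ((intervalIntegrable_circMean hp hgc).const_mul Complex.I)
  have h0 : G 0 = 0 := by
    simp [hG, Real.zero_rpow (show 2 * p + 1 ≠ 0 by linarith)]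
  have h1 : G (2 * Real.pi) = 0 := by
    simp [hG, Real.zero_rpow (show 2 * p + 1 ≠ 0 by linarith)]
  rw [h0, h1, sub_zero, intervalIntegral.integral_const_mul] at hFTC
  exact (mul_eq_zero.1 hFTC).resolve_left Complex.I_ne_zero

lemma conj_eq_one_comm {z : ℂ} (hz : z * (starRingEnd ℂ) z = 1) (k : ℕ) :
    z ^ k * (starRingEnd ℂ) z ^ k = 1 := by
  rw [← mul_pow, hz, one_pow]

/-- `Φ_n` is orthogonal to the lower powers of `z`. -/
lemma circMean_szegoPhi_mul_conj_pow {p : ℝ} (hp : -(1 / 2) < p) (n : ℕ) :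
    ∀ k < n, circMean p (fun z => (szegoPhi p n).eval z * (starRingEnd ℂ) z ^ k) = 0 := by
  induction n with
  | zero => simp
  | succ n ih =>
    have c1 : Continuous fun z : ℂ => (szegoPhi p n).eval z := (szegoPhi p n).continuous
    have c2 : Continuous fun z : ℂ => (szegoPsi p n).eval z := (szegoPsi p n).continuous
    have c3 : Continuous fun z : ℂ => (starRingEnd ℂ) z := Complex.continuous_conj
    -- The powers `1 ≤ k ≤ n` are handled by the recursion and the induction hypothesis.
    have hpos : ∀ k, k + 1 < n + 1 →
        circMean p (fun z => (szegoPhi p (n + 1)).eval z * (starRingEnd ℂ) z ^ (k + 1)) = 0 := by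
      intro k hk
      have hk' : k < n := by omega
      have e : circMean p (fun z => (szegoPhi p (n + 1)).eval z * (starRingEnd ℂ) z ^ (k + 1)) =
          circMean p (fun z => (szegoPhi p n).eval z * (starRingEnd ℂ) z ^ k +
            szegoGamma p n * (starRingEnd ℂ)
              ((szegoPhi p n).eval z * (starRingEnd ℂ) z ^ (n - (k + 1)))) := by
        refine circMean_congr p fun z hz => ?_
        have h1 : z ^ n = z ^ (k + 1) * z ^ (n - (k + 1)) := by
          rw [← pow_add]
          congr 1
          omega
        rw [szegoPhi_eval_succ, szegoPsi_eval_eq p n hz, map_mul, map_pow, Complex.conj_conj, h1]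
        linear_combination ((szegoPhi p n).eval z * (starRingEnd ℂ) z ^ k) * hz +
          (szegoGamma p n * z ^ (n - (k + 1)) * (starRingEnd ℂ) ((szegoPhi p n).eval z)) *
            conj_eq_one_comm hz (k + 1)
      rw [e, circMean_add hp (by fun_prop) (by fun_prop), ih k hk', circMean_const_mul,
        circMean_conj, ih _ (by omega)]
      simp
    intro k hk
    rcases k with _ | k
    · have hrel := circMean_szegoPhi_relation hp (n + 1)
      have hb : circMean p (fun z => (szegoPsi p (n + 1)).eval z * (starRingEnd ℂ) z) =
          (starRingEnd ℂ) (circMean p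
            (fun z => (szegoPhi p (n + 1)).eval z * (starRingEnd ℂ) z ^ n)) := by
        rw [← circMean_conj]
        refine circMean_congr p fun z hz => ?_
        rw [szegoPsi_eval_eq p _ hz, map_mul, map_pow, Complex.conj_conj]
        linear_combination (z ^ n * (starRingEnd ℂ) ((szegoPhi p (n + 1)).eval z)) * hz
      rw [hb] at hrel
      simp only [pow_zero, mul_one]
      rcases n with _ | n
      · simp only [pow_zero, mul_one] at hrel
        set x := circMean p (fun z => (szegoPhi p (0 + 1)).eval z) with hx
        have h1 : ((p : ℂ) + 1) * x = -(p * (starRingEnd ℂ) x) := by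
          push_cast at hrel
          linear_combination hrel
        have h2 := congrArg norm h1
        rw [norm_neg, norm_mul, norm_mul, Complex.norm_conj, Complex.norm_real] at h2
        rw [show (p : ℂ) + 1 = ((p + 1 : ℝ) : ℂ) by push_cast; rfl, Complex.norm_real,
          Real.norm_eq_abs, Real.norm_eq_abs, abs_of_pos (by linarith : 0 < p + 1)] at h2
        have h3 : |p| < p + 1 := abs_lt.2 ⟨by linarith, by linarith⟩
        have h4 : (p + 1 - |p|) * ‖x‖ = 0 := by linarith
        exact norm_eq_zero.1 ((mul_eq_zero.1 h4).resolve_left (by linarith))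
      · have h1 := hpos 0 (by omega)
        have h2 := hpos n (by omega)
        rw [h2] at hrel
        simp only [zero_add, pow_one] at h1
        rw [h1] at hrel
        simp only [mul_zero, sub_zero, map_zero, add_zero] at hrel
        refine (mul_eq_zero.1 hrel).resolve_left ?_
        have := add_param_pos hp (n + 1)
        have h5 : (p : ℂ) + ((n + 1 + 1 : ℕ) : ℂ) = ((((n + 1 : ℕ) : ℝ) + 1 + p : ℝ) : ℂ) := by
          push_cast
          ring
        rw [h5]
        exact_mod_cast this.ne'
    · exact hpos k hk

/-- `Φ_n` is orthogonal to every polynomial of lower degree. -/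
lemma circMean_szegoPhi_mul_conj_poly {p : ℝ} (hp : -(1 / 2) < p) {n : ℕ} {q : Polynomial ℂ}
    (hq : q.natDegree < n) :
    circMean p (fun z => (szegoPhi p n).eval z * (starRingEnd ℂ) (q.eval z)) = 0 := by
  have hsum : ∀ s : Finset ℕ, (∀ k ∈ s, k < n) → circMean p (fun z => ∑ k ∈ s,
      (starRingEnd ℂ) (q.coeff k) * ((szegoPhi p n).eval z * (starRingEnd ℂ) z ^ k)) = 0 := by
    intro s
    have c1 : Continuous fun z : ℂ => (szegoPhi p n).eval z := (szegoPhi p n).continuous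
    have c3 : Continuous fun z : ℂ => (starRingEnd ℂ) z := Complex.continuous_conj
    induction s using Finset.induction_on with
    | empty => intro _; simp [circMean]
    | insert a s ha ih =>
      intro hs
      simp_rw [Finset.sum_insert ha]
      rw [circMean_add hp (by fun_prop) (by fun_prop), circMean_const_mul,
        circMean_szegoPhi_mul_conj_pow hp n a (hs a (Finset.mem_insert_self a s)),
        ih fun k hk => hs k (Finset.mem_insert_of_mem hk)]
      simp
  rw [← hsum (Finset.range n) fun k hk => Finset.mem_range.1 hk]
  refine circMean_congr p fun z _ => ?_
  rw [Polynomial.eval_eq_sum_range' hq, map_sum, Finset.mul_sum]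
  refine Finset.sum_congr rfl fun k _ => ?_
  rw [map_mul, map_pow]
  ring

/-- Total mass of the weight. -/
noncomputable def weightMass (p : ℝ) : ℝ := ∫ θ in (0 : ℝ)..2 * Real.pi, cJWeight 2 p 0 θ

lemma circMean_szegoPhi_norm {p : ℝ} (hp : -(1 / 2) < p) (n : ℕ) :
    circMean p (fun z => (szegoPhi p n).eval z * (starRingEnd ℂ) ((szegoPhi p n).eval z)) =
      (weightMass p * szegoNorm p n : ℝ) := by
  induction n with
  | zero =>
    simp only [szegoPhi_zero, szegoNorm, weightMass, circMean]
    simp [intervalIntegral.integral_ofReal]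
  | succ n ih =>
    have c1 : Continuous fun z : ℂ => (szegoPhi p n).eval z := (szegoPhi p n).continuous
    have c2 : Continuous fun z : ℂ => (szegoPsi p n).eval z := (szegoPsi p n).continuous
    have c4 : Continuous fun z : ℂ => (szegoPhi p (n + 1)).eval z :=
      (szegoPhi p (n + 1)).continuous
    have c3 : Continuous fun z : ℂ => (starRingEnd ℂ) z := Complex.continuous_conj
    have hlow := circMean_szegoPhi_mul_conj_poly hp (n := n + 1) (q := szegoPsi p n)
      (Nat.lt_succ_of_le (szegoPsi_natDegree_le p n))
    -- Expand `|z Φ_n|² = |Φ_{n+1} - γ Φ_n^*|²`.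
    have e : circMean p
        (fun z => (szegoPhi p n).eval z * (starRingEnd ℂ) ((szegoPhi p n).eval z)) =
        circMean p (fun z => (szegoPhi p (n + 1)).eval z *
            (starRingEnd ℂ) ((szegoPhi p (n + 1)).eval z) +
          ((-(szegoGamma p n : ℂ)) * ((szegoPhi p (n + 1)).eval z *
              (starRingEnd ℂ) ((szegoPsi p n).eval z)) +
          ((-(szegoGamma p n : ℂ)) * (starRingEnd ℂ) ((szegoPhi p (n + 1)).eval z *
              (starRingEnd ℂ) ((szegoPsi p n).eval z)) +
            (szegoGamma p n : ℂ) ^ 2 * ((szegoPhi p n).eval z *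
              (starRingEnd ℂ) ((szegoPhi p n).eval z))))) := by
      refine circMean_congr p fun z hz => ?_
      rw [szegoPhi_eval_succ, szegoPsi_eval_eq p n hz]
      simp only [map_mul, map_add, map_pow, Complex.conj_conj, Complex.conj_ofReal]
      linear_combination (-(szegoPhi p n).eval z * (starRingEnd ℂ) ((szegoPhi p n).eval z)) * hz +
        (szegoGamma p n : ℂ) ^ 2 * (szegoPhi p n).eval z *
          (starRingEnd ℂ) ((szegoPhi p n).eval z) * conj_eq_one_comm hz n
    rw [circMean_add hp (by fun_prop) (by fun_prop), circMean_add hp (by fun_prop) (by fun_prop),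
      circMean_add hp (by fun_prop) (by fun_prop), circMean_const_mul, circMean_const_mul,
      circMean_const_mul, circMean_conj, hlow, ih] at e
    simp only [map_zero, mul_zero, zero_add] at e
    rw [szegoNorm_succ]
    push_cast at e ⊢
    linear_combination -e

lemma circMean_szegoPhi_orthogonal {p : ℝ} (hp : -(1 / 2) < p) (j k : ℕ) :
    circMean p (fun z => (szegoPhi p j).eval z * (starRingEnd ℂ) ((szegoPhi p k).eval z)) =
      if j = k then ((weightMass p * szegoNorm p j : ℝ) : ℂ) else 0 := by
  rcases lt_trichotomy j k with h | rfl | h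
  · rw [if_neg h.ne]
    have := circMean_szegoPhi_mul_conj_poly hp (n := k) (q := szegoPhi p j)
      (by rwa [szegoPhi_natDegree])
    have h2 := congrArg (starRingEnd ℂ) this
    rw [← circMean_conj, map_zero] at h2
    rw [← h2]
    simp [mul_comm]
  · rw [if_pos rfl, circMean_szegoPhi_norm hp]
  · rw [if_neg h.ne']
    exact circMean_szegoPhi_mul_conj_poly hp (by rwa [szegoPhi_natDegree])

lemma weightMass_eq {p : ℝ} (hp : -(1 / 2) < p) :
    weightMass p = 4 * 2 ^ (2 * p) * ∫ α in (0 : ℝ)..Real.pi / 2, Real.cos α ^ (2 * p) := by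
  have hpi := Real.pi_pos
  have hs := intervalIntegrable_sin_rpow (m := 2 * p) (by linarith)
  have h1 : weightMass p = ∫ θ in (0 : ℝ)..2 * Real.pi,
      2 ^ (2 * p) * Real.sin (θ / 2) ^ (2 * p) := by
    refine intervalIntegral.integral_congr fun θ hθ => ?_
    rw [Set.uIcc_of_le (by positivity)] at hθ
    exact cJWeight_two_eq p hθ.1 hθ.2
  have h2 : ∫ α in (0 : ℝ)..Real.pi / 2, Real.sin α ^ (2 * p) =
      ∫ α in (0 : ℝ)..Real.pi / 2, Real.cos α ^ (2 * p) := by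
    have := intervalIntegral.integral_comp_sub_left (a := 0) (b := Real.pi / 2)
      (fun α => Real.cos α ^ (2 * p)) (Real.pi / 2)
    simpa [Real.cos_pi_div_two_sub] using this
  have h3 : ∫ α in (Real.pi / 2)..Real.pi, Real.sin α ^ (2 * p) =
      ∫ α in (0 : ℝ)..Real.pi / 2, Real.sin α ^ (2 * p) := by
    have := intervalIntegral.integral_comp_sub_left (a := Real.pi / 2) (b := Real.pi)
      (fun α => Real.sin α ^ (2 * p)) Real.pi
    simp only [Real.sin_pi_sub, sub_self] at this
    rwa [show Real.pi - Real.pi / 2 = Real.pi / 2 by ring] at this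
  have hsub : Set.uIcc 0 (Real.pi / 2) ⊆ Set.uIcc 0 Real.pi := by
    rw [Set.uIcc_of_le (by positivity), Set.uIcc_of_le hpi.le]
    exact Set.Icc_subset_Icc_right (by linarith)
  have hsub' : Set.uIcc (Real.pi / 2) Real.pi ⊆ Set.uIcc 0 Real.pi := by
    rw [Set.uIcc_of_le (by linarith), Set.uIcc_of_le hpi.le]
    exact Set.Icc_subset_Icc_left (by positivity)
  have h4 := intervalIntegral.integral_add_adjacent_intervals (hs.mono_set hsub)
    (hs.mono_set hsub')
  have h5 := intervalIntegral.integral_comp_div (a := 0) (b := 2 * Real.pi)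
    (fun u => Real.sin u ^ (2 * p)) (c := 2) two_ne_zero
  rw [zero_div, mul_div_cancel_left₀ _ (two_ne_zero' ℝ)] at h5
  rw [h1, intervalIntegral.integral_const_mul, h5, ← h4, h3, h2, smul_eq_mul]
  ring

lemma integral_cos_rpow_pos {m : ℝ} (hm : -1 < m) :
    0 < ∫ α in (0 : ℝ)..Real.pi / 2, Real.cos α ^ m := by
  refine intervalIntegral.intervalIntegral_pos_of_pos_on (intervalIntegrable_cos_rpow hm) ?_
    (by positivity)
  intro α hα
  exact Real.rpow_pos_of_pos (Real.cos_pos_of_mem_Ioo ⟨by linarith [hα.1, Real.pi_pos], hα.2⟩) _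

lemma weightMass_pos {p : ℝ} (hp : -(1 / 2) < p) : 0 < weightMass p := by
  rw [weightMass_eq hp]
  have := integral_cos_rpow_pos (m := 2 * p) (by linarith)
  positivity

/-- The one-point function through the orthogonal polynomials `Φ_k`. -/
lemma cJDensity_two_eq {p : ℝ} (hp : -(1 / 2) < p) (n : ℕ) (θ : ℝ) :
    cJDensity n 2 p 0 θ = cJWeight 2 p 0 θ / weightMass p *
      ∑ k ∈ Finset.range n,
        ‖(szegoPhi p k).eval (Complex.exp (Complex.I * θ))‖ ^ 2 / szegoNorm p k := by
  have hM := weightMass_pos hp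
  have hset : ∀ j k, IntegrableOn (fun x : ℝ => (cJWeight 2 p 0 x : ℂ) *
      ((szegoPhi p j).eval (Complex.exp (Complex.I * x)) *
        (starRingEnd ℂ) ((szegoPhi p k).eval (Complex.exp (Complex.I * x)))))
        (Set.Ico 0 (2 * Real.pi)) := by
    intro j k
    have c1 : Continuous fun z : ℂ => (szegoPhi p j).eval z := (szegoPhi p j).continuous
    have c2 : Continuous fun z : ℂ => (szegoPhi p k).eval z := (szegoPhi p k).continuous
    have c3 : Continuous fun z : ℂ => (starRingEnd ℂ) z := Complex.continuous_conj
    have := intervalIntegrable_circMean hp (g := fun z => (szegoPhi p j).eval z *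
      (starRingEnd ℂ) ((szegoPhi p k).eval z)) (by fun_prop)
    rw [intervalIntegrable_iff_integrableOn_Ico_of_le (by positivity)] at this
    exact this
  rw [cJDensity_eq_sum p (szegoPhi p) (fun k => weightMass p * szegoNorm p k) (szegoPhi_monic p)
    (szegoPhi_natDegree p) (fun k => mul_pos hM (szegoNorm_pos hp k)) hset ?_ n θ]
  · rw [div_mul_eq_mul_div, mul_div_assoc, Finset.sum_div]
    congr 1
    refine Finset.sum_congr rfl fun k _ => ?_
    rw [div_div, mul_comm (weightMass p)]
  · intro j k
    have := circMean_szegoPhi_orthogonal hp j k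
    rw [circMean, intervalIntegral.integral_of_le (by positivity), integral_Ioc_eq_integral_Ioo,
      ← integral_Ico_eq_integral_Ioo] at this
    exact this

/-! ### Scaling limit of the density at the spectrum singularity -/

/-- `(p + 1)_k / (2p + 1)_k`. -/
noncomputable def pochRatioA (p : ℝ) (k : ℕ) : ℝ :=
  ∏ j ∈ Finset.range k, ((j : ℝ) + 1 + p) / (j + 1 + 2 * p)

/-- `(p)_k / (2p + 1)_k`. -/
noncomputable def pochRatioB (p : ℝ) (k : ℕ) : ℝ :=
  ∏ j ∈ Finset.range k, ((j : ℝ) + p) / (j + 1 + 2 * p)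

lemma pochRatioA_succ (p : ℝ) (k : ℕ) :
    pochRatioA p (k + 1) = pochRatioA p k * ((k + 1 + p) / (k + 1 + 2 * p)) :=
  Finset.prod_range_succ _ _

lemma pochRatioB_succ (p : ℝ) (k : ℕ) :
    pochRatioB p (k + 1) = pochRatioB p k * ((k + p) / (k + 1 + 2 * p)) :=
  Finset.prod_range_succ _ _

lemma pochRatioB_mul (p : ℝ) (k : ℕ) :
    pochRatioB p k * (k + p) = p * pochRatioA p k := by
  induction k with
  | zero => simp [pochRatioA, pochRatioB]
  | succ k ih =>
    rw [pochRatioB_succ, pochRatioA_succ]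
    push_cast
    linear_combination (k + 1 + p) / (k + 1 + 2 * p) * ih

lemma pochRatioA_succ_mul {p : ℝ} (hp : -(1 / 2) < p) (k : ℕ) :
    pochRatioA p (k + 1) * (k + 1 + 2 * p) = pochRatioA p k * (k + 1 + p) := by
  rw [pochRatioA_succ, mul_assoc, div_mul_cancel₀ _ (add_two_param_pos hp k).ne']

/-- A constant `C` with `|(p + 1)_k / (2p + 1)_k|, |(p)_k / (2p + 1)_k| ≤ C ^ k`. -/
noncomputable def pochBound (p : ℝ) : ℝ := (1 + |p|) / min 1 (1 + 2 * p)

lemma pochBound_pos {p : ℝ} (hp : -(1 / 2) < p) : 0 < pochBound p := by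
  have : 0 < min 1 (1 + 2 * p) := lt_min one_pos (by linarith)
  unfold pochBound
  positivity

lemma add_abs_div_le_pochBound {p : ℝ} (hp : -(1 / 2) < p) (j : ℕ) :
    ((j : ℝ) + 1 + |p|) / (j + 1 + 2 * p) ≤ pochBound p := by
  have h1 := add_two_param_pos hp j
  have h2 : 0 < min 1 (1 + 2 * p) := lt_min one_pos (by linarith)
  have hj : (0 : ℝ) ≤ j := j.cast_nonneg
  rw [pochBound, div_le_div_iff₀ h1 h2]
  have h3 : min 1 (1 + 2 * p) * (j + 1) ≤ j + 1 + 2 * p := by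
    rcases le_total 0 p with h | h
    · have := min_le_left 1 (1 + 2 * p)
      nlinarith
    · have := min_le_right 1 (1 + 2 * p)
      nlinarith
  have h4 : (j : ℝ) + 1 + |p| ≤ (1 + |p|) * (j + 1) := by nlinarith [abs_nonneg p]
  calc ((j : ℝ) + 1 + |p|) * min 1 (1 + 2 * p) ≤ (1 + |p|) * (j + 1) * min 1 (1 + 2 * p) := by
        gcongr
    _ = (1 + |p|) * (min 1 (1 + 2 * p) * (j + 1)) := by ring
    _ ≤ _ := by gcongr

lemma abs_pochRatioA_le {p : ℝ} (hp : -(1 / 2) < p) (k : ℕ) :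
    |pochRatioA p k| ≤ pochBound p ^ k := by
  rw [pochRatioA, Finset.abs_prod]
  refine (Finset.prod_le_prod (fun _ _ => abs_nonneg _) (g := fun _ => pochBound p)
    fun j _ => ?_).trans_eq (by rw [Finset.prod_const, Finset.card_range])
  have h1 := add_two_param_pos hp j
  refine le_trans ?_ (add_abs_div_le_pochBound hp j)
  rw [abs_div, abs_of_pos h1]
  have : |(j : ℝ) + 1 + p| ≤ j + 1 + |p| := (abs_add_le _ _).trans (by
    rw [abs_of_nonneg (by positivity : (0 : ℝ) ≤ (j : ℝ) + 1)])
  gcongr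

lemma abs_pochRatioB_le {p : ℝ} (hp : -(1 / 2) < p) (k : ℕ) :
    |pochRatioB p k| ≤ pochBound p ^ k := by
  rw [pochRatioB, Finset.abs_prod]
  refine (Finset.prod_le_prod (fun _ _ => abs_nonneg _) (g := fun _ => pochBound p)
    fun j _ => ?_).trans_eq (by rw [Finset.prod_const, Finset.card_range])
  have h1 := add_two_param_pos hp j
  refine le_trans ?_ (add_abs_div_le_pochBound hp j)
  rw [abs_div, abs_of_pos h1]
  have : |(j : ℝ) + p| ≤ j + 1 + |p| := (abs_add_le _ _).trans (by
    rw [abs_of_nonneg (by positivity : (0 : ℝ) ≤ (j : ℝ))]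
    linarith)
  gcongr

/-- The common value `Φ_n(1) = Φ_n^*(1)`. -/
noncomputable def szegoOne (p : ℝ) (n : ℕ) : ℝ := ∏ k ∈ Finset.range n, (1 + szegoGamma p k)

lemma szegoOne_succ (p : ℝ) (n : ℕ) :
    szegoOne p (n + 1) = szegoOne p n * (1 + szegoGamma p n) := Finset.prod_range_succ _ _

lemma one_add_szegoGamma {p : ℝ} (hp : -(1 / 2) < p) (n : ℕ) :
    1 + szegoGamma p n = (n + 1 + 2 * p) / (n + 1 + p) := by
  have := (add_param_pos hp n).ne'
  rw [szegoGamma]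
  field_simp
  ring

lemma szegoOne_pos {p : ℝ} (hp : -(1 / 2) < p) (n : ℕ) : 0 < szegoOne p n := by
  refine Finset.prod_pos fun k _ => ?_
  rw [one_add_szegoGamma hp]
  exact div_pos (add_two_param_pos hp k) (add_param_pos hp k)

lemma sum_range_choose_shift (n : ℕ) (c : ℕ → ℂ) (ζ : ℂ) :
    ∑ k ∈ Finset.range (n + 1), (n.choose k : ℂ) * c k * ζ ^ k =
      c 0 + ∑ k ∈ Finset.range (n + 1), (n.choose (k + 1) : ℂ) * c (k + 1) * ζ ^ (k + 1) := by
  have := Finset.sum_range_succ' (fun k => (n.choose k : ℂ) * c k * ζ ^ k) (n + 1)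
  rw [Finset.sum_range_succ] at this
  simp only [Nat.choose_succ_self, Nat.cast_zero, zero_mul, add_zero, Nat.choose_zero_right,
    Nat.cast_one, one_mul, pow_zero, mul_one] at this
  rw [this, add_comm]

lemma choose_succ_mul_cast (n k : ℕ) :
    ((k : ℂ) + 1) * (n.choose (k + 1) : ℂ) = (n - k) * (n.choose k : ℂ) := by
  have h := Nat.choose_succ_right_eq n k
  rcases le_or_gt k n with hk | hk
  · have h2 := congrArg (Nat.cast : ℕ → ℂ) h
    push_cast [Nat.cast_sub hk] at h2
    linear_combination h2
  · simp [Nat.choose_eq_zero_of_lt hk, Nat.choose_eq_zero_of_lt (hk.trans k.lt_succ_self)]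

/-- Hypergeometric expansion of `Φ_n` and `Φ_n^*` about the singularity `z = 1`. -/
lemma szego_eval_one_add {p : ℝ} (hp : -(1 / 2) < p) (n : ℕ) (ζ : ℂ) :
    (szegoPhi p n).eval (1 + ζ) = szegoOne p n *
        ∑ k ∈ Finset.range (n + 1), (n.choose k : ℂ) * pochRatioA p k * ζ ^ k ∧
      (szegoPsi p n).eval (1 + ζ) = szegoOne p n *
        ∑ k ∈ Finset.range (n + 1), (n.choose k : ℂ) * pochRatioB p k * ζ ^ k := by
  induction n with
  | zero => simp [szegoOne, pochRatioA, pochRatioB]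
  | succ n ih =>
    have hγ := szegoGamma_mul hp n
    have hpas : ∀ k, (((n + 1).choose (k + 1) : ℕ) : ℂ) = n.choose k + n.choose (k + 1) :=
      fun k => by rw [Nat.choose_succ_succ]; push_cast; rfl
    have hA0 : pochRatioA p 0 = 1 := rfl
    have hB0 : pochRatioB p 0 = 1 := rfl
    have hshift : ∀ c : ℕ → ℂ,
        ∑ k ∈ Finset.range (n + 1 + 1), ((n + 1).choose k : ℂ) * c k * ζ ^ k =
        c 0 + ∑ k ∈ Finset.range (n + 1),
          ((n.choose k : ℂ) + n.choose (k + 1)) * c (k + 1) * ζ ^ (k + 1) := by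
      intro c
      rw [Finset.sum_range_succ', add_comm]
      simp [hpas]
    have hmulζ : ζ * ∑ k ∈ Finset.range (n + 1), (n.choose k : ℂ) * pochRatioA p k * ζ ^ k =
        ∑ k ∈ Finset.range (n + 1), (n.choose k : ℂ) * pochRatioA p k * ζ ^ (k + 1) := by
      rw [Finset.mul_sum]
      exact Finset.sum_congr rfl fun k _ => by ring
    have hq : ∀ k : ℕ, (k : ℂ) + 1 + p ≠ 0 := fun k => by
      exact_mod_cast (add_param_pos hp k).ne'
    have hAk : ∀ k : ℕ, (pochRatioA p (k + 1) : ℂ) * (k + 1 + 2 * p) =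
        pochRatioA p k * (k + 1 + p) := fun k => by
      exact_mod_cast pochRatioA_succ_mul hp k
    have hBk : ∀ k : ℕ, (pochRatioB p (k + 1) : ℂ) * (k + 1 + p) = p * pochRatioA p (k + 1) :=
      fun k => by exact_mod_cast pochRatioB_mul p (k + 1)
    have sA := sum_range_choose_shift n (fun k => (pochRatioA p k : ℂ)) ζ
    have sB := sum_range_choose_shift n (fun k => (pochRatioB p k : ℂ)) ζ
    simp only [hA0, hB0, Complex.ofReal_one] at sA sB
    rw [szegoPhi_eval_succ, szegoPsi_eval_succ, ih.1, ih.2, szegoOne_succ,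
      hshift (fun k => (pochRatioA p k : ℂ)), hshift (fun k => (pochRatioB p k : ℂ))]
    simp only [hA0, hB0, Complex.ofReal_one]
    push_cast
    constructor
    · have key : ∑ k ∈ Finset.range (n + 1), (n.choose (k + 1) : ℂ) * pochRatioA p (k + 1) *
            ζ ^ (k + 1) +
          ∑ k ∈ Finset.range (n + 1), (n.choose k : ℂ) * pochRatioA p k * ζ ^ (k + 1) +
          szegoGamma p n * ∑ k ∈ Finset.range (n + 1), (n.choose (k + 1) : ℂ) *
            pochRatioB p (k + 1) * ζ ^ (k + 1) =
          (1 + szegoGamma p n) * ∑ k ∈ Finset.range (n + 1),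
            ((n.choose k : ℂ) + n.choose (k + 1)) * pochRatioA p (k + 1) * ζ ^ (k + 1) := by
        rw [Finset.mul_sum, Finset.mul_sum, ← Finset.sum_add_distrib, ← Finset.sum_add_distrib]
        refine Finset.sum_congr rfl fun k _ => ?_
        refine mul_left_cancel₀ (hq k) ?_
        linear_combination ζ ^ (k + 1) * ((-(n.choose k : ℂ)) * hAk k +
          szegoGamma p n * n.choose (k + 1) * hBk k -
          n.choose k * pochRatioA p (k + 1) * hγ -
          szegoGamma p n * pochRatioA p (k + 1) * choose_succ_mul_cast n k)
      linear_combination (szegoOne p n : ℂ) * (sA + hmulζ + szegoGamma p n * sB + key)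
    · have key : ∑ k ∈ Finset.range (n + 1), (n.choose (k + 1) : ℂ) * pochRatioB p (k + 1) *
            ζ ^ (k + 1) +
          szegoGamma p n * (∑ k ∈ Finset.range (n + 1), (n.choose (k + 1) : ℂ) *
            pochRatioA p (k + 1) * ζ ^ (k + 1) +
          ∑ k ∈ Finset.range (n + 1), (n.choose k : ℂ) * pochRatioA p k * ζ ^ (k + 1)) =
          (1 + szegoGamma p n) * ∑ k ∈ Finset.range (n + 1),
            ((n.choose k : ℂ) + n.choose (k + 1)) * pochRatioB p (k + 1) * ζ ^ (k + 1) := by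
        rw [← Finset.sum_add_distrib, Finset.mul_sum, ← Finset.sum_add_distrib, Finset.mul_sum]
        refine Finset.sum_congr rfl fun k _ => ?_
        refine mul_left_cancel₀ (hq k) ?_
        linear_combination ζ ^ (k + 1) * ((-(n.choose k : ℂ)) * szegoGamma p n * hAk k +
          (n.choose (k + 1) - (1 + szegoGamma p n) * (n.choose k + n.choose (k + 1))) * hBk k +
          n.choose k * pochRatioA p (k + 1) * hγ +
          szegoGamma p n * pochRatioA p (k + 1) * choose_succ_mul_cast n k)
      linear_combination (szegoOne p n : ℂ) *
        (sB + szegoGamma p n * (sA + hmulζ) + key)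

/-- The confluent hypergeometric function `₁F₁(p + 1; 2p + 1; w)`. -/
noncomputable def kummerA (p : ℝ) (w : ℂ) : ℂ := ∑' k : ℕ, (pochRatioA p k / (k ! : ℝ) : ℝ) * w ^ k

/-- The confluent hypergeometric function `₁F₁(p; 2p + 1; w)`. -/
noncomputable def kummerB (p : ℝ) (w : ℂ) : ℂ := ∑' k : ℕ, (pochRatioB p k / (k ! : ℝ) : ℝ) * w ^ k

lemma tendsto_choose_mul_pow_complex {ζ : ℕ → ℂ} {w : ℂ}
    (h : Tendsto (fun n : ℕ => (n : ℂ) * ζ n) atTop (𝓝 w)) (k : ℕ) :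
    Tendsto (fun n : ℕ => (n.choose k : ℂ) * ζ n ^ k) atTop (𝓝 (w ^ k / (k ! : ℂ))) := by
  have h1 : Tendsto (fun n : ℕ => (n : ℝ) * (1 / n : ℝ)) atTop (𝓝 1) := by
    refine tendsto_const_nhds.congr' ?_
    filter_upwards [eventually_ge_atTop 1] with n hn
    have : (n : ℝ) ≠ 0 := by positivity
    field_simp
  have h2 := ProbabilityTheory.tendsto_choose_mul_pow_atTop k h1
  have h3 : Tendsto (fun n : ℕ => (((n.choose k : ℝ) * (1 / n : ℝ) ^ k : ℝ) : ℂ) *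
      ((n : ℂ) * ζ n) ^ k) atTop (𝓝 ((((1 : ℝ) ^ k / (k ! : ℝ) : ℝ) : ℂ) * w ^ k)) :=
    ((Complex.continuous_ofReal.tendsto _).comp h2).mul (h.pow k)
  refine (h3.congr' ?_).trans_eq ?_
  · filter_upwards [eventually_ge_atTop 1] with n hn
    have : (n : ℂ) ≠ 0 := by exact_mod_cast (by omega : n ≠ 0)
    push_cast
    rw [mul_pow, one_div, inv_pow]
    field_simp
  · push_cast
    rw [one_pow]
    ring_nf

/-- If `n ζ_n → w`, the terminating hypergeometric sums tend to the confluent series. -/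
lemma tendsto_sum_choose {c : ℕ → ℝ} {C : ℝ} (hc : ∀ k, |c k| ≤ C ^ k) (hC : 0 < C)
    {ζ : ℕ → ℂ} {w : ℂ} (h : Tendsto (fun n : ℕ => (n : ℂ) * ζ n) atTop (𝓝 w)) :
    Tendsto (fun n : ℕ => ∑ k ∈ Finset.range (n + 1), (n.choose k : ℂ) * c k * ζ n ^ k) atTop
      (𝓝 (∑' k : ℕ, (c k / (k ! : ℝ) : ℝ) * w ^ k)) := by
  obtain ⟨K, hK⟩ : ∃ K : ℝ, ∀ n : ℕ, ‖(n : ℂ) * ζ n‖ ≤ K := by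
    obtain ⟨K, hK⟩ := h.norm.bddAbove_range
    exact ⟨K, fun n => hK ⟨n, rfl⟩⟩
  have hK0 : 0 ≤ K := (norm_nonneg _).trans (hK 0)
  have hfin : ∀ n : ℕ, ∑ k ∈ Finset.range (n + 1), (n.choose k : ℂ) * c k * ζ n ^ k =
      ∑' k : ℕ, (n.choose k : ℂ) * c k * ζ n ^ k := fun n => by
    rw [tsum_eq_sum]
    intro k hk
    rw [Finset.mem_range, not_lt] at hk
    simp [Nat.choose_eq_zero_of_lt (Nat.lt_of_succ_le hk)]
  simp_rw [hfin]
  refine tendsto_tsum_of_dominated_convergence (bound := fun k => (C * K) ^ k / k !)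
    (Real.summable_pow_div_factorial _) (fun k => ?_) (Eventually.of_forall fun n k => ?_)
  · refine ((tendsto_choose_mul_pow_complex h k).const_mul (c k : ℂ)).congr (fun n => by ring)
      |>.trans_eq ?_
    push_cast
    ring_nf
  · have h1 : (n.choose k : ℝ) ≤ (n : ℝ) ^ k / k ! := Nat.choose_le_pow_div k n
    rw [norm_mul, norm_mul, norm_pow, Complex.norm_natCast, Complex.norm_real, Real.norm_eq_abs]
    have h2 := hK n
    rw [norm_mul, Complex.norm_natCast] at h2
    calc (n.choose k : ℝ) * |c k| * ‖ζ n‖ ^ k ≤ (n : ℝ) ^ k / k ! * C ^ k * ‖ζ n‖ ^ k := by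
          gcongr
          exact hc k
      _ = C ^ k * ((n : ℝ) * ‖ζ n‖) ^ k / k ! := by rw [mul_pow]; ring
      _ ≤ C ^ k * K ^ k / k ! := by gcongr
      _ = _ := by rw [mul_pow]

lemma tendsto_nat_mul_exp_sub_one (w : ℂ) :
    Tendsto (fun n : ℕ => (n : ℂ) * (Complex.exp (w / n) - 1)) atTop (𝓝 w) := by
  have hd : HasDerivAt (fun t : ℂ => Complex.exp (w * t)) w 0 := by
    have := ((hasDerivAt_id (0 : ℂ)).const_mul w).cexp
    simpa using this
  have h := hasDerivAt_iff_tendsto_slope_zero.1 hd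
  have ht : Tendsto (fun n : ℕ => ((n : ℂ))⁻¹) atTop (𝓝[≠] 0) := by
    refine tendsto_nhdsWithin_iff.2 ⟨tendsto_inv_atTop_nhds_zero_nat, ?_⟩
    filter_upwards [eventually_ge_atTop 1] with n hn
    have : (n : ℂ) ≠ 0 := by exact_mod_cast (by omega : n ≠ 0)
    simpa using this
  refine (h.comp ht).congr fun n => ?_
  simp [div_eq_mul_inv]

section Limits

variable {p : ℝ} (hp : -(1 / 2) < p) (y : ℝ)

include hp

lemma tendsto_szegoPhi : Tendsto (fun n : ℕ =>
    (szegoPhi p n).eval (Complex.exp (Complex.I * y / n)) / szegoOne p n) atTop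
      (𝓝 (kummerA p (Complex.I * y))) := by
  refine (tendsto_sum_choose (abs_pochRatioA_le hp) (pochBound_pos hp)
    (tendsto_nat_mul_exp_sub_one (Complex.I * y))).congr fun n => ?_
  have h := (szego_eval_one_add hp n (Complex.exp (Complex.I * y / n) - 1)).1
  have hne : (szegoOne p n : ℂ) ≠ 0 := by exact_mod_cast (szegoOne_pos hp n).ne'
  rw [add_sub_cancel] at h
  rw [h]
  field_simp

lemma tendsto_szegoPsi : Tendsto (fun n : ℕ =>
    (szegoPsi p n).eval (Complex.exp (Complex.I * y / n)) / szegoOne p n) atTop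
      (𝓝 (kummerB p (Complex.I * y))) := by
  refine (tendsto_sum_choose (abs_pochRatioB_le hp) (pochBound_pos hp)
    (tendsto_nat_mul_exp_sub_one (Complex.I * y))).congr fun n => ?_
  have h := (szego_eval_one_add hp n (Complex.exp (Complex.I * y / n) - 1)).2
  have hne : (szegoOne p n : ℂ) ≠ 0 := by exact_mod_cast (szegoOne_pos hp n).ne'
  rw [add_sub_cancel] at h
  rw [h]
  field_simp

omit hp in
lemma exp_div_mul_conj (n : ℕ) : Complex.exp (Complex.I * y / n) *
    (starRingEnd ℂ) (Complex.exp (Complex.I * y / n)) = 1 := by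
  rw [← Complex.exp_conj, ← Complex.exp_add]
  simp [neg_div]

/-- Kummer's transformation on the imaginary axis, as the limit of `Φ_n^*(z) = z^n conj Φ_n(z)`. -/
lemma kummerB_eq_exp_mul_conj : kummerB p (Complex.I * y) =
    Complex.exp (Complex.I * y) * (starRingEnd ℂ) (kummerA p (Complex.I * y)) := by
  refine tendsto_nhds_unique (tendsto_szegoPsi hp y) ?_
  have h := ((Complex.continuous_conj.tendsto _).comp (tendsto_szegoPhi hp y)).const_mul
    (Complex.exp (Complex.I * y))
  refine h.congr' ?_
  filter_upwards [eventually_ge_atTop 1] with n hn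
  have hn0 : (n : ℂ) ≠ 0 := by exact_mod_cast (by omega : n ≠ 0)
  rw [szegoPsi_eval_eq p n (exp_div_mul_conj y n), ← Complex.exp_nat_mul,
    mul_div_cancel₀ _ hn0]
  simp [mul_div_assoc]

omit y in
lemma szegoOne_sq_div_szegoNorm (n : ℕ) : szegoOne p n ^ 2 / szegoNorm p n =
    ∏ k ∈ Finset.range n, ((k : ℝ) + 1 + 2 * p) / (k + 1) := by
  rw [szegoOne, szegoNorm, ← Finset.prod_pow, ← Finset.prod_div_distrib]
  refine Finset.prod_congr rfl fun k _ => ?_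
  have h1 := (add_param_pos hp k).ne'
  have h2 := (add_two_param_pos hp k).ne'
  rw [one_add_szegoGamma hp, one_sub_szegoGamma_sq hp]
  have : (k : ℝ) + 1 ≠ 0 := by positivity
  field_simp

omit y in
lemma tendsto_szegoOne_sq_div : Tendsto (fun n : ℕ =>
    szegoOne p n ^ 2 / szegoNorm p n / (n : ℝ) ^ (2 * p)) atTop
      (𝓝 (1 / Real.Gamma (2 * p + 1))) := by
  have hs : (0 : ℝ) < 2 * p + 1 := by linarith
  have hG := Real.GammaSeq_tendsto_Gamma (2 * p + 1)
  have hr : Tendsto (fun n : ℕ => (n : ℝ) / (n + (1 + 2 * p))) atTop (𝓝 1) :=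
    tendsto_natCast_div_add_atTop (1 + 2 * p)
  have h := hr.div hG (Real.Gamma_pos_of_pos hs).ne'
  refine h.congr' ?_
  filter_upwards [eventually_ge_atTop 1] with n hn
  have hn0 : (0 : ℝ) < n := by exact_mod_cast hn
  have h1 := (add_two_param_pos hp n).ne'
  have hprod : ∏ j ∈ Finset.range (n + 1), (2 * p + 1 + (j : ℝ)) =
      (∏ k ∈ Finset.range n, ((k : ℝ) + 1 + 2 * p)) * (n + 1 + 2 * p) := by
    rw [Finset.prod_range_succ]
    congr 1
    · exact Finset.prod_congr rfl fun k _ => by ring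
    · ring
  have hfac : ∏ k ∈ Finset.range n, ((k : ℝ) + 1) = (n ! : ℝ) := by
    rw [← Finset.prod_range_add_one_eq_factorial]
    push_cast
    rfl
  have hP : (∏ k ∈ Finset.range n, ((k : ℝ) + 1 + 2 * p)) ≠ 0 :=
    Finset.prod_ne_zero_iff.2 fun k _ => (add_two_param_pos hp k).ne'
  have hf : (n ! : ℝ) ≠ 0 := by positivity
  rw [szegoOne_sq_div_szegoNorm hp, Finset.prod_div_distrib, hfac]
  simp only [Pi.div_apply, Real.GammaSeq]
  rw [hprod, Real.rpow_add_one hn0.ne']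
  have h3 : (n : ℝ) ^ (2 * p) ≠ 0 := (Real.rpow_pos_of_pos hn0 _).ne'
  have h4 : (n : ℝ) + (1 + 2 * p) ≠ 0 := by rw [← add_assoc]; exact h1
  field_simp
  ring

end Limits

/-- The limiting density about the singularity in the variable `y = 2πx`. -/
noncomputable def bulkLimit (p y : ℝ) : ℝ :=
  2 * Real.pi / weightMass p / Real.Gamma (2 * p + 1) * |y| ^ (2 * p) *
    (‖kummerA p (Complex.I * y)‖ ^ 2 - 2 * p / y *
      (kummerA p (Complex.I * y) * (starRingEnd ℂ) (kummerB p (Complex.I * y))).im)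

lemma tendsto_cJScaledDensity {p : ℝ} (hp : -(1 / 2) < p) {x : ℝ} (hx : x ≠ 0) :
    Tendsto (fun N : ℕ => cJScaledDensity N 2 p 0 x) atTop (𝓝 (bulkLimit p (2 * Real.pi * x))) := by
  obtain ⟨y, hy⟩ : ∃ y : ℝ, y = 2 * Real.pi * x := ⟨_, rfl⟩
  rw [← hy]
  have hy0 : y ≠ 0 := by
    rw [hy]
    exact mul_ne_zero (by positivity) hx
  have hyc : (y : ℂ) ≠ 0 := by exact_mod_cast hy0
  set z : ℕ → ℂ := fun N => Complex.exp (Complex.I * y / N) with hz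
  have hlim1 : Tendsto (fun n : ℕ => (n : ℂ) * (z n - 1)) atTop (𝓝 (Complex.I * y)) :=
    tendsto_nat_mul_exp_sub_one (Complex.I * y)
  have hz1 : Tendsto z atTop (𝓝 1) := by
    have h1 : Tendsto (fun n : ℕ => Complex.I * y / (n : ℂ)) atTop (𝓝 0) :=
      tendsto_const_div_atTop_nhds_zero_nat (𝕜 := ℂ) _
    have := (Complex.continuous_exp.tendsto 0).comp h1
    simpa [hz, Function.comp_def] using this
  set A := kummerA p (Complex.I * y) with hA
  set B := kummerB p (Complex.I * y) with hB
  have hF : Tendsto (fun n : ℕ => (szegoPhi p n).eval (z n) / szegoOne p n) atTop (𝓝 A) :=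
    tendsto_szegoPhi hp y
  have hG : Tendsto (fun n : ℕ => (szegoPsi p n).eval (z n) / szegoOne p n) atTop (𝓝 B) :=
    tendsto_szegoPsi hp y
  have hFc := (Complex.continuous_conj.tendsto _).comp hF
  have hGc := (Complex.continuous_conj.tendsto _).comp hG
  have hN1 : Tendsto (fun N : ℕ => ((N : ℂ) + p) / N) atTop (𝓝 1) := by
    have h1 : Tendsto (fun n : ℕ => 1 + (p : ℂ) / (n : ℂ)) atTop (𝓝 (1 + 0)) :=
      tendsto_const_nhds.add (tendsto_const_div_atTop_nhds_zero_nat (𝕜 := ℂ) _)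
    rw [add_zero] at h1
    refine h1.congr' ?_
    filter_upwards [eventually_ge_atTop 1] with n hn
    have hn0 : (n : ℂ) ≠ 0 := by exact_mod_cast (by omega : n ≠ 0)
    field_simp
  have hker := ((hN1.mul (hF.mul hFc)).sub (((hz1.mul (hF.mul hGc)).sub (hFc.mul hG)).const_mul
    (p : ℂ) |>.div hlim1 (mul_ne_zero Complex.I_ne_zero hyc)))
  have hpow : Tendsto (fun N : ℕ => ‖(N : ℂ) * (z N - 1)‖ ^ (2 * p)) atTop
      (𝓝 (|y| ^ (2 * p))) := by
    have := hlim1.norm.rpow_const (p := 2 * p) (Or.inl (by simpa using hy0))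
    simpa using this
  have hcoef := ((hpow.mul (tendsto_szegoOne_sq_div hp)).const_mul (2 * Real.pi / weightMass p))
  have hall := ((Complex.continuous_ofReal.tendsto _).comp hcoef).mul hker
  have hlimval : (((2 * Real.pi / weightMass p * (|y| ^ (2 * p) *
      (1 / Real.Gamma (2 * p + 1))) : ℝ)) : ℂ) * (1 * (A * (starRingEnd ℂ) A) -
      p * (1 * (A * (starRingEnd ℂ) B) - (starRingEnd ℂ) A * B) / (Complex.I * y)) =
      ((bulkLimit p y : ℝ) : ℂ) := by
    have h2 : A * (starRingEnd ℂ) B - (starRingEnd ℂ) A * B =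
        2 * Complex.I * ((A * (starRingEnd ℂ) B).im : ℝ) := by
      rw [Complex.im_eq_sub_conj]
      simp only [map_mul, Complex.conj_conj]
      field_simp
    rw [one_mul, one_mul, h2, Complex.mul_conj, Complex.normSq_eq_norm_sq, bulkLimit, ← hA, ← hB]
    push_cast
    field_simp
  rw [hlimval] at hall
  have hall' : Tendsto (fun N : ℕ => ((cJScaledDensity N 2 p 0 x : ℝ) : ℂ)) atTop
      (𝓝 ((bulkLimit p y : ℝ) : ℂ)) := by
    refine hall.congr' ?_
    have hne : ∀ᶠ N : ℕ in atTop, (N : ℂ) * (z N - 1) ≠ 0 :=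
      hlim1.eventually_ne (mul_ne_zero Complex.I_ne_zero hyc)
    filter_upwards [eventually_ge_atTop 1, hne] with N hN hzN
    have hN0 : (0 : ℝ) < N := by exact_mod_cast hN
    have hNc : (N : ℂ) ≠ 0 := by exact_mod_cast hN0.ne'
    have hz1N : z N - 1 ≠ 0 := right_ne_zero_of_mul hzN
    have hexp : Complex.exp (Complex.I * (((if x < 0 then 2 * Real.pi else 0) +
        2 * Real.pi * x / N : ℝ) : ℂ)) = z N := by
      simp only [hz, hy]
      split_ifs
      · rw [Complex.ofReal_add, mul_add, Complex.exp_add]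
        have : Complex.exp (Complex.I * ((2 * Real.pi : ℝ) : ℂ)) = 1 := by
          rw [mul_comm]
          push_cast
          exact Complex.exp_two_pi_mul_I
        rw [this, one_mul]
        push_cast
        ring_nf
      · push_cast
        ring_nf
    rw [cJScaledDensity, cJDensity_two_eq hp, cJWeight_two_eq_norm, hexp, Complex.ofReal_mul,
      Complex.ofReal_mul, szego_christoffel_darboux hp N (z := z N) (exp_div_mul_conj y N)
        (sub_ne_zero.1 hz1N)]
    have hc : (szegoOne p N : ℂ) ≠ 0 := by exact_mod_cast (szegoOne_pos hp N).ne'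
    have hS : (szegoNorm p N : ℂ) ≠ 0 := by exact_mod_cast (szegoNorm_pos hp N).ne'
    have hM : (weightMass p : ℂ) ≠ 0 := by exact_mod_cast (weightMass_pos hp).ne'
    have hNp : (((N : ℝ) ^ (2 * p) : ℝ) : ℂ) ≠ 0 := by
      exact_mod_cast (Real.rpow_pos_of_pos hN0 _).ne'
    have hnorm : ‖(N : ℂ) * (z N - 1)‖ ^ (2 * p) =
        (N : ℝ) ^ (2 * p) * ‖1 - z N‖ ^ (2 * p) := by
      rw [norm_mul, Complex.norm_natCast, norm_sub_rev, Real.mul_rpow hN0.le (norm_nonneg _)]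
    simp only [Function.comp_apply, Pi.div_apply, map_div₀, Complex.conj_ofReal]
    rw [hnorm]
    push_cast
    field_simp
  have h5 := (Complex.continuous_re.tendsto _).comp hall'
  simpa [Function.comp_def] using h5

/-! ### Differentiation and multiplication of power series -/

section PowerSeriesLemmas

variable {𝕜 : Type*} [RCLike 𝕜]

lemma summable_nat_mul_coeff_pow {c : ℕ → 𝕜} {r ρ : ℝ} (hρ : 0 < ρ) (hr : ρ < r)
    (hc : Summable fun k => ‖c k‖ * r ^ k) :
    Summable fun k : ℕ => (k : ℝ) * ‖c k‖ * ρ ^ (k - 1) := by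
  have hr0 : 0 < r := hρ.trans hr
  have h1 : Tendsto (fun k : ℕ => (k : ℝ) * (ρ / r) ^ k) atTop (𝓝 0) :=
    tendsto_self_mul_const_pow_of_lt_one (by positivity) ((div_lt_one hr0).2 hr)
  obtain ⟨K, hK⟩ := h1.bddAbove_range
  refine Summable.of_nonneg_of_le (fun k => by positivity) (fun k => ?_) (hc.mul_left (K / ρ))
  have hk : (k : ℝ) * (ρ / r) ^ k ≤ K := hK ⟨k, rfl⟩
  rcases k with _ | k
  · simp only [Nat.cast_zero, zero_mul] at hk ⊢
    positivity
  · have e : ((k + 1 : ℕ) : ℝ) * ‖c (k + 1)‖ * ρ ^ (k + 1 - 1) =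
        (((k + 1 : ℕ) : ℝ) * (ρ / r) ^ (k + 1)) / ρ * (‖c (k + 1)‖ * r ^ (k + 1)) := by
      rw [div_pow, Nat.add_sub_cancel]
      field_simp
      ring
    rw [e]
    gcongr

/-- A power series may be differentiated term by term inside its disc of absolute convergence. -/
lemma hasDerivAt_tsum_mul_pow {c : ℕ → 𝕜} {r : ℝ} (hc : Summable fun k => ‖c k‖ * r ^ k) {w : 𝕜}
    (hw : ‖w‖ < r) :
    HasDerivAt (fun w => ∑' k, c k * w ^ k) (∑' k : ℕ, (k : 𝕜) * c k * w ^ (k - 1)) w ∧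
      Summable fun k : ℕ => (k : 𝕜) * c k * w ^ (k - 1) := by
  obtain ⟨ρ, hρ1, hρ2⟩ := exists_between hw
  have hρ0 : 0 < ρ := (norm_nonneg w).trans_lt hρ1
  have hu := summable_nat_mul_coeff_pow hρ0 hρ2 hc
  have hbound : ∀ (k : ℕ) (x : 𝕜), x ∈ Metric.ball (0 : 𝕜) ρ →
      ‖(k : 𝕜) * c k * x ^ (k - 1)‖ ≤ (k : ℝ) * ‖c k‖ * ρ ^ (k - 1) := by
    intro k x hx
    rw [mem_ball_zero_iff] at hx
    rw [norm_mul, norm_mul, norm_pow, RCLike.norm_natCast]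
    gcongr
  have hwm : w ∈ Metric.ball (0 : 𝕜) ρ := by rwa [mem_ball_zero_iff]
  refine ⟨hasDerivAt_tsum_of_isPreconnected hu Metric.isOpen_ball
    (convex_ball (0 : 𝕜) ρ).isPreconnected (g := fun k x => c k * x ^ k) (fun k x _ => ?_)
    hbound (Metric.mem_ball_self hρ0) ?_ hwm, Summable.of_norm_bounded hu fun k => hbound k w hwm⟩
  · exact ((hasDerivAt_pow k x).const_mul (c k)).congr_deriv (by ring)
  · refine summable_of_ne_finset_zero (s := {0}) fun k hk => ?_
    rw [zero_pow (by simpa using hk), mul_zero]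

lemma mul_tsum_nat_mul_pow {c : ℕ → 𝕜} {w : 𝕜} :
    w * ∑' k : ℕ, (k : 𝕜) * c k * w ^ (k - 1) = ∑' k : ℕ, (k : 𝕜) * c k * w ^ k := by
  rw [← tsum_mul_left]
  refine tsum_congr fun k => ?_
  rcases k with _ | k
  · simp
  · rw [Nat.add_sub_cancel, pow_succ]
    ring

lemma summable_mul_pow {c : ℕ → 𝕜} {r : ℝ} (hc : Summable fun k => ‖c k‖ * r ^ k) {w : 𝕜}
    (hw : ‖w‖ ≤ r) : Summable fun k => ‖c k * w ^ k‖ := by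
  refine Summable.of_nonneg_of_le (fun k => norm_nonneg _) (fun k => ?_) hc
  rw [norm_mul, norm_pow]
  gcongr

end PowerSeriesLemmas

lemma hasSum_powerSeries_mul {F G : PowerSeries ℂ} {w a b : ℂ}
    (hF : Summable fun k => ‖F.coeff k * w ^ k‖) (hG : Summable fun k => ‖G.coeff k * w ^ k‖)
    (ha : HasSum (fun k => F.coeff k * w ^ k) a) (hb : HasSum (fun k => G.coeff k * w ^ k) b) :
    (Summable fun k => ‖(F * G).coeff k * w ^ k‖) ∧
      HasSum (fun k => (F * G).coeff k * w ^ k) (a * b) := by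
  have e : ∀ k, (F * G).coeff k * w ^ k = ∑ ij ∈ Finset.HasAntidiagonal.antidiagonal k,
      (F.coeff ij.1 * w ^ ij.1) * (G.coeff ij.2 * w ^ ij.2) := by
    intro k
    rw [PowerSeries.coeff_mul, Finset.sum_mul]
    refine Finset.sum_congr rfl fun ij hij => ?_
    rw [← Finset.HasAntidiagonal.mem_antidiagonal.1 hij, pow_add]
    ring
  have hs := summable_norm_sum_mul_antidiagonal_of_summable_norm hF hG
  simp_rw [e]
  refine ⟨hs, ?_⟩
  rw [← ha.tsum_eq, ← hb.tsum_eq, tsum_mul_tsum_eq_tsum_sum_antidiagonal_of_summable_norm hF hG]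
  exact hs.of_norm.hasSum

/-! ### The confluent hypergeometric pair and its differential system -/

section Kummer

variable {p : ℝ} (hp : -(1 / 2) < p)

include hp

omit hp in
lemma summable_kummer {c : ℕ → ℝ} (hc : ∀ k, |c k| ≤ pochBound p ^ k) (r : ℝ) (hr : 0 ≤ r) :
    Summable fun k : ℕ => ‖((c k / (k ! : ℝ) : ℝ) : ℂ)‖ * r ^ k := by
  refine Summable.of_nonneg_of_le (fun k => by positivity) (fun k => ?_)
    (Real.summable_pow_div_factorial (pochBound p * r))
  rw [Complex.norm_real, Real.norm_eq_abs, abs_div, Nat.abs_cast, mul_pow, div_mul_eq_mul_div]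
  gcongr
  exact hc k

lemma hasDerivAt_kummer (w : ℂ) :
    (∃ A', HasDerivAt (kummerA p) A' w ∧ w * A' = w * kummerA p w + p * (kummerB p w - kummerA p w)) ∧
      ∃ B', HasDerivAt (kummerB p) B' w ∧ w * B' = p * (kummerA p w - kummerB p w) := by
  have hw : ‖w‖ < ‖w‖ + 1 := by linarith
  have sA := summable_kummer (abs_pochRatioA_le hp) (‖w‖ + 1) (by positivity)
  have sB := summable_kummer (abs_pochRatioB_le hp) (‖w‖ + 1) (by positivity)
  obtain ⟨dA, dsA⟩ := hasDerivAt_tsum_mul_pow sA hw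
  obtain ⟨dB, dsB⟩ := hasDerivAt_tsum_mul_pow sB hw
  have tA := (summable_mul_pow sA hw.le).of_norm
  have tB := (summable_mul_pow sB hw.le).of_norm
  refine ⟨⟨_, dA, ?_⟩, ⟨_, dB, ?_⟩⟩
  · have h1 : w * kummerA p w = ∑' k : ℕ,
        ((k : ℂ) * (pochRatioA p k / (k ! : ℝ) : ℝ) + p * (pochRatioA p k / (k ! : ℝ) : ℝ) -
          p * (pochRatioB p k / (k ! : ℝ) : ℝ)) * w ^ k := by
      have hsA1 : Summable fun k : ℕ => (k : ℂ) * (pochRatioA p k / (k ! : ℝ) : ℝ) * w ^ k := by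
        refine (dsA.mul_left w).congr fun k => ?_
        rcases k with _ | k
        · simp
        · rw [Nat.add_sub_cancel, pow_succ]
          ring
      have hs : Summable fun k : ℕ =>
        ((k : ℂ) * (pochRatioA p k / (k ! : ℝ) : ℝ) + p * (pochRatioA p k / (k ! : ℝ) : ℝ) -
          p * (pochRatioB p k / (k ! : ℝ) : ℝ)) * w ^ k := by
        refine ((hsA1.add (tA.mul_left (p : ℂ))).sub (tB.mul_left (p : ℂ))).congr fun k => ?_
        ring
      rw [hs.tsum_eq_zero_add, kummerA, ← tsum_mul_left]
      have h0 : ((0 : ℕ) : ℂ) * (pochRatioA p 0 / (0 ! : ℝ) : ℝ) +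
          p * (pochRatioA p 0 / (0 ! : ℝ) : ℝ) - p * (pochRatioB p 0 / (0 ! : ℝ) : ℝ) = 0 := by
        simp [pochRatioA, pochRatioB]
      rw [h0, zero_mul, zero_add]
      refine tsum_congr fun k => ?_
      have hA := pochRatioA_succ_mul hp k
      have hB := pochRatioB_mul p (k + 1)
      have hq := (add_param_pos hp k).ne'
      have hf : ((k ! : ℕ) : ℝ) ≠ 0 := by positivity
      have hk1 : (k : ℝ) + 1 ≠ 0 := by positivity
      have key : ((k : ℝ) + 1) * (pochRatioA p (k + 1) / ((k + 1)! : ℝ)) +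
          p * (pochRatioA p (k + 1) / ((k + 1)! : ℝ)) -
            p * (pochRatioB p (k + 1) / ((k + 1)! : ℝ)) = pochRatioA p k / (k ! : ℝ) := by
        rw [Nat.factorial_succ]
        push_cast at hB ⊢
        field_simp
        refine mul_left_cancel₀ hq ?_
        linear_combination ((k : ℝ) + 1) * hA - p * hB
      have key' := congrArg (Complex.ofReal) key
      push_cast at key' ⊢
      rw [← key']
      ring
    rw [mul_tsum_nat_mul_pow, h1, kummerA, kummerB, ← tB.tsum_sub tA, ← tsum_mul_left,
      ← Summable.tsum_add]
    · refine tsum_congr fun k => ?_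
      ring
    · refine (((dsA.mul_left w).add (tA.mul_left (p : ℂ))).sub (tB.mul_left (p : ℂ))).congr
        fun k => ?_
      rcases k with _ | k
      · simp
      · rw [Nat.add_sub_cancel, pow_succ]
        ring
    · exact (tB.sub tA).mul_left _
  · rw [mul_tsum_nat_mul_pow, kummerA, kummerB, ← tA.tsum_sub tB, ← tsum_mul_left]
    refine tsum_congr fun k => ?_
    have hB := congrArg Complex.ofReal (pochRatioB_mul p k)
    push_cast at hB ⊢
    linear_combination (w ^ k / (k ! : ℂ)) * hB

end Kummer

/-- `e^{-iy} A(iy)²`, whose real and imaginary parts and modulus close the differential system. -/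
noncomputable def kummerSq (p y : ℝ) : ℂ :=
  kummerA p (Complex.I * y) ^ 2 * Complex.exp (-(Complex.I * y))

section System

variable {p : ℝ} (hp : -(1 / 2) < p) (y : ℝ)

include hp

lemma kummerA_mul_conj_kummerB :
    kummerA p (Complex.I * y) * (starRingEnd ℂ) (kummerB p (Complex.I * y)) = kummerSq p y := by
  rw [kummerB_eq_exp_mul_conj hp, map_mul, Complex.conj_conj, ← Complex.exp_conj, kummerSq]
  simp
  ring

omit hp in
lemma norm_kummerSq : ‖kummerSq p y‖ = ‖kummerA p (Complex.I * y)‖ ^ 2 := by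
  rw [kummerSq, norm_mul, norm_pow, show -(Complex.I * (y : ℂ)) = ((-y : ℝ) : ℂ) * Complex.I by
    push_cast; ring, Complex.norm_exp_ofReal_mul_I, mul_one]

lemma conj_kummerA : (starRingEnd ℂ) (kummerA p (Complex.I * y)) =
    kummerB p (Complex.I * y) * Complex.exp (-(Complex.I * y)) := by
  rw [kummerB_eq_exp_mul_conj hp, mul_right_comm, ← Complex.exp_add]
  simp

/-- The linear system satisfied by `r = |A|²` and `e^{-iy} A² = d + iω`:
`y r' = 2p (d - r)`, `y d' = -y ω + 2p (r - d)`, `y ω' = y d - 2p ω`. -/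
lemma hasDerivAt_kummer_system (hy : y ≠ 0) :
    HasDerivAt (fun y : ℝ => ‖kummerA p (Complex.I * y)‖ ^ 2)
        (2 * p / y * ((kummerSq p y).re - ‖kummerA p (Complex.I * y)‖ ^ 2)) y ∧
      HasDerivAt (fun y : ℝ => (kummerSq p y).re) (-(kummerSq p y).im +
        2 * p / y * (‖kummerA p (Complex.I * y)‖ ^ 2 - (kummerSq p y).re)) y ∧
      HasDerivAt (fun y : ℝ => (kummerSq p y).im)
        ((kummerSq p y).re - 2 * p / y * (kummerSq p y).im) y := by
  have hyc : (y : ℂ) ≠ 0 := by exact_mod_cast hy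
  obtain ⟨⟨A', hA', eA⟩, B', hB', eB⟩ := hasDerivAt_kummer hp (Complex.I * y)
  have hid : HasDerivAt (fun y : ℝ => Complex.I * (y : ℂ)) (Complex.I * 1) y :=
    (hasDerivAt_id y).ofReal_comp.const_mul Complex.I
  have dA : HasDerivAt (fun y : ℝ => kummerA p (Complex.I * y)) (A' * (Complex.I * 1)) y :=
    HasDerivAt.comp (h₂ := kummerA p) (h := fun y : ℝ => Complex.I * (y : ℂ)) y hA' hid
  have dB : HasDerivAt (fun y : ℝ => kummerB p (Complex.I * y)) (B' * (Complex.I * 1)) y :=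
    HasDerivAt.comp (h₂ := kummerB p) (h := fun y : ℝ => Complex.I * (y : ℂ)) y hB' hid
  have dE : HasDerivAt (fun y : ℝ => Complex.exp (-(Complex.I * (y : ℂ))))
    (Complex.exp (-(Complex.I * y)) * (-(Complex.I * 1))) y := hid.neg.cexp
  have hr : ∀ y : ℝ, ((‖kummerA p (Complex.I * y)‖ ^ 2 : ℝ) : ℂ) =
      kummerA p (Complex.I * y) * (kummerB p (Complex.I * y) * Complex.exp (-(Complex.I * y))) :=
    fun y => by
      rw [← conj_kummerA hp, Complex.mul_conj, Complex.normSq_eq_norm_sq]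
  have hgc : (starRingEnd ℂ) (kummerSq p y) =
      kummerB p (Complex.I * y) ^ 2 * Complex.exp (-(Complex.I * y)) := by
    rw [kummerSq, map_mul, map_pow, conj_kummerA hp, ← Complex.exp_conj]
    have : Complex.exp ((starRingEnd ℂ) (-(Complex.I * y))) * Complex.exp (-(Complex.I * y)) = 1 := by
      rw [← Complex.exp_add]
      simp
    linear_combination (kummerB p (Complex.I * y) ^ 2 * Complex.exp (-(Complex.I * y))) * this
  have hre : (((kummerSq p y).re : ℝ) : ℂ) =
      (kummerSq p y + (starRingEnd ℂ) (kummerSq p y)) / 2 := Complex.re_eq_add_conj _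
  have d1 : HasDerivAt (fun y : ℝ => ((‖kummerA p (Complex.I * y)‖ ^ 2 : ℝ) : ℂ))
      ((2 * p / y * ((kummerSq p y).re - ‖kummerA p (Complex.I * y)‖ ^ 2) : ℝ) : ℂ) y := by
    have := dA.mul (dB.mul dE)
    have e2 : (fun y : ℝ => ((‖kummerA p (Complex.I * y)‖ ^ 2 : ℝ) : ℂ)) =
      (fun y : ℝ => kummerA p (Complex.I * y)) * ((fun y : ℝ => kummerB p (Complex.I * y)) *
        fun y : ℝ => Complex.exp (-(Complex.I * (y : ℂ)))) := by
      funext y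
      rw [hr]
      rfl
    rw [e2]
    refine this.congr_deriv ?_
    simp only [Pi.mul_apply]
    rw [Complex.ofReal_mul, Complex.ofReal_sub, hr, hre, hgc, kummerSq]
    refine mul_left_cancel₀ hyc ?_
    push_cast
    generalize kummerA p (Complex.I * y) = A at *
    generalize kummerB p (Complex.I * y) = B at *
    generalize Complex.exp (-(Complex.I * y)) = E at *
    field_simp
    linear_combination (B * E) * eA + (A * E) * eB
  have d2 : HasDerivAt (fun y : ℝ => kummerSq p y) (Complex.I * kummerSq p y +
      2 * p / y * (((‖kummerA p (Complex.I * y)‖ ^ 2 : ℝ) : ℂ) - kummerSq p y)) y := by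
    have := (dA.pow 2).mul dE
    refine this.congr_deriv ?_
    simp only [Pi.pow_apply]
    rw [hr, kummerSq]
    refine mul_left_cancel₀ hyc ?_
    push_cast
    generalize kummerA p (Complex.I * y) = A at *
    generalize kummerB p (Complex.I * y) = B at *
    generalize Complex.exp (-(Complex.I * y)) = E at *
    field_simp
    linear_combination (2 * A * E) * eA
  refine ⟨?_, ?_, ?_⟩
  · have := Complex.reCLM.hasFDerivAt.comp_hasDerivAt y d1
    exact this.congr_deriv (Complex.ofReal_re _)
  · have := Complex.reCLM.hasFDerivAt.comp_hasDerivAt y d2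
    refine this.congr_deriv ?_
    rw [Complex.reCLM_apply, show (2 * (p : ℂ) / y) = ((2 * p / y : ℝ) : ℂ) by push_cast; rfl,
      Complex.add_re, Complex.re_ofReal_mul, Complex.sub_re, Complex.ofReal_re]
    simp
  · have := Complex.imCLM.hasFDerivAt.comp_hasDerivAt y d2
    refine this.congr_deriv ?_
    rw [Complex.imCLM_apply, show (2 * (p : ℂ) / y) = ((2 * p / y : ℝ) : ℂ) by push_cast; rfl,
      Complex.add_im, Complex.im_ofReal_mul, Complex.sub_im, Complex.ofReal_im]
    simp
    ring

end System

/-! ### Decay of the truncated density -/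

/-- A function with derivative `O(y⁻³)` converges, with error `O(y⁻²)`. -/
lemma exists_limit_of_deriv_le_inv_cube {f f' : ℝ → ℝ} {Y C : ℝ} (hY : 0 < Y)
    (hd : ∀ y ∈ Set.Ici Y, HasDerivAt f (f' y) y) (hb : ∀ y ∈ Set.Ici Y, |f' y| ≤ C / y ^ 3) :
    ∃ L, ∀ y ∈ Set.Ici Y, |f y - L| ≤ C / 2 / y ^ 2 := by
  have hpow : ∀ y ∈ Set.Ici Y, HasDerivAt (fun y : ℝ => C / 2 / y ^ 2) (-(C / y ^ 3)) y := by
    intro y hy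
    have hy0 : y ≠ 0 := (hY.trans_le hy).ne'
    refine (((hasDerivAt_pow 2 y).inv (pow_ne_zero 2 hy0)).const_mul (C / 2)).congr_deriv ?_
    field_simp
    norm_num
  have hu : AntitoneOn (fun y => f y + C / 2 / y ^ 2) (Set.Ici Y) := by
    refine antitoneOn_of_hasDerivWithinAt_nonpos (f' := fun y => f' y + -(C / y ^ 3))
      (convex_Ici Y) (fun y hy => ((hd y hy).add (hpow y hy)).continuousAt.continuousWithinAt)
      (fun y hy => ?_) fun y hy => ?_
    · exact ((hd y (interior_subset hy)).add (hpow y (interior_subset hy))).hasDerivWithinAt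
    · have := (abs_le.1 (hb y (interior_subset hy))).2
      linarith
  have hv : MonotoneOn (fun y => f y - C / 2 / y ^ 2) (Set.Ici Y) := by
    refine monotoneOn_of_hasDerivWithinAt_nonneg (f' := fun y => f' y - -(C / y ^ 3))
      (convex_Ici Y) (fun y hy => ((hd y hy).sub (hpow y hy)).continuousAt.continuousWithinAt)
      (fun y hy => ?_) fun y hy => ?_
    · exact ((hd y (interior_subset hy)).sub (hpow y (interior_subset hy))).hasDerivWithinAt
    · have := (abs_le.1 (hb y (interior_subset hy))).1
      linarith
  have hC : 0 ≤ C := by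
    have h1 := (abs_nonneg _).trans (hb Y Set.self_mem_Ici)
    have h2 : C = C / Y ^ 3 * Y ^ 3 := by field_simp
    rw [h2]
    positivity
  have hvu : ∀ y ∈ Set.Ici Y, ∀ y' ∈ Set.Ici Y,
      f y - C / 2 / y ^ 2 ≤ f y' + C / 2 / y' ^ 2 := by
    intro y hy y' hy'
    have hm : max y y' ∈ Set.Ici Y := le_trans (Set.mem_Ici.1 hy) (le_max_left y y')
    have h1 := hv hy hm (le_max_left _ _)
    have h2 := hu hy' hm (le_max_right _ _)
    have h3 : 0 ≤ C / 2 / (max y y') ^ 2 := by positivity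
    simp only at h1 h2
    linarith
  refine ⟨sInf ((fun y => f y + C / 2 / y ^ 2) '' Set.Ici Y), fun y hy => abs_le.2 ⟨?_, ?_⟩⟩
  · have : sInf ((fun y => f y + C / 2 / y ^ 2) '' Set.Ici Y) ≤ f y + C / 2 / y ^ 2 := by
      refine csInf_le ⟨f y - C / 2 / y ^ 2, ?_⟩ ⟨y, hy, rfl⟩
      rintro _ ⟨y', hy', rfl⟩
      exact hvu y hy y' hy'
    linarith
  · have : f y - C / 2 / y ^ 2 ≤ sInf ((fun y => f y + C / 2 / y ^ 2) '' Set.Ici Y) := by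
      refine le_csInf ⟨_, Y, Set.self_mem_Ici, rfl⟩ ?_
      rintro _ ⟨y', hy', rfl⟩
      exact hvu y hy y' hy'
    linarith

/-- Solutions of the system of `hasDerivAt_kummer_system` give a density that converges with error
`O(y⁻²)`: its derivative is `2p y^{2p-2} ω`, and `ω` integrates to a lower-order term. -/
lemma system_asymptotics {p : ℝ} {r d ω : ℝ → ℝ}
    (hr : ∀ y : ℝ, 0 < y → HasDerivAt r (2 * p / y * (d y - r y)) y)
    (hd : ∀ y : ℝ, 0 < y → HasDerivAt d (-ω y + 2 * p / y * (r y - d y)) y)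
    (hω : ∀ y : ℝ, 0 < y → HasDerivAt ω (d y - 2 * p / y * ω y) y)
    (hdr : ∀ y, |d y| ≤ r y) (hωr : ∀ y, |ω y| ≤ r y) :
    ∃ L C Y : ℝ, 0 < Y ∧ ∀ y ∈ Set.Ici Y,
      |y ^ (2 * p) * (r y - 2 * p / y * ω y) - L| ≤ C / y ^ 2 := by
  set Y : ℝ := 4 * |p| + 1 with hYdef
  have hY : 0 < Y := by positivity
  have hpos : ∀ y ∈ Set.Ici Y, 0 < y := fun y hy => hY.trans_le hy
  set P : ℝ → ℝ := fun y => y ^ (2 * p) * (r y - 2 * p / y * ω y) with hP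
  have hr0 : ∀ y, 0 ≤ r y := fun y => (abs_nonneg _).trans (hdr y)
  have hW : ∀ y : ℝ, 0 < y → HasDerivAt (fun y : ℝ => y ^ (2 * p))
      (2 * p / y * y ^ (2 * p)) y := by
    intro y hy
    refine (Real.hasDerivAt_rpow_const (p := 2 * p) (Or.inl hy.ne')).congr_deriv ?_
    rw [Real.rpow_sub_one hy.ne']
    ring
  have hinv : ∀ y : ℝ, 0 < y → HasDerivAt (fun y : ℝ => 2 * p / y) (-(2 * p / y ^ 2)) y := by
    intro y hy
    refine ((hasDerivAt_inv hy.ne').const_mul (2 * p)).congr_deriv ?_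
    ring
  have hPd : ∀ y : ℝ, 0 < y → HasDerivAt P (2 * p / y ^ 2 * (y ^ (2 * p) * ω y)) y := by
    intro y hy
    refine ((hW y hy).mul ((hr y hy).sub ((hinv y hy).mul (hω y hy)))).congr_deriv ?_
    simp only [Pi.sub_apply, Pi.mul_apply]
    field_simp
    ring
  have hRP : ∀ y ∈ Set.Ici Y, y ^ (2 * p) * r y ≤ 2 * P y := by
    intro y hy
    have hy0 := hpos y hy
    have hw := Real.rpow_nonneg hy0.le (2 * p)
    have h1 : 2 * p / y * ω y ≤ r y / 2 := by
      have h2 : |2 * p / y * ω y| ≤ 2 * |p| / y * r y := by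
        rw [abs_mul, abs_div, abs_mul, abs_two, abs_of_pos hy0]
        have := hωr y
        gcongr
      have h3 : 2 * |p| / y ≤ 1 / 2 := by
        rw [div_le_div_iff₀ hy0 two_pos]
        have : Y ≤ y := hy
        linarith
      have h4 := mul_le_mul_of_nonneg_right h3 (hr0 y)
      have := le_abs_self (2 * p / y * ω y)
      linarith
    have h5 : r y ≤ 2 * (r y - 2 * p / y * ω y) := by linarith
    calc y ^ (2 * p) * r y ≤ y ^ (2 * p) * (2 * (r y - 2 * p / y * ω y)) := by gcongr
      _ = _ := by rw [hP]; ring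
  have hR0 : ∀ y ∈ Set.Ici Y, 0 ≤ y ^ (2 * p) * r y := fun y hy =>
    mul_nonneg (Real.rpow_nonneg (hpos y hy).le _) (hr0 y)
  -- The density times `exp (4|p|/y)` is decreasing, hence the density is bounded.
  have hexp : ∀ y : ℝ, 0 < y → HasDerivAt (fun y : ℝ => Real.exp (4 * |p| / y))
      (Real.exp (4 * |p| / y) * (-(4 * |p| / y ^ 2))) y := by
    intro y hy
    refine (((hasDerivAt_inv hy.ne').const_mul (4 * |p|)).exp).congr_deriv ?_
    simp only [div_eq_mul_inv]
    ring
  have hanti : AntitoneOn (fun y => P y * Real.exp (4 * |p| / y)) (Set.Ici Y) := by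
    refine antitoneOn_of_hasDerivWithinAt_nonpos
      (f' := fun y => 2 * p / y ^ 2 * (y ^ (2 * p) * ω y) * Real.exp (4 * |p| / y) +
        P y * (Real.exp (4 * |p| / y) * (-(4 * |p| / y ^ 2))))
      (convex_Ici Y) (fun y hy => ((hPd y (hpos y hy)).mul
        (hexp y (hpos y hy))).continuousAt.continuousWithinAt) (fun y hy => ?_) fun y hy => ?_
    · exact ((hPd y (hpos y (interior_subset hy))).mul
        (hexp y (hpos y (interior_subset hy)))).hasDerivWithinAt
    · have hyY : y ∈ Set.Ici Y := interior_subset hy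
      have hy0 := hpos y hyY
      have hw := Real.rpow_nonneg hy0.le (2 * p)
      have h1 : 2 * p / y ^ 2 * (y ^ (2 * p) * ω y) ≤ 4 * |p| / y ^ 2 * P y := by
        calc 2 * p / y ^ 2 * (y ^ (2 * p) * ω y)
            ≤ |2 * p / y ^ 2 * (y ^ (2 * p) * ω y)| := le_abs_self _
          _ = 2 * |p| / y ^ 2 * (y ^ (2 * p) * |ω y|) := by
            rw [abs_mul, abs_div, abs_mul, abs_mul, abs_two, abs_of_nonneg hw,
              abs_of_nonneg (by positivity : 0 ≤ y ^ 2)]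
          _ ≤ 2 * |p| / y ^ 2 * (y ^ (2 * p) * r y) := by
            have := hωr y
            gcongr
          _ ≤ 2 * |p| / y ^ 2 * (2 * P y) := by
            have := hRP y hyY
            gcongr
          _ = _ := by ring
      have h2 := mul_le_mul_of_nonneg_right h1 (Real.exp_pos (4 * |p| / y)).le
      linarith
  set K : ℝ := P Y * Real.exp (4 * |p| / Y) with hK
  have hPK : ∀ y ∈ Set.Ici Y, P y ≤ K := by
    intro y hy
    have h1 := hanti Set.self_mem_Ici hy hy
    simp only at h1
    have h2 : 0 ≤ P y := by linarith [hRP y hy, hR0 y hy]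
    have h3 : 1 ≤ Real.exp (4 * |p| / y) := Real.one_le_exp (by have := hpos y hy; positivity)
    calc P y = P y * 1 := (mul_one _).symm
      _ ≤ P y * Real.exp (4 * |p| / y) := by gcongr
      _ ≤ K := h1
  have hR : ∀ y ∈ Set.Ici Y, y ^ (2 * p) * r y ≤ 2 * K := fun y hy => by
    linarith [hRP y hy, hPK y hy]
  have hD : ∀ y ∈ Set.Ici Y, |y ^ (2 * p) * d y| ≤ 2 * K := fun y hy => by
    have hw := Real.rpow_nonneg (hpos y hy).le (2 * p)
    rw [abs_mul, abs_of_nonneg hw]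
    exact (mul_le_mul_of_nonneg_left (hdr y) hw).trans (hR y hy)
  -- Integrating the oscillatory part once gains a further power of `y`.
  obtain ⟨L, hL⟩ := exists_limit_of_deriv_le_inv_cube (C := (4 * p ^ 2 + 4 * |p|) * (2 * K)) hY
    (f := fun y => P y + 2 * p / y ^ 2 * (y ^ (2 * p) * d y))
    (f' := fun y => (4 * p ^ 2 * (y ^ (2 * p) * r y) - 4 * p * (y ^ (2 * p) * d y)) / y ^ 3)
    (fun y hy => by
      have hy0 := hpos y hy
      have h2 : HasDerivAt (fun y : ℝ => 2 * p / y ^ 2) (-(4 * p / y ^ 3)) y := by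
        refine (((hasDerivAt_pow 2 y).inv (pow_ne_zero 2 hy0.ne')).const_mul
          (2 * p)).congr_deriv ?_
        field_simp
        ring
      refine ((hPd y hy0).add (h2.mul ((hW y hy0).mul (hd y hy0)))).congr_deriv ?_
      simp only [Pi.mul_apply]
      field_simp
      ring)
    (fun y hy => by
      have hy0 := hpos y hy
      rw [abs_div, abs_of_pos (by positivity : 0 < y ^ 3)]
      gcongr
      refine (abs_sub _ _).trans ?_
      rw [abs_mul, abs_mul (4 * p), abs_mul 4 p, abs_of_nonneg (hR0 y hy),
        abs_of_nonneg (by positivity : (0 : ℝ) ≤ 4 * p ^ 2),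
        abs_of_nonneg (by norm_num : (0 : ℝ) ≤ 4)]
      have h1 := hR y hy
      have h2 := hD y hy
      rw [add_mul]
      gcongr)
  refine ⟨L, (4 * p ^ 2 + 4 * |p|) * (2 * K) / 2 + 2 * |p| * (2 * K), Y, hY, fun y hy => ?_⟩
  have hy0 := hpos y hy
  have h1 := hL y hy
  have h2 : |2 * p / y ^ 2 * (y ^ (2 * p) * d y)| ≤ 2 * |p| * (2 * K) / y ^ 2 := by
    rw [abs_mul, abs_div, abs_mul, abs_two, abs_of_nonneg (by positivity : 0 ≤ y ^ 2),
      div_mul_eq_mul_div]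
    have := hD y hy
    gcongr
  have h3 : P y - L = (P y + 2 * p / y ^ 2 * (y ^ (2 * p) * d y) - L) -
      2 * p / y ^ 2 * (y ^ (2 * p) * d y) := by ring
  change |P y - L| ≤ _
  rw [h3, add_div]
  exact (abs_sub _ _).trans (add_le_add h1 h2)

/-- The normalising constant of the limiting density. -/
noncomputable def bulkConst (p : ℝ) : ℝ := 2 * Real.pi / weightMass p / Real.Gamma (2 * p + 1)

/-- The analytic factor of the limiting density, an entire even function of `y`. -/
noncomputable def bulkFactor (p y : ℝ) : ℝ :=
  ‖kummerA p (Complex.I * y)‖ ^ 2 - 2 * p / y * (kummerSq p y).im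

section Bulk

variable {p : ℝ} (hp : -(1 / 2) < p)

include hp

lemma bulkLimit_eq (y : ℝ) :
    bulkLimit p y = bulkConst p * |y| ^ (2 * p) * bulkFactor p y := by
  rw [bulkLimit, bulkConst, bulkFactor, kummerA_mul_conj_kummerB hp]

/-- The limiting density tends to a constant at infinity, with error `O(y⁻²)`. -/
lemma bulkLimit_asymptotics : ∃ L C Y : ℝ, 0 < Y ∧ ∀ y ∈ Set.Ici Y,
    |bulkLimit p y - L| ≤ C / y ^ 2 := by
  obtain ⟨L, C, Y, hY, h⟩ := system_asymptotics (p := p)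
    (r := fun y => ‖kummerA p (Complex.I * y)‖ ^ 2) (d := fun y => (kummerSq p y).re)
    (ω := fun y => (kummerSq p y).im)
    (fun y hy => (hasDerivAt_kummer_system hp y hy.ne').1)
    (fun y hy => (hasDerivAt_kummer_system hp y hy.ne').2.1)
    (fun y hy => (hasDerivAt_kummer_system hp y hy.ne').2.2)
    (fun y => (Complex.abs_re_le_norm _).trans_eq (norm_kummerSq y))
    (fun y => (Complex.abs_im_le_norm _).trans_eq (norm_kummerSq y))
  refine ⟨bulkConst p * L, |bulkConst p| * C, Y, hY, fun y hy => ?_⟩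
  have hy0 : 0 < y := hY.trans_le hy
  rw [bulkLimit_eq hp, abs_of_pos hy0, mul_assoc, ← mul_sub, abs_mul, mul_div_assoc]
  exact mul_le_mul_of_nonneg_left (h y hy) (abs_nonneg _)

end Bulk

/-! ### Taylor coefficients of the analytic factor -/

/-- Taylor coefficients, in powers of `y²`, of the analytic factor of the limiting density. -/
noncomputable def bulkCoeff (p : ℝ) (j : ℕ) : ℝ :=
  1 / (2 * p + 1) * ∏ i ∈ Finset.range j,
    (-((i + p) / (2 * (i + 1) * (i + 1 + 2 * p) * (2 * (i + 1) + 2 * p + 1))))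

lemma bulkCoeff_succ (p : ℝ) (j : ℕ) : bulkCoeff p (j + 1) = bulkCoeff p j *
    (-((j + p) / (2 * (j + 1) * (j + 1 + 2 * p) * (2 * (j + 1) + 2 * p + 1)))) := by
  rw [bulkCoeff, bulkCoeff, Finset.prod_range_succ]
  ring

section Formal

open PowerSeries

/-- Formal power series of `₁F₁(p + 1; 2p + 1; w)`. -/
noncomputable def formalA (p : ℝ) : PowerSeries ℝ := PowerSeries.mk fun k => pochRatioA p k / (k ! : ℝ)

/-- Formal power series of `₁F₁(p; 2p + 1; w)`. -/
noncomputable def formalB (p : ℝ) : PowerSeries ℝ := PowerSeries.mk fun k => pochRatioB p k / (k ! : ℝ)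

/-- Formal power series of `exp (-w)`. -/
noncomputable def formalE : PowerSeries ℝ := PowerSeries.mk fun k => (-1) ^ k / (k ! : ℝ)

lemma coeff_X_mul_derivative (F : PowerSeries ℝ) (k : ℕ) :
    coeff k (X * PowerSeries.derivative ℝ F) = k * coeff k F := by
  rcases k with _ | k
  · simp
  · rw [coeff_succ_X_mul, PowerSeries.coeff_derivative]
    push_cast
    ring

lemma X_mul_derivative_formalE : X * PowerSeries.derivative ℝ formalE = -(X * formalE) := by
  ext k
  rw [coeff_X_mul_derivative]
  rcases k with _ | k
  · simp
  · rw [map_neg, coeff_succ_X_mul, formalE, coeff_mk, coeff_mk, Nat.factorial_succ]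
    push_cast
    field_simp
    ring

lemma X_mul_derivative_formalA {p : ℝ} (hp : -(1 / 2) < p) :
    X * PowerSeries.derivative ℝ (formalA p) =
      X * formalA p + C p * (formalB p - formalA p) := by
  ext k
  rw [coeff_X_mul_derivative]
  rcases k with _ | k
  · simp [formalA, formalB, pochRatioA, pochRatioB]
  · rw [map_add, coeff_succ_X_mul, coeff_C_mul, map_sub, formalA, formalB, coeff_mk, coeff_mk,
      coeff_mk]
    have hA := pochRatioA_succ_mul hp k
    have hB := pochRatioB_mul p (k + 1)
    have hq := (add_param_pos hp k).ne'
    rw [Nat.factorial_succ]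
    push_cast at hB ⊢
    field_simp
    refine mul_left_cancel₀ hq ?_
    linear_combination ((k : ℝ) + 1) * hA - p * hB

lemma X_mul_derivative_formalB (p : ℝ) :
    X * PowerSeries.derivative ℝ (formalB p) = C p * (formalA p - formalB p) := by
  ext k
  rw [coeff_X_mul_derivative, coeff_C_mul, map_sub, formalA, formalB, coeff_mk, coeff_mk]
  have hB := pochRatioB_mul p k
  linear_combination (1 / (k ! : ℝ)) * hB

/-- Formal counterpart of `|A|²`. -/
noncomputable def formalR (p : ℝ) : PowerSeries ℝ := formalA p * formalB p * formalE

/-- Formal counterpart of the even combination `(A² + B²) e^{-w} / 2`. -/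
noncomputable def formalD (p : ℝ) : PowerSeries ℝ :=
  C (1 / 2) * (formalA p * formalA p + formalB p * formalB p) * formalE

/-- Formal counterpart of the odd combination `(A² - B²) e^{-w} / 2`. -/
noncomputable def formalO (p : ℝ) : PowerSeries ℝ :=
  C (1 / 2) * (formalA p * formalA p - formalB p * formalB p) * formalE

lemma formal_system {p : ℝ} (hp : -(1 / 2) < p) :
    X * PowerSeries.derivative ℝ (formalR p) = C (2 * p) * (formalD p - formalR p) ∧
    X * PowerSeries.derivative ℝ (formalD p) =
      X * formalO p + C (2 * p) * (formalR p - formalD p) ∧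
    X * PowerSeries.derivative ℝ (formalO p) = X * formalD p - C (2 * p) * formalO p := by
  have hA := X_mul_derivative_formalA hp
  have hB := X_mul_derivative_formalB p
  have hE := X_mul_derivative_formalE
  have hC2 : (C (2 : ℝ) : PowerSeries ℝ) = 2 := map_ofNat C 2
  have h2 : (C (2 * p) : PowerSeries ℝ) = 2 * C p := by
    rw [map_mul, hC2]
  have h3 : (2 : PowerSeries ℝ) * C (1 / 2 : ℝ) = 1 := by
    rw [← hC2, ← map_mul]
    norm_num
  have hC : ∀ a : ℝ, PowerSeries.derivative ℝ (C a) = 0 := fun a => PowerSeries.derivative_C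
  refine ⟨?_, ?_, ?_⟩
  · rw [formalR, formalD, h2]
    simp only [Derivation.leibniz, smul_eq_mul]
    linear_combination formalB p * formalE * hA + formalA p * formalE * hB +
      formalA p * formalB p * hE - C p * (formalA p ^ 2 + formalB p ^ 2) * formalE * h3
  · rw [formalR, formalD, formalO, h2]
    simp only [Derivation.leibniz, smul_eq_mul, map_add, hC]
    linear_combination C (1 / 2) * (2 * formalA p * formalE * hA + 2 * formalB p * formalE * hB +
      (formalA p ^ 2 + formalB p ^ 2) * hE) + 2 * C p * formalA p * formalB p * formalE * h3
  · rw [formalD, formalO, h2]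
    simp only [Derivation.leibniz, smul_eq_mul, map_sub, hC]
    linear_combination C (1 / 2) * (2 * formalA p * formalE * hA - 2 * formalB p * formalE * hB +
      (formalA p ^ 2 - formalB p ^ 2) * hE)

end Formal

section FormalCoeff

open PowerSeries

lemma formalO_coeff_zero (p : ℝ) : coeff 0 (formalO p) = 0 := by
  simp [formalO, formalA, formalB, pochRatioA, pochRatioB]

lemma formalR_coeff_zero (p : ℝ) : coeff 0 (formalR p) = 1 := by
  simp [formalR, formalA, formalB, formalE, pochRatioA, pochRatioB]

lemma formalD_coeff_zero (p : ℝ) : coeff 0 (formalD p) = 1 := by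
  simp [formalD, formalA, formalB, formalE, pochRatioA, pochRatioB]
  norm_num

lemma formalD_coeff_one {p : ℝ} (hp : -(1 / 2) < p) : coeff 1 (formalD p) = 0 := by
  have h : (1 + 2 * p) ≠ 0 := by linarith
  have hA := pochRatioA_succ_mul hp 0
  have hB := pochRatioB_mul p 1
  have hA0 : pochRatioA p 0 = 1 := by simp [pochRatioA]
  have hB0 : pochRatioB p 0 = 1 := by simp [pochRatioB]
  rw [hA0] at hA
  norm_num at hA hB
  have key : pochRatioA p 1 + pochRatioB p 1 = 1 := by
    have hq : (1 + p) ≠ 0 := by linarith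
    refine mul_left_cancel₀ h (mul_left_cancel₀ hq ?_)
    linear_combination (1 + p + p) * hA + (1 + 2 * p) * hB
  simp [formalD, formalA, formalB, formalE, PowerSeries.coeff_mul,
    Finset.Nat.antidiagonal_succ, hA0, hB0]
  linarith

variable {p : ℝ} (hp : -(1 / 2) < p)

include hp

lemma formalR_coeff (k : ℕ) : (k + 2 * p) * coeff k (formalR p) = 2 * p * coeff k (formalD p) := by
  have h := congrArg (coeff k) (formal_system hp).1
  rw [coeff_X_mul_derivative, coeff_C_mul, map_sub] at h
  linarith

lemma formalO_coeff (k : ℕ) :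
    (k + 1 + 2 * p) * coeff (k + 1) (formalO p) = coeff k (formalD p) := by
  have h := congrArg (coeff (k + 1)) (formal_system hp).2.2
  rw [coeff_X_mul_derivative, map_sub, coeff_C_mul, coeff_succ_X_mul] at h
  push_cast at h
  linarith

lemma formalD_coeff (k : ℕ) :
    (k + 1 + 2 * p) * coeff (k + 1) (formalD p) =
      coeff k (formalO p) + 2 * p * coeff (k + 1) (formalR p) := by
  have h := congrArg (coeff (k + 1)) (formal_system hp).2.1
  rw [coeff_X_mul_derivative, map_add, coeff_C_mul, coeff_succ_X_mul, map_sub] at h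
  push_cast at h
  linarith

lemma formalD_coeff_add_two (k : ℕ) :
    (k + 2) * (k + 2 + 4 * p) * (k + 1 + 2 * p) * coeff (k + 2) (formalD p) =
      (k + 2 + 2 * p) * coeff k (formalD p) := by
  have h1 := formalR_coeff hp (k + 2)
  have h2 := formalD_coeff hp (k + 1)
  have h3 := formalO_coeff hp k
  push_cast at h1 h2 h3
  linear_combination (k + 2 + 2 * p) * h3 + (k + 1 + 2 * p) * (k + 2 + 2 * p) * h2 +
    (k + 1 + 2 * p) * (2 * p) * h1

lemma formalD_coeff_odd (j : ℕ) : coeff (2 * j + 1) (formalD p) = 0 := by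
  induction j with
  | zero => exact formalD_coeff_one hp
  | succ j ih =>
    have h := formalD_coeff_add_two hp (2 * j + 1)
    rw [ih, mul_zero] at h
    push_cast at h
    have hj : (0 : ℝ) ≤ j := j.cast_nonneg
    have h0 : (2 * (j : ℝ) + 1 + 2) * (2 * j + 1 + 2 + 4 * p) * (2 * j + 1 + 1 + 2 * p) ≠ 0 := by
      refine mul_ne_zero (mul_ne_zero ?_ ?_) ?_ <;> linarith
    exact (mul_eq_zero.1 h).resolve_left h0

/-- The coefficients of `|A|² - (2p/w) O`. -/
lemma formal_bulk_coeff (k : ℕ) :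
    coeff k (formalR p) - 2 * p * coeff (k + 1) (formalO p) =
      if Even k then (-1) ^ (k / 2) * bulkCoeff p (k / 2) else 0 := by
  have hO := formalO_coeff hp k
  have hR := formalR_coeff hp k
  have hk0 : (0 : ℝ) ≤ k := k.cast_nonneg
  have hk1 : (k : ℝ) + 1 + 2 * p ≠ 0 := by linarith
  split_ifs with hk
  · obtain ⟨j, rfl⟩ := hk
    rw [← two_mul, Nat.mul_div_cancel_left _ two_pos]
    clear hO hR hk1 hk0
    -- The relation at `j` holds also for `j = p = 0`, where both sides vanish.
    have aux : ∀ j : ℕ, (2 * j + 2 * p) * (2 * j + 1 + 2 * p) *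
        (coeff (2 * j) (formalR p) - 2 * p * coeff (2 * j + 1) (formalO p)) =
        2 * p * coeff (2 * j) (formalD p) := by
      intro j
      have hO := formalO_coeff hp (2 * j)
      have hR := formalR_coeff hp (2 * j)
      push_cast at hO hR
      linear_combination (2 * (j : ℝ) + 1 + 2 * p) * hR - (2 * j + 2 * p) * (2 * p) * hO
    induction j with
    | zero =>
      have hO := formalO_coeff hp 0
      have h1 : 2 * p + 1 ≠ 0 := by linarith
      norm_num [formalD_coeff_zero] at hO
      simp only [mul_zero, zero_add, formalR_coeff_zero, pow_zero, bulkCoeff, Finset.range_zero,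
        Finset.prod_empty]
      rw [mul_one, one_mul, eq_div_iff h1]
      linear_combination -(2 * p) * hO
    | succ j ih =>
      have hj : (0 : ℝ) ≤ j := j.cast_nonneg
      have e1 := aux (j + 1)
      have e2 := aux j
      have e3 := formalD_coeff_add_two hp (2 * j)
      rw [ih] at e2
      rw [bulkCoeff_succ]
      rw [show 2 * (j + 1) = 2 * j + 2 by ring] at e1 ⊢
      push_cast at e1 e3
      set v := coeff (2 * j + 2) (formalR p) - 2 * p * coeff (2 * j + 2 + 1) (formalO p)
      have n1 : 2 * (j : ℝ) + 2 + 2 * p ≠ 0 := by linarith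
      have n2 : (j : ℝ) + 1 + 2 * p ≠ 0 := by linarith
      have n4 : (j : ℝ) + 1 ≠ 0 := by linarith
      have n5 : 2 * (j : ℝ) + 1 + 2 * p ≠ 0 := by linarith
      have n6 : 2 * ((j : ℝ) + 1) * (j + 1 + 2 * p) * (2 * (j + 1) + 2 * p + 1) ≠ 0 := by
        refine mul_ne_zero (mul_ne_zero (mul_ne_zero two_ne_zero n4) n2) ?_
        linarith
      have hq := div_mul_cancel₀ ((j : ℝ) + p) n6
      set q := ((j : ℝ) + p) / (2 * (j + 1) * (j + 1 + 2 * p) * (2 * (j + 1) + 2 * p + 1))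
      refine mul_left_cancel₀ n6 (mul_left_cancel₀ n1 (mul_left_cancel₀ n5 ?_))
      rw [pow_succ]
      linear_combination (2 * ((j : ℝ) + 1) * (j + 1 + 2 * p)) * (2 * j + 1 + 2 * p) * e1 +
        p * e3 - (1 / 2) * (2 * (j : ℝ) + 2 + 2 * p) * e2 -
        (2 * (j : ℝ) + 2 + 2 * p) * (2 * j + 1 + 2 * p) * (-1) ^ j * bulkCoeff p j * hq
  · obtain ⟨j, rfl⟩ := Nat.not_even_iff_odd.1 hk
    rw [formalD_coeff_odd hp, mul_zero] at hR
    rw [formalD_coeff_odd hp] at hO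
    have h1 : ((2 * j + 1 : ℕ) : ℝ) + 2 * p ≠ 0 := by
      have : (0 : ℝ) ≤ j := j.cast_nonneg
      push_cast
      linarith
    rw [(mul_eq_zero.1 hR).resolve_left h1, (mul_eq_zero.1 hO).resolve_left hk1]
    simp

end FormalCoeff

section Bulk

variable {p : ℝ} (hp : -(1 / 2) < p)

include hp

/-- The analytic factor of the limiting density is an even power series. -/
lemma hasSum_bulkFactor {y : ℝ} (hy : y ≠ 0) :
    HasSum (fun j => bulkCoeff p j * y ^ (2 * j)) (bulkFactor p y) := by
  set w : ℂ := Complex.I * y with hw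
  have hw0 : w ≠ 0 := mul_ne_zero Complex.I_ne_zero (by exact_mod_cast hy)
  let T : PowerSeries ℝ → PowerSeries ℂ := PowerSeries.map Complex.ofRealHom
  have hTc : ∀ (F : PowerSeries ℝ) k, (T F).coeff k = ((F.coeff k : ℝ) : ℂ) := fun F k => by
    simp [T]
  have hTm : ∀ F G, T (F * G) = T F * T G := fun F G => map_mul _ F G
  have sA : Summable fun k => ‖(T (formalA p)).coeff k * w ^ k‖ := by
    simp only [hTc, formalA, PowerSeries.coeff_mk]
    exact summable_mul_pow (summable_kummer (abs_pochRatioA_le hp) ‖w‖ (norm_nonneg w)) le_rfl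
  have sB : Summable fun k => ‖(T (formalB p)).coeff k * w ^ k‖ := by
    simp only [hTc, formalB, PowerSeries.coeff_mk]
    exact summable_mul_pow (summable_kummer (abs_pochRatioB_le hp) ‖w‖ (norm_nonneg w)) le_rfl
  have hA : HasSum (fun k => (T (formalA p)).coeff k * w ^ k) (kummerA p w) := by
    have := sA.of_norm.hasSum
    simpa only [hTc, formalA, PowerSeries.coeff_mk, kummerA] using this
  have hB : HasSum (fun k => (T (formalB p)).coeff k * w ^ k) (kummerB p w) := by
    have := sB.of_norm.hasSum
    simpa only [hTc, formalB, PowerSeries.coeff_mk, kummerB] using this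
  have eE : ∀ k, (T formalE).coeff k * w ^ k = (-w) ^ k / (k ! : ℂ) := fun k => by
    rw [hTc, formalE, PowerSeries.coeff_mk, neg_pow w]
    push_cast
    ring
  have sE : Summable fun k => ‖(T formalE).coeff k * w ^ k‖ := by
    simp only [eE]
    exact NormedSpace.norm_expSeries_div_summable (-w)
  have hE : HasSum (fun k => (T formalE).coeff k * w ^ k) (Complex.exp (-w)) := by
    simp only [eE]
    rw [Complex.exp_eq_exp_ℂ]
    exact NormedSpace.expSeries_div_hasSum_exp (-w)
  obtain ⟨sAB, hAB⟩ := hasSum_powerSeries_mul sA sB hA hB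
  obtain ⟨sAA, hAA⟩ := hasSum_powerSeries_mul sA sA hA hA
  obtain ⟨sBB, hBB⟩ := hasSum_powerSeries_mul sB sB hB hB
  have hR := (hasSum_powerSeries_mul sAB sE hAB hE).2
  have hO1 := (hasSum_powerSeries_mul sAA sE hAA hE).2
  have hO2 := (hasSum_powerSeries_mul sBB sE hBB hE).2
  have hO : HasSum (fun k => (((formalO p).coeff k : ℝ) : ℂ) * w ^ k)
      ((kummerSq p y).im * Complex.I) := by
    have h := (hO1.sub hO2).mul_left (1 / 2 : ℂ)
    have e2 : (1 / 2 : ℂ) * (kummerA p w * kummerA p w * Complex.exp (-w) -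
        kummerB p w * kummerB p w * Complex.exp (-w)) = (kummerSq p y).im * Complex.I := by
      have e3 : kummerB p w * kummerB p w * Complex.exp (-w) =
          (starRingEnd ℂ) (kummerSq p y) := by
        rw [kummerSq, map_mul, map_pow, conj_kummerA hp, ← Complex.exp_conj, hw]
        simp only [map_neg, map_mul, Complex.conj_I, Complex.conj_ofReal, neg_mul, neg_neg]
        have : Complex.exp (-(Complex.I * y)) * Complex.exp (Complex.I * y) = 1 := by
          rw [← Complex.exp_add]; simp
        linear_combination -kummerB p (Complex.I * y) ^ 2 * Complex.exp (-(Complex.I * y)) * this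
      have e4 := Complex.sub_conj (kummerSq p y)
      push_cast at e4
      rw [e3]
      have e5 : kummerA p w * kummerA p w * Complex.exp (-w) = kummerSq p y := by
        rw [kummerSq, pow_two]
      rw [e5]
      linear_combination (1 / 2 : ℂ) * e4
    rw [e2] at h
    refine h.congr_fun ?_
    intro k
    rw [← hTm, ← hTm, ← hTm, ← hTm, hTc, hTc, formalO, mul_assoc (PowerSeries.C _), sub_mul,
      PowerSeries.coeff_C_mul, map_sub]
    push_cast
    ring
  rw [← hTm, ← hTm] at hR
  simp only [hTc] at hR
  have eR : kummerA p w * kummerB p w * Complex.exp (-w) =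
      ((‖kummerA p w‖ ^ 2 : ℝ) : ℂ) := by
    rw [mul_assoc, hw, ← conj_kummerA hp, Complex.mul_conj, Complex.normSq_eq_norm_sq]
  rw [eR] at hR
  change HasSum (fun k => (((formalR p).coeff k : ℝ) : ℂ) * w ^ k) _ at hR
  have hO' : HasSum (fun k => (((formalO p).coeff (k + 1) : ℝ) : ℂ) * w ^ k)
      ((kummerSq p y).im * Complex.I / w) := by
    have h := ((hasSum_nat_add_iff' 1).2 hO).div_const w
    simp only [Finset.range_one, Finset.sum_singleton, PowerSeries.coeff_zero_eq_constantCoeff]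
      at h
    have h0 : PowerSeries.constantCoeff (formalO p) = 0 := by
      rw [← PowerSeries.coeff_zero_eq_constantCoeff_apply]; exact formalO_coeff_zero p
    rw [h0] at h
    simp only [Complex.ofReal_zero, zero_mul, sub_zero] at h
    refine h.congr_fun fun k => ?_
    rw [pow_succ]
    field_simp
  have hsum := hR.sub (hO'.mul_left (2 * p : ℂ))
  have eV : ((‖kummerA p w‖ ^ 2 : ℝ) : ℂ) - 2 * p * ((kummerSq p y).im * Complex.I / w) =
      ((bulkFactor p y : ℝ) : ℂ) := by
    rw [bulkFactor, ← hw]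
    have : (y : ℂ) ≠ 0 := by exact_mod_cast hy
    push_cast
    rw [hw]
    field_simp
  rw [eV] at hsum
  have hinj : Function.Injective fun j : ℕ => 2 * j := fun a b h => by simpa using h
  rw [← hinj.hasSum_iff] at hsum
  · rw [← Complex.hasSum_ofReal]
    refine hsum.congr_fun fun j => ?_
    have h := formal_bulk_coeff hp (2 * j)
    rw [if_pos (even_two_mul j), Nat.mul_div_cancel_left _ two_pos] at h
    have h' := congrArg (fun x : ℝ => (x : ℂ)) h
    simp only [Complex.ofReal_sub, Complex.ofReal_mul] at h'
    simp only [Function.comp]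
    have hI : w ^ (2 * j) = (-1) ^ j * (y : ℂ) ^ (2 * j) := by
      rw [hw, mul_pow, pow_mul Complex.I, Complex.I_sq]
    have hs : ((-1 : ℂ) ^ j) * (-1) ^ j = 1 := by rw [← mul_pow]; norm_num
    rw [hI]
    push_cast at h' ⊢
    linear_combination -(((-1) ^ j * (y : ℂ) ^ (2 * j))) * h' - 
      (bulkCoeff p j : ℂ) * (y : ℂ) ^ (2 * j) * hs
  · intro k hk
    have hk' : ¬ Even k := fun ⟨j, hj⟩ => hk ⟨j, by simp only; omega⟩
    have h := formal_bulk_coeff hp k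
    rw [if_neg hk'] at h
    have h' := congrArg (fun x : ℝ => (x : ℂ)) h
    push_cast at h'
    linear_combination w ^ k * h'

end Bulk

/-! ### Wallis integrals with real exponent -/

/-- The Wallis integral `∫_0^{π/2} cos^m`. -/
noncomputable def wallisInt (m : ℝ) : ℝ := ∫ α in (0 : ℝ)..Real.pi / 2, Real.cos α ^ m

lemma wallisInt_add_two {m : ℝ} (hm : -1 < m) :
    (m + 2) * wallisInt (m + 2) = (m + 1) * wallisInt m := by
  have hpi : (0 : ℝ) ≤ Real.pi / 2 := by positivity
  have hi1 := (intervalIntegrable_cos_rpow (show -1 < m + 2 by linarith)).const_mul (m + 2)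
  have hi2 := (intervalIntegrable_cos_rpow hm).const_mul (m + 1)
  have h := intervalIntegral.integral_eq_sub_of_hasDerivAt_of_le hpi
    (f := fun α => Real.sin α * Real.cos α ^ (m + 1))
    (f' := fun α => (m + 2) * Real.cos α ^ (m + 2) - (m + 1) * Real.cos α ^ m)
    (Real.continuous_sin.continuousOn.mul
      (Real.continuous_cos.continuousOn.rpow_const fun α _ => Or.inr (by linarith)))
    (fun α hα => by
      have hc : 0 < Real.cos α := Real.cos_pos_of_mem_Ioo ⟨by linarith [hα.1, Real.pi_pos], hα.2⟩
      refine ((Real.hasDerivAt_sin α).mul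
        ((Real.hasDerivAt_cos α).rpow_const (p := m + 1) (Or.inl hc.ne'))).congr_deriv ?_
      rw [add_sub_cancel_right, show m + 2 = m + 1 + 1 by ring, Real.rpow_add_one hc.ne' (m + 1),
        Real.rpow_add_one hc.ne' m]
      have := Real.sin_sq_add_cos_sq α
      linear_combination -(m + 1) * Real.cos α ^ m * this)
    (hi1.sub hi2)
  rw [intervalIntegral.integral_sub hi1 hi2, intervalIntegral.integral_const_mul,
    intervalIntegral.integral_const_mul] at h
  simp only [Real.cos_pi_div_two, Real.sin_zero, zero_mul, sub_zero] at h
  rw [Real.zero_rpow (by linarith), mul_zero] at h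
  rw [wallisInt, wallisInt]
  linarith

lemma wallisInt_pos {m : ℝ} (hm : -1 < m) : 0 < wallisInt m := by
  have h := intervalIntegral.intervalIntegral_pos_of_pos_on (intervalIntegrable_cos_rpow hm)
    (fun α hα => Real.rpow_pos_of_pos
      (Real.cos_pos_of_mem_Ioo ⟨by linarith [hα.1, Real.pi_pos], hα.2⟩) m) (by positivity)
  exact h

lemma wallisInt_anti {m n : ℝ} (hm : -1 < m) (hmn : m ≤ n) : wallisInt n ≤ wallisInt m := by
  refine intervalIntegral.integral_mono_on_of_le_Ioo (by positivity)
    (intervalIntegrable_cos_rpow (hm.trans_le hmn)) (intervalIntegrable_cos_rpow hm)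
    fun α hα => ?_
  exact Real.rpow_le_rpow_of_exponent_ge
    (Real.cos_pos_of_mem_Ioo ⟨by linarith [hα.1, Real.pi_pos], hα.2⟩) (Real.cos_le_one α) hmn

/-- The product `(m + 1) I(m) I(m + 1)` has period one in `m`, and the monotonicity of `I`
makes it constant. -/
lemma wallisInt_mul_wallisInt {m : ℝ} (hm : -1 < m) :
    (m + 1) * (wallisInt m * wallisInt (m + 1)) = Real.pi / 2 := by
  set g : ℝ → ℝ := fun m => (m + 1) * (wallisInt m * wallisInt (m + 1)) with hg
  have hstep : ∀ m : ℝ, -1 < m → g (m + 1) = g m := by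
    intro m hm
    have := wallisInt_add_two hm
    simp only [hg]
    rw [show m + 1 + 1 = m + 2 by ring]
    linear_combination wallisInt (m + 1) * this
  have hper : ∀ (n : ℕ) (m : ℝ), -1 < m → g (m + n) = g m := by
    intro n m hm
    induction n with
    | zero => simp
    | succ n ih =>
      rw [← ih, ← hstep (m + n) (by have : (0 : ℝ) ≤ n := n.cast_nonneg; linarith)]
      push_cast
      ring_nf
  have hg0 : g 0 = Real.pi / 2 := by
    simp [hg, wallisInt]
  have hgn : ∀ n : ℕ, g n = Real.pi / 2 := fun n => by
    have := hper n 0 (by norm_num)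
    rwa [zero_add, hg0] at this
  -- Compare with the neighbouring integers.
  have hcomp : ∀ (k : ℕ) (x : ℝ), (k : ℝ) ≤ x → x ≤ k + 1 →
      g x ≤ (k + 2) / (k + 1) * (Real.pi / 2) ∧ (k + 1) / (k + 2) * (Real.pi / 2) ≤ g x := by
    intro k x h1 h2
    have hk : (0 : ℝ) ≤ k := k.cast_nonneg
    have e1 := hgn k
    have e2 := hgn (k + 1)
    simp only [hg] at e1 e2 ⊢
    push_cast at e2
    have p1 := wallisInt_pos (show -1 < x by linarith)
    have p2 := wallisInt_pos (show -1 < x + 1 by linarith)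
    have q0 := wallisInt_pos (show -1 < (k : ℝ) by linarith)
    have q1 := wallisInt_pos (show -1 < (k : ℝ) + 1 by linarith)
    have q2 := wallisInt_pos (show -1 < (k : ℝ) + 1 + 1 by linarith)
    have a1 := wallisInt_anti (show -1 < (k : ℝ) by linarith) h1
    have a2 := wallisInt_anti (show -1 < (k : ℝ) + 1 by linarith) (show (k : ℝ) + 1 ≤ x + 1 by linarith)
    have b1 := wallisInt_anti (show -1 < x by linarith) h2
    have b2 := wallisInt_anti (show -1 < x + 1 by linarith)
      (show x + 1 ≤ (k : ℝ) + 1 + 1 by linarith)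
    constructor
    · calc (x + 1) * (wallisInt x * wallisInt (x + 1))
          ≤ (k + 2) * (wallisInt k * wallisInt (k + 1)) := by
            refine mul_le_mul (by linarith) (mul_le_mul a1 a2 p2.le q0.le) (by positivity)
              (by linarith)
        _ = _ := by rw [← e1]; field_simp
    · calc (k + 1) / (k + 2) * (Real.pi / 2)
          = (k + 1) * (wallisInt (k + 1) * wallisInt (k + 1 + 1)) := by
            rw [← e2]; field_simp; ring
        _ ≤ _ := by
            refine mul_le_mul (by linarith) (mul_le_mul b1 b2 q2.le p1.le) (by positivity)
              (by linarith)
  set k0 := ⌊m + 1⌋₊ with hk0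
  have f1 : (k0 : ℝ) ≤ m + 1 := Nat.floor_le (by linarith)
  have f2 : m + 1 < k0 + 1 := Nat.lt_floor_add_one _
  have hb : ∀ n : ℕ, g m ≤ (((k0 + n : ℕ) : ℝ) + 2) / (((k0 + n : ℕ) : ℝ) + 1) * (Real.pi / 2) ∧
      (((k0 + n : ℕ) : ℝ) + 1) / (((k0 + n : ℕ) : ℝ) + 2) * (Real.pi / 2) ≤ g m := by
    intro n
    have := hcomp (k0 + n) (m + (n + 1 : ℕ)) (by push_cast; linarith) (by push_cast; linarith)
    rwa [hper (n + 1) m hm] at this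
  have ht : Tendsto (fun n : ℕ => (1 : ℝ) / (((k0 + n : ℕ) : ℝ) + 1)) atTop (𝓝 0) := by
    have := (tendsto_one_div_add_atTop_nhds_zero_nat (𝕜 := ℝ)).comp (tendsto_add_atTop_nat k0)
    refine this.congr fun n => ?_
    simp [add_comm]
  have ht2 : Tendsto (fun n : ℕ => (1 : ℝ) / (((k0 + n : ℕ) : ℝ) + 2)) atTop (𝓝 0) := by
    refine squeeze_zero (fun n => by positivity) (fun n => ?_) ht
    gcongr
    norm_num
  have t1 : Tendsto (fun n : ℕ => (((k0 + n : ℕ) : ℝ) + 2) / (((k0 + n : ℕ) : ℝ) + 1) *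
      (Real.pi / 2)) atTop (𝓝 (Real.pi / 2)) := by
    have := (ht.const_add 1).mul_const (Real.pi / 2)
    rw [add_zero, one_mul] at this
    refine this.congr fun n => ?_
    congr 1
    field_simp
    ring
  have t2 : Tendsto (fun n : ℕ => (((k0 + n : ℕ) : ℝ) + 1) / (((k0 + n : ℕ) : ℝ) + 2) *
      (Real.pi / 2)) atTop (𝓝 (Real.pi / 2)) := by
    have := (ht2.const_sub 1).mul_const (Real.pi / 2)
    rw [sub_zero, one_mul] at this
    refine this.congr fun n => ?_
    congr 1
    field_simp
    ring
  exact le_antisymm (ge_of_tendsto' t1 fun n => (hb n).1) (le_of_tendsto' t2 fun n => (hb n).2)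

/-! ### The power series of `((1 + √(1 + 4t)) / 2)^{-2p}` -/

/-- Termwise differentiation of a power series, with the derived series reindexed. -/
lemma hasDerivAt_tsum_mul_pow_succ {𝕜 : Type*} [RCLike 𝕜] {c : ℕ → 𝕜} {r : ℝ}
    (hc : Summable fun k => ‖c k‖ * r ^ k) {w : 𝕜} (hw : ‖w‖ < r) :
    HasDerivAt (fun w => ∑' k, c k * w ^ k) (∑' k : ℕ, ((k : 𝕜) + 1) * c (k + 1) * w ^ k) w ∧
      Summable fun k : ℕ => ((k : 𝕜) + 1) * c (k + 1) * w ^ k := by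
  obtain ⟨h1, h2⟩ := hasDerivAt_tsum_mul_pow hc hw
  have h3 := (summable_nat_add_iff 1).2 h2
  simp only [Nat.add_sub_cancel, Nat.cast_add, Nat.cast_one] at h3
  refine ⟨h1.congr_deriv ?_, h3⟩
  rw [h2.tsum_eq_zero_add]
  simp

lemma summable_succ_mul_coeff_pow {𝕜 : Type*} [RCLike 𝕜] {c : ℕ → 𝕜} {r ρ : ℝ} (hρ : 0 < ρ)
    (hr : ρ < r) (hc : Summable fun k => ‖c k‖ * r ^ k) :
    Summable fun k : ℕ => ‖((k : 𝕜) + 1) * c (k + 1)‖ * ρ ^ k := by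
  have h := (summable_nat_add_iff 1).2 (summable_nat_mul_coeff_pow hρ hr hc)
  refine h.congr fun k => ?_
  rw [norm_mul, show (k : 𝕜) + 1 = ((k + 1 : ℕ) : 𝕜) by push_cast; rfl, RCLike.norm_natCast,
    Nat.add_sub_cancel]

/-- A two-term recurrence for the coefficients gives a second-order differential equation for the
power series. -/
lemma hypergeometric_ode {c : ℕ → ℝ} {a b A B C R ρ t : ℝ}
    (hc : ∀ k : ℕ, ((k : ℝ) + 1) * (a * k + b) * c (k + 1) = (A * k ^ 2 + B * k + C) * c k)
    (hρ : 0 < ρ) (hR : ρ < R) (sC : Summable fun k => ‖c k‖ * R ^ k) (ht : |t| < ρ) :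
    t * (a - A * t) * (∑' k : ℕ, ((k : ℝ) + 1) *
        ((((k + 1 : ℕ) : ℝ) + 1) * c (k + 1 + 1)) * t ^ k) +
      (b - (A + B) * t) * (∑' k : ℕ, ((k : ℝ) + 1) * c (k + 1) * t ^ k) -
      C * (∑' k : ℕ, c k * t ^ k) = 0 := by
  have sC1 : Summable fun k : ℕ => ‖((k : ℝ) + 1) * c (k + 1)‖ * ρ ^ k :=
    summable_succ_mul_coeff_pow hρ hR sC
  have htR : ‖t‖ < R := lt_trans ht hR
  have s0 := (summable_mul_pow sC htR.le).of_norm.hasSum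
  obtain ⟨-, s1'⟩ := hasDerivAt_tsum_mul_pow_succ sC htR
  obtain ⟨-, s2'⟩ := hasDerivAt_tsum_mul_pow_succ sC1 (w := t) ht
  have s1 := s1'.hasSum
  have s2 := s2'.hasSum
  set H0 := ∑' k : ℕ, c k * t ^ k
  set H1 := ∑' k : ℕ, ((k : ℝ) + 1) * c (k + 1) * t ^ k
  set H2 := ∑' k : ℕ, ((k : ℝ) + 1) * ((((k + 1 : ℕ) : ℝ) + 1) * c (k + 1 + 1)) * t ^ k
  have shift : ∀ {f : ℕ → ℝ} {a : ℝ}, f 0 = 0 → HasSum (fun k => f (k + 1)) a → HasSum f a :=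
    fun {f a} h0 h => by
      have := (hasSum_nat_add_iff 1).1 h
      simpa [h0] using this
  -- `t H''`, `t H'`, `t² H''` as power series in `t`.
  have a1 : HasSum (fun k : ℕ => (k : ℝ) * (k + 1) * c (k + 1) * t ^ k) (t * H2) := by
    refine shift (by simp) ((s2.mul_left t).congr_fun fun k => ?_)
    push_cast
    ring
  have a2 : HasSum (fun k : ℕ => (k : ℝ) * c k * t ^ k) (t * H1) := by
    refine shift (by simp) ((s1.mul_left t).congr_fun fun k => ?_)
    push_cast
    ring
  have a3 : HasSum (fun k : ℕ => ((k : ℝ) - 1) * k * c k * t ^ k) (t * (t * H2)) := by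
    refine shift (by simp) ((a1.mul_left t).congr_fun fun k => ?_)
    push_cast
    ring
  have key := (((a1.mul_left a).add (s1.mul_left b)).sub (a3.mul_left A)).sub
    ((a2.mul_left (A + B)).add (s0.mul_left C))
  have hz : HasSum (fun _ : ℕ => (0 : ℝ)) 0 := hasSum_zero
  have h0 := key.unique (hz.congr_fun fun k => by linear_combination t ^ k * hc k)
  linear_combination h0

/-- Taylor coefficients of `((1 + √(1 + 4t)) / 2)^{-2p}`. -/
noncomputable def catalanCoeff (p : ℝ) (j : ℕ) : ℝ :=
  ∏ i ∈ Finset.range j, (-((2 * p + 2 * i) * (2 * p + 2 * i + 1) / ((i + 1) * (2 * p + i + 1))))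

section Catalan

variable {p : ℝ} (hp : -(1 / 2) < p)

include hp

lemma catalanCoeff_succ_mul (j : ℕ) : (j + 1) * (2 * p + j + 1) * catalanCoeff p (j + 1) =
    -((2 * p + 2 * j) * (2 * p + 2 * j + 1) * catalanCoeff p j) := by
  have hj : (0 : ℝ) ≤ j := j.cast_nonneg
  have h1 : ((j : ℝ) + 1) * (2 * p + j + 1) ≠ 0 := mul_ne_zero (by linarith) (by linarith)
  have h2 := div_mul_cancel₀ ((2 * p + 2 * (j : ℝ)) * (2 * p + 2 * j + 1)) h1
  rw [catalanCoeff, Finset.prod_range_succ, ← catalanCoeff]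
  linear_combination -catalanCoeff p j * h2

lemma abs_catalanCoeff_le (j : ℕ) : |catalanCoeff p j| ≤ (4 * |p| + 4) ^ j := by
  rw [catalanCoeff, Finset.abs_prod, ← Finset.card_range j, ← Finset.prod_const,
    Finset.card_range]
  refine Finset.prod_le_prod (fun i _ => abs_nonneg _) fun i _ => ?_
  have hi : (0 : ℝ) ≤ i := i.cast_nonneg
  have h1 : 0 < 2 * p + i + 1 := by linarith
  have h2 : 0 ≤ 2 * p + 2 * i + 1 := by linarith
  rw [abs_neg, abs_div, abs_mul, abs_of_nonneg h2, abs_of_pos (by positivity : 0 < ((i : ℝ) + 1) * (2 * p + i + 1)),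
    div_le_iff₀ (by positivity)]
  have h3 : |2 * p + 2 * i| ≤ (2 * |p| + 2) * (i + 1) := by
    refine (abs_add_le _ _).trans ?_
    rw [abs_mul, abs_two, abs_of_nonneg (by positivity : (0 : ℝ) ≤ 2 * i)]
    nlinarith [abs_nonneg p, mul_nonneg (abs_nonneg p) hi]
  have h4 : 2 * p + 2 * i + 1 ≤ 2 * (2 * p + i + 1) := by linarith
  calc |2 * p + 2 * i| * (2 * p + 2 * i + 1) ≤ (2 * |p| + 2) * (i + 1) * (2 * (2 * p + i + 1)) :=
        mul_le_mul h3 h4 h2 (by positivity)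
    _ = _ := by ring

lemma catalan_ode {R ρ t : ℝ} (hρ : 0 < ρ) (hR : ρ < R)
    (sC : Summable fun k => ‖catalanCoeff p k‖ * R ^ k) (ht : |t| < ρ) :
    t * (1 + 4 * t) * (∑' k : ℕ, ((k : ℝ) + 1) *
        ((((k + 1 : ℕ) : ℝ) + 1) * catalanCoeff p (k + 1 + 1)) * t ^ k) +
      (2 * p + 1 + (8 * p + 6) * t) * (∑' k : ℕ, ((k : ℝ) + 1) * catalanCoeff p (k + 1) * t ^ k) +
      (4 * p ^ 2 + 2 * p) * (∑' k : ℕ, catalanCoeff p k * t ^ k) = 0 := by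
  have h := hypergeometric_ode (c := catalanCoeff p) (a := 1) (b := 2 * p + 1) (A := -4)
    (B := -(8 * p + 2)) (C := -(4 * p ^ 2 + 2 * p))
    (fun k => by linear_combination catalanCoeff_succ_mul hp k) hρ hR sC ht
  linear_combination h

/-- Inside the disc of convergence `∑ C_j t^j` takes the value `(1 - ε)^{2p}` at
`t = ε / (1 - ε)²`. With `K(ε)` the quotient of both sides, the hypergeometric equation of the
series gives `(ε^{2p+1} K')' = 0`; since `2p + 1 > 0` this forces `K' = 0`. -/
lemma catalan_series : ∃ r : ℝ, 0 < r ∧ ∀ ε ∈ Set.Ioo 0 r, ε < 1 ∧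
    HasSum (fun j => catalanCoeff p j * (ε / (1 - ε) ^ 2) ^ j) ((1 - ε) ^ (2 * p)) := by
  set M : ℝ := 4 * |p| + 4 with hM
  have hM4 : 4 ≤ M := by have := abs_nonneg p; linarith
  set R : ℝ := 1 / (2 * M) with hR
  have hR0 : 0 < R := by positivity
  have hMR : M * R = 1 / 2 := by rw [hR]; field_simp
  have sC : Summable fun k => ‖catalanCoeff p k‖ * R ^ k := by
    refine Summable.of_nonneg_of_le (fun k => by positivity) (fun k => ?_)
      (summable_geometric_of_lt_one (by norm_num : (0 : ℝ) ≤ 1 / 2) (by norm_num))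
    rw [← hMR, mul_pow, Real.norm_eq_abs]
    have := abs_catalanCoeff_le hp k
    gcongr
  have sC1 : Summable fun k : ℕ => ‖((k : ℝ) + 1) * catalanCoeff p (k + 1)‖ * (R / 2) ^ k :=
    summable_succ_mul_coeff_pow (half_pos hR0) (half_lt_self hR0) sC
  have hR8 : R ≤ 1 / 8 := by nlinarith
  set r : ℝ := R / 8 with hr
  have hr0 : 0 < r := by positivity
  have ht : ∀ ε ∈ Set.Ico 0 r, 0 < 1 - ε ∧ |ε / (1 - ε) ^ 2| < R / 2 := by
    intro ε hε
    have h1 : ε < 1 / 64 := by linarith [hε.2]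
    have h2 : 0 < 1 - ε := by linarith
    refine ⟨h2, ?_⟩
    rw [abs_of_nonneg (div_nonneg hε.1 (by positivity)), div_lt_iff₀ (by positivity)]
    nlinarith [hε.2, hε.1]
  set H0 : ℝ → ℝ := fun t => ∑' k : ℕ, catalanCoeff p k * t ^ k with hH0
  set H1 : ℝ → ℝ := fun t => ∑' k : ℕ, ((k : ℝ) + 1) * catalanCoeff p (k + 1) * t ^ k with hH1
  set H2 : ℝ → ℝ := fun t => ∑' k : ℕ, ((k : ℝ) + 1) *
        ((((k + 1 : ℕ) : ℝ) + 1) * catalanCoeff p (k + 1 + 1)) * t ^ k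
  have dH0 : ∀ t, |t| < R / 2 → HasDerivAt H0 (H1 t) t := fun t ht =>
    (hasDerivAt_tsum_mul_pow_succ sC (lt_trans ht (half_lt_self hR0))).1
  have dH1 : ∀ t, |t| < R / 2 → HasDerivAt H1 (H2 t) t := fun t ht =>
    (hasDerivAt_tsum_mul_pow_succ sC1 (w := t) ht).1
  have dt : ∀ ε : ℝ, 0 < 1 - ε → HasDerivAt (fun ε : ℝ => ε / (1 - ε) ^ 2)
      ((1 + ε) / (1 - ε) ^ 3) ε := by
    intro ε h
    have h1 : HasDerivAt (fun ε : ℝ => (1 - ε) ^ 2) (2 * (1 - ε) * (-1)) ε := by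
      have := ((hasDerivAt_id ε).const_sub 1).fun_pow 2
      simpa using this
    refine ((hasDerivAt_id ε).div h1 (pow_ne_zero 2 h.ne')).congr_deriv ?_
    simp only [id]
    field_simp
    ring
  have dpow : ∀ (a ε : ℝ), 0 < 1 - ε → HasDerivAt (fun ε : ℝ => (1 - ε) ^ a)
      (-(a * (1 - ε) ^ (a - 1))) ε := by
    intro a ε h
    refine (((hasDerivAt_id ε).const_sub 1).rpow_const (p := a) (Or.inl h.ne')).congr_deriv ?_
    simp only [id]
    ring
  have d0 : ∀ ε ∈ Set.Ico 0 r, HasDerivAt (fun ε : ℝ => H0 (ε / (1 - ε) ^ 2))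
      (H1 (ε / (1 - ε) ^ 2) * ((1 + ε) / (1 - ε) ^ 3)) ε := fun ε hε =>
    HasDerivAt.comp (h₂ := H0) (h := fun ε : ℝ => ε / (1 - ε) ^ 2) ε (dH0 _ (ht ε hε).2) (dt ε (ht ε hε).1)
  have d1 : ∀ ε ∈ Set.Ico 0 r, HasDerivAt (fun ε : ℝ => H1 (ε / (1 - ε) ^ 2))
      (H2 (ε / (1 - ε) ^ 2) * ((1 + ε) / (1 - ε) ^ 3)) ε := fun ε hε =>
    HasDerivAt.comp (h₂ := H1) (h := fun ε : ℝ => ε / (1 - ε) ^ 2) ε (dH1 _ (ht ε hε).2) (dt ε (ht ε hε).1)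
  set J : ℝ → ℝ := fun ε =>
    2 * p * H0 (ε / (1 - ε) ^ 2) + (1 + ε) / (1 - ε) ^ 2 * H1 (ε / (1 - ε) ^ 2) with hJ
  have dcoef : ∀ ε : ℝ, 0 < 1 - ε → HasDerivAt (fun ε : ℝ => (1 + ε) / (1 - ε) ^ 2)
      ((3 + ε) / (1 - ε) ^ 3) ε := by
    intro ε h
    have h1 : HasDerivAt (fun ε : ℝ => (1 - ε) ^ 2) (2 * (1 - ε) * (-1)) ε := by
      have := ((hasDerivAt_id ε).const_sub 1).fun_pow 2
      simpa using this
    refine (((hasDerivAt_id ε).const_add 1).div h1 (pow_ne_zero 2 h.ne')).congr_deriv ?_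
    simp only [id]
    field_simp
    ring
  have dJ : ∀ ε ∈ Set.Ico 0 r, HasDerivAt J
      (2 * p * (H1 (ε / (1 - ε) ^ 2) * ((1 + ε) / (1 - ε) ^ 3)) +
        ((3 + ε) / (1 - ε) ^ 3 * H1 (ε / (1 - ε) ^ 2) +
          (1 + ε) / (1 - ε) ^ 2 * (H2 (ε / (1 - ε) ^ 2) * ((1 + ε) / (1 - ε) ^ 3)))) ε :=
    fun ε hε => ((d0 ε hε).const_mul (2 * p)).add ((dcoef ε (ht ε hε).1).mul (d1 ε hε))
  have hJ0 : ∀ ε ∈ Set.Ioo 0 r, J ε = 0 := by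
    intro ε hε
    set G : ℝ → ℝ := fun ε => ε ^ (2 * p + 1) * ((1 - ε) ^ (-2 * p - 1) * J ε) with hG
    obtain ⟨c, hc, hslope⟩ := exists_hasDerivAt_eq_slope G (fun _ => 0) hε.1
      (fun x hx => by
        have hx' : x ∈ Set.Ico 0 r := ⟨hx.1, hx.2.trans_lt hε.2⟩
        refine ContinuousAt.continuousWithinAt ?_
        exact (Real.continuousAt_rpow_const x (2 * p + 1) (Or.inr (by linarith))).mul
          ((dpow _ x (ht x hx').1).continuousAt.mul (dJ x hx').continuousAt))
      (fun x hx => by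
        have hx' : x ∈ Set.Ico 0 r := ⟨hx.1.le, hx.2.trans hε.2⟩
        have hx1 := (ht x hx').1
        refine ((Real.hasDerivAt_rpow_const (p := 2 * p + 1) (Or.inl hx.1.ne')).mul
          ((dpow _ x hx1).mul (dJ x hx'))).congr_deriv ?_
        have e1 : x ^ (2 * p + 1) = x ^ (2 * p + 1 - 1) * x := by
          rw [← Real.rpow_add_one hx.1.ne']; ring_nf
        have e2 : (1 - x) ^ (-2 * p - 1) = (1 - x) ^ (-2 * p - 1 - 1) * (1 - x) := by
          rw [← Real.rpow_add_one hx1.ne']; ring_nf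
        have ode := catalan_ode hp (half_pos hR0) (half_lt_self hR0) sC (ht x hx').2
        change x / (1 - x) ^ 2 * (1 + 4 * (x / (1 - x) ^ 2)) * H2 (x / (1 - x) ^ 2) +
          (2 * p + 1 + (8 * p + 6) * (x / (1 - x) ^ 2)) * H1 (x / (1 - x) ^ 2) +
          (4 * p ^ 2 + 2 * p) * H0 (x / (1 - x) ^ 2) = 0 at ode
        simp only [Pi.mul_apply, hJ]
        rw [e1, e2]
        generalize H0 (x / (1 - x) ^ 2) = a0 at ode ⊢
        generalize H1 (x / (1 - x) ^ 2) = a1 at ode ⊢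
        generalize H2 (x / (1 - x) ^ 2) = a2 at ode ⊢
        generalize x ^ (2 * p + 1 - 1) = u
        generalize (1 - x) ^ (-2 * p - 1 - 1) = v
        have hne : 1 - x ≠ 0 := hx1.ne'
        field_simp at ode ⊢
        linear_combination u * v * ode)
    have hG0 : G 0 = 0 := by
      simp only [hG]
      rw [Real.zero_rpow (by linarith), zero_mul]
    rw [hG0, sub_zero, sub_zero, eq_comm, div_eq_zero_iff, or_iff_left hε.1.ne', hG] at hslope
    have hε' := (ht ε ⟨hε.1.le, hε.2⟩).1
    have p1 := Real.rpow_pos_of_pos hε.1 (2 * p + 1)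
    have p2 := Real.rpow_pos_of_pos hε' (-2 * p - 1)
    exact (mul_eq_zero.1 ((mul_eq_zero.1 hslope).resolve_left p1.ne')).resolve_left p2.ne'
  refine ⟨r, hr0, fun ε hε => ?_⟩
  have hε' : ε ∈ Set.Ico 0 r := ⟨hε.1.le, hε.2⟩
  have hε1 := (ht ε hε').1
  refine ⟨by linarith, ?_⟩
  have hsum := (summable_mul_pow sC
    (show ‖ε / (1 - ε) ^ 2‖ ≤ R from ((ht ε hε').2.trans (half_lt_self hR0)).le)).of_norm.hasSum
  set K : ℝ → ℝ := fun ε => (1 - ε) ^ (-2 * p) * H0 (ε / (1 - ε) ^ 2) with hK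
  have dK : ∀ x ∈ Set.Ico 0 r, HasDerivAt K ((1 - x) ^ (-2 * p - 1) * J x) x := by
    intro x hx
    have hx1 := (ht x hx).1
    refine ((dpow (-2 * p) x hx1).mul (d0 x hx)).congr_deriv ?_
    have e2 : (1 - x) ^ (-2 * p) = (1 - x) ^ (-2 * p - 1) * (1 - x) := by
      rw [← Real.rpow_add_one hx1.ne']; ring_nf
    rw [e2, hJ]
    have hne : 1 - x ≠ 0 := hx1.ne'
    field_simp
  obtain ⟨c, hc, hslope⟩ := exists_hasDerivAt_eq_slope K (fun x => (1 - x) ^ (-2 * p - 1) * J x)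
    hε.1 (fun x hx => (dK x ⟨hx.1, hx.2.trans_lt hε.2⟩).continuousAt.continuousWithinAt)
    (fun x hx => dK x ⟨hx.1.le, hx.2.trans hε.2⟩)
  rw [hJ0 c ⟨hc.1, hc.2.trans hε.2⟩, mul_zero, sub_zero, eq_comm, div_eq_zero_iff,
    or_iff_left hε.1.ne', sub_eq_zero] at hslope
  have hK0 : K 0 = 1 := by
    simp only [hK, hH0]
    rw [sub_zero, Real.one_rpow, one_mul, zero_div,
      tsum_eq_single 0 fun k hk => by rw [zero_pow hk, mul_zero]]
    simp [catalanCoeff]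
  rw [hK0] at hslope
  have e3 : (1 - ε) ^ (2 * p) * (1 - ε) ^ (-2 * p) = 1 := by
    rw [← Real.rpow_add hε1]
    simp
  have hv : (1 - ε) ^ (2 * p) = ∑' k : ℕ, catalanCoeff p k * (ε / (1 - ε) ^ 2) ^ k := by
    change _ = H0 (ε / (1 - ε) ^ 2)
    linear_combination -(1 - ε) ^ (2 * p) * hslope + H0 (ε / (1 - ε) ^ 2) * e3
  rw [hv]
  exact hsum

end Catalan

/-! ### The Laplace transform for large argument -/

section LargeParameter

variable {p : ℝ} (hp : -(1 / 2) < p)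

include hp

/-- With `2x = E - 1/E`, that is `E = x + √(1 + x²)`: the expansion of `E^{-2p}` at `x = ∞`. -/
lemma hasSum_catalanCoeff_rpow : ∃ X : ℝ, 1 < X ∧ ∀ E, X ≤ E →
    HasSum (fun j : ℕ => catalanCoeff p j * (E - E⁻¹) ^ (-(2 * p) - 2 * j)) (E ^ (-(2 * p))) := by
  obtain ⟨r, hr, h⟩ := catalan_series hp
  refine ⟨max 2 (1 / r + 1), by simp, fun E hE => ?_⟩
  have hE2 : 2 ≤ E := (le_max_left _ _).trans hE
  have hEr : 1 / r + 1 ≤ E := (le_max_right _ _).trans hE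
  have hE0 : 0 < E := by linarith
  have hεr : (E ^ 2)⁻¹ < r := by
    rw [inv_lt_comm₀ (by positivity) hr, ← one_div]
    nlinarith [one_div_pos.2 hr]
  obtain ⟨hε1, hs⟩ := h _ ⟨by positivity, hεr⟩
  have hx : 0 < E - E⁻¹ := by
    have : E⁻¹ < 1 := inv_lt_one_of_one_lt₀ (by linarith)
    linarith
  have e1 : 1 - (E ^ 2)⁻¹ = (E - E⁻¹) * E⁻¹ := by field_simp
  have e2 : (E ^ 2)⁻¹ / (1 - (E ^ 2)⁻¹) ^ 2 = ((E - E⁻¹) ^ 2)⁻¹ := by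
    rw [e1]
    field_simp
  rw [e2, e1] at hs
  have h2 := hs.mul_left ((E - E⁻¹) ^ (-(2 * p)))
  have e3 : (E - E⁻¹) ^ (-(2 * p)) * ((E - E⁻¹) * E⁻¹) ^ (2 * p) = E ^ (-(2 * p)) := by
    rw [Real.mul_rpow hx.le (by positivity), ← mul_assoc, ← Real.rpow_add hx,
      Real.inv_rpow hE0.le, ← Real.rpow_neg hE0.le]
    simp
  rw [e3] at h2
  refine h2.congr_fun fun j => ?_
  rw [Real.rpow_sub hx, inv_pow, ← pow_mul, show (2 * (j : ℝ)) = ((2 * j : ℕ) : ℝ) by push_cast; rfl,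
    Real.rpow_natCast]
  ring

/-- The coefficients of the Laplace transform of the limiting density are those of the
corresponding integral of `E^{-2p}`. -/
lemma bulkCoeff_mul_Gamma (j : ℕ) :
    bulkConst p * bulkCoeff p j * Real.Gamma (2 * p + 2 * j + 1) =
      catalanCoeff p j * 2 ^ (-(2 * p) - 2 * j) * wallisInt (2 * p + 2 * j + 1) := by
  induction j with
  | zero =>
    have h1 := wallisInt_mul_wallisInt (show -1 < 2 * p by linarith)
    have h2 := wallisInt_pos (show -1 < 2 * p by linarith)
    have h3 : 0 < 2 * p + 1 := by linarith
    have h4 : Real.Gamma (2 * p + 1) ≠ 0 := (Real.Gamma_pos_of_pos h3).ne'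
    simp only [bulkConst, bulkCoeff, catalanCoeff, weightMass_eq hp, Finset.range_zero,
      Finset.prod_empty, Nat.cast_zero, mul_zero, add_zero, sub_zero]
    change 2 * Real.pi / (4 * 2 ^ (2 * p) * wallisInt (2 * p)) / _ * _ * _ = _
    rw [Real.rpow_neg two_pos.le]
    have h5 : (0 : ℝ) < 2 ^ (2 * p) := Real.rpow_pos_of_pos two_pos _
    have h6 : wallisInt (2 * p + 1) = Real.pi / 2 / ((2 * p + 1) * wallisInt (2 * p)) := by
      rw [eq_div_iff (by positivity)]
      linarith
    rw [h6]
    field_simp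
    ring
  | succ j ih =>
    have hj : (0 : ℝ) ≤ j := j.cast_nonneg
    have n1 : 0 < 2 * p + 2 * j + 1 := by linarith
    have n2 : 0 < 2 * p + 2 * j + 2 := by linarith
    have n3 : 0 < 2 * p + 2 * j + 3 := by linarith
    have n4 : 0 < (j : ℝ) + 1 := by linarith
    have n5 : 0 < 2 * p + j + 1 := by linarith
    have g1 := Real.Gamma_add_one n1.ne'
    have g2 := Real.Gamma_add_one (s := 2 * p + 2 * j + 1 + 1) (by linarith)
    rw [g1] at g2
    have w1 := wallisInt_add_two (show -1 < 2 * p + 2 * j + 1 by linarith)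
    have c1 := catalanCoeff_succ_mul hp j
    have b1 := bulkCoeff_succ p j
    rw [b1]
    push_cast
    rw [show 2 * p + 2 * ((j : ℝ) + 1) + 1 = 2 * p + 2 * j + 1 + 1 + 1 by ring, g2,
      show 2 * p + 2 * (j : ℝ) + 1 + 1 + 1 = 2 * p + 2 * j + 1 + 2 by ring,
      show -(2 * p) - 2 * ((j : ℝ) + 1) = -(2 * p) - 2 * j - (2 : ℕ) by push_cast; ring,
      Real.rpow_sub_natCast two_ne_zero]
    have hc : catalanCoeff p (j + 1) =
        -((2 * p + 2 * j) * (2 * p + 2 * j + 1) * catalanCoeff p j) / ((j + 1) * (2 * p + j + 1)) := by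
      rw [eq_div_iff (by positivity)]
      linarith
    have hw : wallisInt (2 * p + 2 * j + 1 + 2) =
        (2 * p + 2 * j + 2) * wallisInt (2 * p + 2 * j + 1) / (2 * p + 2 * j + 3) := by
      rw [eq_div_iff n3.ne']
      linarith
    rw [hc, hw]
    have n6 : 2 * (j + 1) * ((j : ℝ) + 1 + 2 * p) * (2 * (j + 1) + 2 * p + 1) ≠ 0 := by
      refine mul_ne_zero (mul_ne_zero (by positivity) ?_) ?_ <;> linarith
    calc _ = (bulkConst p * bulkCoeff p j * Real.Gamma (2 * p + 2 * j + 1)) *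
          ((2 * p + 2 * j + 2) * (2 * p + 2 * j + 1) *
            -((j + p) / (2 * (j + 1) * (j + 1 + 2 * p) * (2 * (j + 1) + 2 * p + 1)))) := by ring
      _ = (catalanCoeff p j * 2 ^ (-(2 * p) - 2 * j) * wallisInt (2 * p + 2 * j + 1)) *
          ((2 * p + 2 * j + 2) * (2 * p + 2 * j + 1) *
            -((j + p) / (2 * (j + 1) * (j + 1 + 2 * p) * (2 * (j + 1) + 2 * p + 1)))) := by rw [ih]
      _ = _ := by
        rw [show (j : ℝ) + 1 + 2 * p = 2 * p + j + 1 by ring,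
          show 2 * ((j : ℝ) + 1) + 2 * p + 1 = 2 * p + 2 * j + 3 by ring]
        generalize (2 : ℝ) ^ (-(2 * p) - 2 * (j : ℝ)) = u
        field_simp
        ring

lemma summable_wallis_coeff {s : ℝ} (hs : 0 < s) (hs2 : 4 * |p| + 4 < s ^ 2) :
    Summable fun j : ℕ => |catalanCoeff p j * 2 ^ (-(2 * p) - 2 * j) *
      wallisInt (2 * p + 2 * j + 1)| * (1 / s) ^ (2 * p + 2 * j + 1) := by
  have hq : (4 * |p| + 4) / s ^ 2 < 1 := (div_lt_one (by positivity)).2 hs2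
  refine Summable.of_nonneg_of_le (fun j => by positivity) (fun j => ?_)
    ((summable_geometric_of_lt_one (by positivity) hq).mul_left
      (2 ^ (-(2 * p)) * wallisInt (2 * p + 1) * (1 / s) ^ (2 * p + 1)))
  have hj : (0 : ℝ) ≤ j := j.cast_nonneg
  have w1 := wallisInt_pos (show -1 < 2 * p + 2 * j + 1 by linarith)
  have w2 := wallisInt_anti (show -1 < 2 * p + 1 by linarith)
    (show 2 * p + 1 ≤ 2 * p + 2 * j + 1 by linarith)
  have e1 : (2 : ℝ) ^ (-(2 * p) - 2 * j) ≤ 2 ^ (-(2 * p)) :=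
    Real.rpow_le_rpow_of_exponent_le one_le_two (by linarith)
  have e2 : (1 / s) ^ (2 * p + 2 * j + 1) = (1 / s) ^ (2 * p + 1) * (1 / s ^ 2) ^ j := by
    rw [show 2 * p + 2 * (j : ℝ) + 1 = 2 * p + 1 + (2 * j : ℕ) by push_cast; ring,
      Real.rpow_add_natCast (by positivity), pow_mul, one_div_pow]
  have e0 : (0 : ℝ) < 2 ^ (-(2 * p) - 2 * (j : ℝ)) := Real.rpow_pos_of_pos two_pos _
  have e4 : (0 : ℝ) < 2 ^ (-(2 * p)) := Real.rpow_pos_of_pos two_pos _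
  rw [abs_mul, abs_mul, abs_of_pos w1, abs_of_pos e0, e2]
  have e3 := abs_catalanCoeff_le hp j
  have e5 : (0 : ℝ) < (1 / s) ^ (2 * p + 1) := Real.rpow_pos_of_pos (by positivity) _
  calc |catalanCoeff p j| * 2 ^ (-(2 * p) - 2 * (j : ℝ)) * wallisInt (2 * p + 2 * j + 1) *
        ((1 / s) ^ (2 * p + 1) * (1 / s ^ 2) ^ j)
      ≤ (4 * |p| + 4) ^ j * 2 ^ (-(2 * p)) * wallisInt (2 * p + 1) *
        ((1 / s) ^ (2 * p + 1) * (1 / s ^ 2) ^ j) := by gcongr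
    _ = _ := by
      simp only [div_pow, one_pow]
      ring

/-- For large `s` the Laplace transform of the limiting density can be computed termwise. -/
lemma hasSum_laplace_bulkLimit {s : ℝ} (hs : 0 < s) (hs2 : 4 * |p| + 4 < s ^ 2) :
    HasSum (fun j : ℕ => catalanCoeff p j * 2 ^ (-(2 * p) - 2 * j) *
      wallisInt (2 * p + 2 * j + 1) * (1 / s) ^ (2 * p + 2 * j + 1))
      (∫ y in Set.Ioi (0 : ℝ), bulkLimit p y * Real.exp (-(s * y))) := by
  have ha : ∀ j : ℕ, 0 < 2 * p + 2 * j + 1 := fun j => by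
    have hj : (0 : ℝ) ≤ j := j.cast_nonneg
    linarith
  set F : ℕ → ℝ → ℝ := fun j y => bulkConst p * bulkCoeff p j *
    (y ^ (2 * p + 2 * j) * Real.exp (-(s * y))) with hF
  have hFi : ∀ j : ℕ, ∫ y in Set.Ioi (0 : ℝ), y ^ (2 * p + 2 * j) * Real.exp (-(s * y)) =
      (1 / s) ^ (2 * p + 2 * j + 1) * Real.Gamma (2 * p + 2 * j + 1) := fun j => by
    have := Real.integral_rpow_mul_exp_neg_mul_Ioi (ha j) hs
    rwa [add_sub_cancel_right] at this
  have hint : ∀ j : ℕ, IntegrableOn (fun y : ℝ => y ^ (2 * p + 2 * j) * Real.exp (-(s * y)))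
      (Set.Ioi 0) := fun j => by
    have := integrableOn_rpow_mul_exp_neg_mul_rpow (s := 2 * p + 2 * j) (p := 1) (b := s)
      (by linarith [ha j]) one_pos hs
    simpa only [Real.rpow_one, neg_mul] using this
  have hG : ∀ j : ℕ, 0 < Real.Gamma (2 * p + 2 * j + 1) := fun j => Real.Gamma_pos_of_pos (ha j)
  have h := hasSum_integral_of_summable_integral_norm (F := F)
    (μ := volume.restrict (Set.Ioi 0)) (fun j => (hint j).const_mul _) (by
      refine (summable_wallis_coeff hp hs hs2).congr fun j => ?_
      have e1 : ∫ y in Set.Ioi (0 : ℝ), ‖F j y‖ = |bulkConst p * bulkCoeff p j| *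
          ∫ y in Set.Ioi (0 : ℝ), y ^ (2 * p + 2 * j) * Real.exp (-(s * y)) := by
        rw [← integral_const_mul]
        refine setIntegral_congr_fun measurableSet_Ioi fun y hy => ?_
        have hy0 : (0 : ℝ) < y := hy
        simp only [hF, norm_mul, Real.norm_eq_abs, abs_mul]
        rw [abs_of_pos (Real.rpow_pos_of_pos hy0 _), Real.abs_exp]
      rw [e1, hFi, ← bulkCoeff_mul_Gamma hp, abs_mul _ (Real.Gamma _), abs_of_pos (hG j)]
      ring)
  have e2 : ∫ y in Set.Ioi (0 : ℝ), ∑' j, F j y =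
      ∫ y in Set.Ioi (0 : ℝ), bulkLimit p y * Real.exp (-(s * y)) := by
    refine setIntegral_congr_fun measurableSet_Ioi fun y hy => ?_
    have hy0 : (0 : ℝ) < y := hy
    have h1 := (hasSum_bulkFactor hp hy0.ne').mul_left
      (bulkConst p * |y| ^ (2 * p) * Real.exp (-(s * y)))
    rw [bulkLimit_eq hp, show bulkConst p * |y| ^ (2 * p) * bulkFactor p y * Real.exp (-(s * y)) =
      bulkConst p * |y| ^ (2 * p) * Real.exp (-(s * y)) * bulkFactor p y by ring, ← h1.tsum_eq]
    refine tsum_congr fun j => ?_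
    simp only [hF]
    rw [abs_of_pos hy0, show 2 * p + 2 * (j : ℝ) = 2 * p + (2 * j : ℕ) by push_cast; rfl,
      Real.rpow_add_natCast hy0.ne']
    ring
  rw [e2] at h
  refine h.congr_fun fun j => ?_
  simp only [hF]
  rw [integral_const_mul, hFi, ← bulkCoeff_mul_Gamma hp]
  ring

/-- The function `x ↦ x + √(1 + x²)`, that is `exp ∘ arsinh`. -/
noncomputable def expArsinh (x : ℝ) : ℝ := x + √(1 + x ^ 2)

omit hp in
lemma expArsinh_pos (x : ℝ) : 0 < expArsinh x := by
  rw [expArsinh, ← Real.exp_arsinh]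
  exact Real.exp_pos _

omit hp in
lemma expArsinh_sub_inv (x : ℝ) : expArsinh x - (expArsinh x)⁻¹ = 2 * x := by
  have h := Real.sq_sqrt (show 0 ≤ 1 + x ^ 2 by positivity)
  have h2 : expArsinh x * (expArsinh x - 2 * x) = 1 := by
    rw [expArsinh]; linear_combination h
  rw [inv_eq_of_mul_eq_one_right h2]
  ring

/-- For large `s` the Laplace transform of the limiting density is an explicit integral. -/
lemma laplace_bulkLimit_eq_of_large : ∃ X : ℝ, 1 < X ∧ ∀ s, X ≤ s →
    s * ∫ y in Set.Ioi (0 : ℝ), bulkLimit p y * Real.exp (-(s * y)) =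
      ∫ α in Set.Ioo 0 (Real.pi / 2),
        Real.cos α * expArsinh (s / Real.cos α) ^ (-(2 * p)) := by
  obtain ⟨X, hX1, hX⟩ := hasSum_catalanCoeff_rpow hp
  refine ⟨max X (4 * |p| + 5), hX1.trans_le (le_max_left _ _), fun s hs => ?_⟩
  have hsX : X ≤ s := (le_max_left _ _).trans hs
  have hsp : 4 * |p| + 5 ≤ s := (le_max_right _ _).trans hs
  have hs0 : 0 < s := by linarith
  have hs2 : 4 * |p| + 4 < s ^ 2 := by nlinarith
  have hL := (hasSum_laplace_bulkLimit hp hs0 hs2).mul_left s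
  have hcos : ∀ α ∈ Set.Ioo 0 (Real.pi / 2), 0 < Real.cos α := fun α hα =>
    Real.cos_pos_of_mem_Ioo ⟨by linarith [hα.1, Real.pi_pos], hα.2⟩
  set F : ℕ → ℝ → ℝ := fun j α => catalanCoeff p j * (2 * s) ^ (-(2 * p) - 2 * j) *
    Real.cos α ^ (2 * p + 2 * j + 1) with hF
  have ha : ∀ j : ℕ, -1 < 2 * p + 2 * j + 1 := fun j => by
    have hj : (0 : ℝ) ≤ j := j.cast_nonneg
    linarith
  have hW : ∀ j : ℕ, ∫ α in Set.Ioo 0 (Real.pi / 2), Real.cos α ^ (2 * p + 2 * j + 1) =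
      wallisInt (2 * p + 2 * j + 1) := fun j => by
    rw [wallisInt, intervalIntegral.integral_of_le (by positivity), integral_Ioc_eq_integral_Ioo]
  have hint : ∀ j : ℕ, IntegrableOn (fun α => Real.cos α ^ (2 * p + 2 * j + 1))
      (Set.Ioo 0 (Real.pi / 2)) := fun j => by
    have := (intervalIntegrable_iff_integrableOn_Ioc_of_le (by positivity)).1
      (intervalIntegrable_cos_rpow (ha j))
    exact this.mono_set Set.Ioo_subset_Ioc_self
  have hpow : ∀ j : ℕ, (2 * s) ^ (-(2 * p) - 2 * (j : ℝ)) =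
      s * (2 ^ (-(2 * p) - 2 * (j : ℝ)) * (1 / s) ^ (2 * p + 2 * j + 1)) := fun j => by
    rw [Real.mul_rpow two_pos.le hs0.le, one_div, Real.inv_rpow hs0.le, ← Real.rpow_neg hs0.le,
      mul_left_comm]
    congr 1
    rw [show -(2 * p) - 2 * (j : ℝ) = 1 + -(2 * p + 2 * j + 1) by ring, Real.rpow_add hs0,
      Real.rpow_one]
  have h := hasSum_integral_of_summable_integral_norm (F := F)
    (μ := volume.restrict (Set.Ioo 0 (Real.pi / 2))) (fun j => (hint j).const_mul _) (by
      refine ((summable_wallis_coeff hp hs0 hs2).mul_left s).congr fun j => ?_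
      have e1 : ∫ α in Set.Ioo 0 (Real.pi / 2), ‖F j α‖ =
          |catalanCoeff p j * (2 * s) ^ (-(2 * p) - 2 * (j : ℝ))| *
          ∫ α in Set.Ioo 0 (Real.pi / 2), Real.cos α ^ (2 * p + 2 * j + 1) := by
        rw [← integral_const_mul]
        refine setIntegral_congr_fun measurableSet_Ioo fun α hα => ?_
        simp only [hF, norm_mul, Real.norm_eq_abs, abs_mul]
        rw [abs_of_pos (Real.rpow_pos_of_pos (hcos α hα) _)]
      rw [e1, hW, hpow, abs_mul, abs_mul, abs_mul, abs_mul, abs_mul, abs_of_pos hs0,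
        abs_of_pos (wallisInt_pos (ha j)),
        abs_of_pos (Real.rpow_pos_of_pos (one_div_pos.2 hs0) (2 * p + 2 * j + 1))]
      ring)
  have e2 : ∫ α in Set.Ioo 0 (Real.pi / 2), ∑' j, F j α =
      ∫ α in Set.Ioo 0 (Real.pi / 2),
        Real.cos α * expArsinh (s / Real.cos α) ^ (-(2 * p)) := by
    refine setIntegral_congr_fun measurableSet_Ioo fun α hα => ?_
    have hc := hcos α hα
    have hsx : s ≤ s / Real.cos α := by
      rw [le_div_iff₀ hc]
      nlinarith [Real.cos_le_one α]
    have hE : X ≤ expArsinh (s / Real.cos α) := by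
      rw [expArsinh]
      linarith [Real.sqrt_nonneg (1 + (s / Real.cos α) ^ 2)]
    have h1 := (hX _ hE).mul_left (Real.cos α)
    rw [expArsinh_sub_inv] at h1
    rw [← h1.tsum_eq]
    refine tsum_congr fun j => ?_
    simp only [hF]
    rw [show 2 * (s / Real.cos α) = 2 * s * (Real.cos α)⁻¹ by rw [div_eq_mul_inv, mul_assoc],
      Real.mul_rpow (x := 2 * s) (y := (Real.cos α)⁻¹) (by positivity) (by positivity),
      Real.inv_rpow hc.le, ← Real.rpow_neg hc.le,
      show 2 * p + 2 * (j : ℝ) + 1 = -(-(2 * p) - 2 * j) + 1 by ring, Real.rpow_add_one hc.ne']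
    ring
  rw [e2] at h
  refine hL.unique (h.congr_fun fun j => ?_)
  simp only [hF]
  rw [integral_const_mul, hW, hpow]
  ring

end LargeParameter

/-! ### The function `(x + √(1 + x²))^{-2p}` on the closed right half plane -/

/-- The function `x ↦ x + √(1 + x²)` on the closed right half plane, written as
`(√(x + i) + √(x - i))² / 2` so that it is continuous up to the boundary. -/
noncomputable def expArsinhC (x : ℂ) : ℂ :=
  ((x + Complex.I) ^ (2⁻¹ : ℂ) + (x - Complex.I) ^ (2⁻¹ : ℂ)) ^ 2 / 2

lemma cpow_inv_two_sq (z : ℂ) : (z ^ (2⁻¹ : ℂ)) ^ 2 = z := by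
  have h := Complex.cpow_nat_inv_pow z (n := 2) two_ne_zero
  rwa [Nat.cast_ofNat] at h

lemma abs_im_cpow_inv_two_le {z : ℂ} (hz : 0 ≤ z.re) :
    |(z ^ (2⁻¹ : ℂ)).im| ≤ (z ^ (2⁻¹ : ℂ)).re := by
  have h0 : 0 ≤ (z ^ (2⁻¹ : ℂ)).re := by
    rw [Complex.cpow_inv_two_re]
    exact Real.sqrt_nonneg _
  refine abs_le_of_sq_le_sq ?_ h0
  have h := congrArg Complex.re (cpow_inv_two_sq z)
  rw [pow_two, Complex.mul_re] at h
  nlinarith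

lemma norm_cpow_inv_two_sq (z : ℂ) : ‖z ^ (2⁻¹ : ℂ)‖ ^ 2 = ‖z‖ := by
  rw [← norm_pow, cpow_inv_two_sq]

section HalfPlane

variable {x : ℂ}

lemma expArsinhC_eq_add (x : ℂ) : expArsinhC x =
    x + (x + Complex.I) ^ (2⁻¹ : ℂ) * (x - Complex.I) ^ (2⁻¹ : ℂ) := by
  have h1 := cpow_inv_two_sq (x + Complex.I)
  have h2 := cpow_inv_two_sq (x - Complex.I)
  rw [expArsinhC]
  linear_combination (1 / 2 : ℂ) * h1 + (1 / 2 : ℂ) * h2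

/-- The quadratic equation satisfied by `x + √(1 + x²)`. -/
lemma expArsinhC_quadratic (x : ℂ) : expArsinhC x * (expArsinhC x - 2 * x) = 1 := by
  have h1 := cpow_inv_two_sq (x + Complex.I)
  have h2 := cpow_inv_two_sq (x - Complex.I)
  rw [expArsinhC_eq_add]
  linear_combination (x - Complex.I) * h1 + ((x + Complex.I) ^ (2⁻¹ : ℂ)) ^ 2 * h2 -
    Complex.I_sq

lemma expArsinhC_ne_zero (x : ℂ) : expArsinhC x ≠ 0 := fun h => by
  have := expArsinhC_quadratic x
  rw [h, zero_mul] at this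
  exact zero_ne_one this

lemma expArsinhC_re_nonneg (hx : 0 ≤ x.re) : 0 ≤ (expArsinhC x).re := by
  have h1 := abs_im_cpow_inv_two_le (z := x + Complex.I) (by simpa using hx)
  have h2 := abs_im_cpow_inv_two_le (z := x - Complex.I) (by simpa using hx)
  rw [expArsinhC]
  set a := (x + Complex.I) ^ (2⁻¹ : ℂ)
  set b := (x - Complex.I) ^ (2⁻¹ : ℂ)
  have h3 : |(a + b).im| ≤ (a + b).re := by
    rw [Complex.add_im, Complex.add_re]
    exact (abs_add_le _ _).trans (add_le_add h1 h2)
  have h4 : (a + b).im ^ 2 ≤ (a + b).re ^ 2 := by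
    rw [← sq_abs (a + b).im]
    exact pow_le_pow_left₀ (abs_nonneg _) h3 2
  rw [show (a + b) ^ 2 / 2 = ((1 / 2 : ℝ) : ℂ) * ((a + b) * (a + b)) by push_cast; ring,
    Complex.re_ofReal_mul, Complex.mul_re]
  nlinarith

lemma one_le_norm_expArsinhC (hx : 0 ≤ x.re) : 1 ≤ ‖expArsinhC x‖ := by
  have h1 := abs_im_cpow_inv_two_le (z := x + Complex.I) (by simpa using hx)
  have h2 := abs_im_cpow_inv_two_le (z := x - Complex.I) (by simpa using hx)
  have n1 := norm_cpow_inv_two_sq (x + Complex.I)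
  have n2 := norm_cpow_inv_two_sq (x - Complex.I)
  rw [expArsinhC, norm_div, norm_pow]
  set a := (x + Complex.I) ^ (2⁻¹ : ℂ)
  set b := (x - Complex.I) ^ (2⁻¹ : ℂ)
  have h3 : -(a.re * b.re) ≤ a.im * b.im := by
    have h4 : |a.im * b.im| ≤ a.re * b.re := by
      rw [abs_mul]
      exact mul_le_mul h1 h2 (abs_nonneg _) ((abs_nonneg _).trans h1)
    exact (abs_le.1 h4).1
  have h5 : ‖a‖ ^ 2 + ‖b‖ ^ 2 ≤ ‖a + b‖ ^ 2 := by
    simp only [← Complex.normSq_eq_norm_sq, Complex.normSq_apply, Complex.add_re, Complex.add_im]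
    nlinarith
  have h6 : 2 ≤ ‖x + Complex.I‖ + ‖x - Complex.I‖ := by
    have h := norm_sub_le (x + Complex.I) (x - Complex.I)
    rw [show x + Complex.I - (x - Complex.I) = 2 * Complex.I by ring] at h
    simpa using h
  rw [RCLike.norm_ofNat, le_div_iff₀ two_pos]
  linarith

lemma norm_expArsinhC_le (x : ℂ) : ‖expArsinhC x‖ ≤ 2 * ‖x‖ + 1 := by
  rw [expArsinhC_eq_add]
  set a := (x + Complex.I) ^ (2⁻¹ : ℂ) with ha
  set b := (x - Complex.I) ^ (2⁻¹ : ℂ) with hb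
  have h1 : ‖a * b‖ ^ 2 ≤ (‖x‖ + 1) ^ 2 := by
    rw [norm_mul, mul_pow, ha, hb, norm_cpow_inv_two_sq, norm_cpow_inv_two_sq, pow_two]
    have e1 : ‖x + Complex.I‖ ≤ ‖x‖ + 1 := by simpa using norm_add_le x Complex.I
    have e2 : ‖x - Complex.I‖ ≤ ‖x‖ + 1 := by simpa using norm_sub_le x Complex.I
    gcongr
  have h2 : ‖a * b‖ ≤ ‖x‖ + 1 := le_of_sq_le_sq h1 (by positivity)
  linarith [norm_add_le x (a * b)]

/-- In the right half plane the root of the quadratic equation is determined by the sign of its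
real part, the product of the two roots being `-1`. -/
lemma expArsinhC_eq_of_quadratic (hx : 0 ≤ x.re) {u : ℂ} (hu : 0 < u.re)
    (h : u * (u - 2 * x) = 1) : expArsinhC x = u := by
  by_contra hne
  have hw := expArsinhC_quadratic x
  have h1 : (expArsinhC x - u) * (expArsinhC x + u - 2 * x) = 0 := by
    linear_combination hw - h
  have h2 := (mul_eq_zero.1 h1).resolve_left (sub_ne_zero.2 hne)
  have h3 : u * expArsinhC x = -1 := by linear_combination u * h2 - h
  have hu0 : u ≠ 0 := fun h0 => by rw [h0] at hu; simp at hu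
  have h4 : expArsinhC x = -u⁻¹ := by
    field_simp
    linear_combination h3
  have h5 := expArsinhC_re_nonneg hx
  rw [h4, Complex.neg_re, Complex.inv_re] at h5
  have h6 : 0 < u.re / Complex.normSq u := div_pos hu (Complex.normSq_pos.2 hu0)
  linarith

lemma expArsinhC_ofReal {x : ℝ} (hx : 0 ≤ x) : expArsinhC x = expArsinh x := by
  have h0 := expArsinh_pos x
  refine expArsinhC_eq_of_quadratic (by simpa using hx) (by simpa using h0) ?_
  have h1 := expArsinh_sub_inv x
  have h2 : expArsinh x * (expArsinh x - 2 * x) = 1 := by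
    rw [← h1]
    field_simp
    ring
  exact_mod_cast h2

lemma expArsinhC_zero : expArsinhC 0 = 1 :=
  expArsinhC_eq_of_quadratic (by simp) (by simp) (by simp)

lemma expArsinhC_neg_I_mul_sin {θ : ℝ} (h0 : 0 ≤ θ) (h1 : θ < Real.pi / 2) :
    expArsinhC (-(Complex.I * (Real.sin θ : ℝ))) = Complex.exp (-(θ * Complex.I)) := by
  refine expArsinhC_eq_of_quadratic (by simp) ?_ ?_
  · rw [show -((θ : ℂ) * Complex.I) = ((-θ : ℝ) : ℂ) * Complex.I by push_cast; ring,
      Complex.exp_ofReal_mul_I_re, Real.cos_neg]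
    exact Real.cos_pos_of_mem_Ioo ⟨by linarith [Real.pi_pos], h1⟩
  · have e1 : Complex.exp (-(θ * Complex.I)) * Complex.exp (θ * Complex.I) = 1 := by
      rw [← Complex.exp_add]; simp
    have e2 : (Real.sin θ : ℂ) =
        (Complex.exp (-(θ * Complex.I)) - Complex.exp (θ * Complex.I)) * Complex.I / 2 := by
      rw [Complex.ofReal_sin, Complex.sin, neg_mul]
    rw [e2]
    linear_combination e1 - Complex.exp (-(θ * Complex.I)) * (Complex.exp (-(θ * Complex.I)) -
      Complex.exp (θ * Complex.I)) * (-Complex.I_sq)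

lemma expArsinhC_mem_slitPlane (hx : 0 ≤ x.re) : expArsinhC x ∈ Complex.slitPlane := by
  rw [Complex.mem_slitPlane_iff]
  by_contra! h
  exact expArsinhC_ne_zero x (Complex.ext (le_antisymm h.1 (expArsinhC_re_nonneg hx)) h.2)

lemma continuousAt_expArsinhC (hx : 0 ≤ x.re) : ContinuousAt expArsinhC x := by
  have h1 : ContinuousAt (fun x : ℂ => (x + Complex.I) ^ (2⁻¹ : ℂ)) x :=
    ContinuousAt.comp (g := fun z : ℂ => z ^ (2⁻¹ : ℂ)) (f := fun x : ℂ => x + Complex.I)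
      (Complex.continuousAt_cpow_const_of_re_pos (Or.inl (by simpa using hx)) (by norm_num))
      (by fun_prop)
  have h2 : ContinuousAt (fun x : ℂ => (x - Complex.I) ^ (2⁻¹ : ℂ)) x :=
    ContinuousAt.comp (g := fun z : ℂ => z ^ (2⁻¹ : ℂ)) (f := fun x : ℂ => x - Complex.I)
      (Complex.continuousAt_cpow_const_of_re_pos (Or.inl (by simpa using hx)) (by norm_num))
      (by fun_prop)
  exact ((h1.add h2).pow 2).div_const 2

lemma differentiableAt_expArsinhC (h1 : x + Complex.I ∈ Complex.slitPlane)
    (h2 : x - Complex.I ∈ Complex.slitPlane) : DifferentiableAt ℂ expArsinhC x := by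
  have d1 : DifferentiableAt ℂ (fun x : ℂ => (x + Complex.I) ^ (2⁻¹ : ℂ)) x :=
    (differentiableAt_id.add_const _).cpow_const h1
  have d2 : DifferentiableAt ℂ (fun x : ℂ => (x - Complex.I) ^ (2⁻¹ : ℂ)) x :=
    (differentiableAt_id.sub_const _).cpow_const h2
  exact ((d1.add d2).pow 2).div_const 2

lemma differentiableAt_expArsinhC_of_re_pos (hx : 0 < x.re) :
    DifferentiableAt ℂ expArsinhC x :=
  differentiableAt_expArsinhC (Or.inl (by simpa using hx)) (Or.inl (by simpa using hx))

/-- The function `x ↦ (x + √(1 + x²))^{-2p}` on the closed right half plane. -/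
noncomputable def arsinhPow (p : ℝ) (x : ℂ) : ℂ := expArsinhC x ^ ((-(2 * p) : ℝ) : ℂ)

variable (p : ℝ)

lemma continuousAt_arsinhPow (hx : 0 ≤ x.re) : ContinuousAt (arsinhPow p) x :=
  ContinuousAt.comp (g := fun z : ℂ => z ^ ((-(2 * p) : ℝ) : ℂ))
    (continuousAt_cpow_const (expArsinhC_mem_slitPlane hx)) (continuousAt_expArsinhC hx)

lemma differentiableAt_arsinhPow (hx : 0 < x.re) : DifferentiableAt ℂ (arsinhPow p) x :=
  (differentiableAt_expArsinhC_of_re_pos hx).cpow_const (expArsinhC_mem_slitPlane hx.le)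

lemma norm_arsinhPow_le (hx : 0 ≤ x.re) :
    ‖arsinhPow p x‖ ≤ (2 * ‖x‖ + 1) ^ max (-(2 * p)) 0 := by
  have h1 := one_le_norm_expArsinhC hx
  rw [arsinhPow, Complex.norm_cpow_real]
  exact (Real.rpow_le_rpow_of_exponent_le h1 (le_max_left _ _)).trans
    (Real.rpow_le_rpow (by linarith) (norm_expArsinhC_le x) (le_max_right _ _))

lemma arsinhPow_ofReal {x : ℝ} (hx : 0 ≤ x) :
    arsinhPow p x = ((expArsinh x ^ (-(2 * p)) : ℝ) : ℂ) := by
  rw [arsinhPow, expArsinhC_ofReal hx, Complex.ofReal_cpow (expArsinh_pos x).le]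

lemma arsinhPow_zero : arsinhPow p 0 = 1 := by
  rw [arsinhPow, expArsinhC_zero, Complex.one_cpow]

lemma arsinhPow_neg_I_mul_sin {θ : ℝ} (h0 : 0 ≤ θ) (h1 : θ < Real.pi / 2) :
    arsinhPow p (-(Complex.I * (Real.sin θ : ℝ))) = Complex.exp ((2 * p * θ : ℝ) * Complex.I) := by
  rw [arsinhPow, expArsinhC_neg_I_mul_sin h0 h1, Complex.cpow_def_of_ne_zero (Complex.exp_ne_zero _),
    Complex.log_exp]
  · congr 1
    push_cast
    ring
  · simp
    linarith [Real.pi_pos]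
  · simp
    linarith [Real.pi_pos]

lemma hasDerivAt_arsinhPow_zero : HasDerivAt (arsinhPow p) (-(2 * p) : ℝ) 0 := by
  have hd : DifferentiableAt ℂ expArsinhC 0 :=
    differentiableAt_expArsinhC (Or.inr (by simp)) (Or.inr (by simp))
  have h := hd.hasDerivAt
  have hq : HasDerivAt (fun x => expArsinhC x * (expArsinhC x - 2 * x)) 0 0 := by
    rw [show (fun x => expArsinhC x * (expArsinhC x - 2 * x)) = fun _ => 1 from
      funext expArsinhC_quadratic]
    exact hasDerivAt_const _ _
  have h2 := hq.unique (h.mul (h.sub ((hasDerivAt_id (0 : ℂ)).const_mul 2)))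
  simp only [expArsinhC_zero, mul_zero, sub_zero, mul_one, one_mul] at h2
  have h3 : deriv expArsinhC 0 = 1 := by linear_combination -(1 / 2 : ℂ) * h2
  rw [h3] at h
  have h4 := h.cpow_const (c := ((-(2 * p) : ℝ) : ℂ)) (expArsinhC_mem_slitPlane (x := 0) (by simp))
  rw [expArsinhC_zero, Complex.one_cpow, mul_one, mul_one] at h4
  exact h4

end HalfPlane

/-! ### Integrability of the truncated density -/

section Integrability

variable {p : ℝ} (hp : -(1 / 2) < p)

include hp

lemma continuousOn_bulkLimit : ContinuousOn (bulkLimit p) (Set.Ioi 0) := by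
  intro y hy
  have hy0 : y ≠ 0 := (show (0 : ℝ) < y from hy).ne'
  obtain ⟨h1, -, h3⟩ := hasDerivAt_kummer_system hp y hy0
  have h4 : ContinuousAt (bulkFactor p) y :=
    h1.continuousAt.sub ((continuousAt_const.div continuousAt_id hy0).mul h3.continuousAt)
  have h5 : ContinuousAt (fun y : ℝ => |y| ^ (2 * p)) y :=
    continuous_abs.continuousAt.rpow_const (Or.inl (abs_ne_zero.2 hy0))
  refine ContinuousAt.continuousWithinAt ?_
  rw [show bulkLimit p = fun y => bulkConst p * |y| ^ (2 * p) * bulkFactor p y from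
    funext (bulkLimit_eq hp)]
  exact (continuousAt_const.mul h5).mul h4

lemma exists_abs_bulkLimit_le (Y : ℝ) (hY : 0 < Y) :
    ∃ K, ∀ y ∈ Set.Ioc 0 Y, |bulkLimit p y| ≤ K * y ^ (2 * p) := by
  have hs := (hasSum_bulkFactor hp hY.ne').summable.abs
  refine ⟨|bulkConst p| * ∑' j, |bulkCoeff p j * Y ^ (2 * j)|, fun y hy => ?_⟩
  have h1 := hasSum_bulkFactor hp hy.1.ne'
  have h2 : |bulkFactor p y| ≤ ∑' j, |bulkCoeff p j * Y ^ (2 * j)| := by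
    rw [← h1.tsum_eq, ← Real.norm_eq_abs]
    refine tsum_of_norm_bounded hs.hasSum fun j => ?_
    rw [Real.norm_eq_abs, abs_mul, abs_mul, abs_pow, abs_pow, abs_of_pos hy.1, abs_of_pos hY]
    have := hy.1.le
    have := hy.2
    gcongr
  have h3 := Real.rpow_nonneg hy.1.le (2 * p)
  rw [bulkLimit_eq hp, abs_of_pos hy.1, abs_mul, abs_mul, abs_of_nonneg h3]
  calc |bulkConst p| * y ^ (2 * p) * |bulkFactor p y|
      ≤ |bulkConst p| * y ^ (2 * p) * ∑' j, |bulkCoeff p j * Y ^ (2 * j)| := by gcongr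
    _ = _ := by ring

lemma exists_integrableOn_bulkLimit_sub :
    ∃ L, IntegrableOn (fun y => bulkLimit p y - L) (Set.Ioi 0) := by
  obtain ⟨L, C, Y, hY, h⟩ := bulkLimit_asymptotics hp
  obtain ⟨K, hK⟩ := exists_abs_bulkLimit_le hp Y hY
  refine ⟨L, ?_⟩
  have hmeas : AEStronglyMeasurable (fun y => bulkLimit p y - L) (volume.restrict (Set.Ioi 0)) :=
    ((continuousOn_bulkLimit hp).sub continuousOn_const).aestronglyMeasurable measurableSet_Ioi
  rw [← Set.Ioc_union_Ioi_eq_Ioi hY.le]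
  refine IntegrableOn.union ?_ ?_
  · have h1 : IntegrableOn (fun y : ℝ => K * y ^ (2 * p) + |L|) (Set.Ioc 0 Y) := by
      have h2 := (intervalIntegrable_iff_integrableOn_Ioc_of_le hY.le).1
        (intervalIntegral.intervalIntegrable_rpow' (a := 0) (b := Y) (show -1 < 2 * p by linarith))
      exact (h2.const_mul K).add (integrableOn_const (by simp) (by simp))
    refine h1.mono' (hmeas.mono_measure (Measure.restrict_mono Set.Ioc_subset_Ioi_self le_rfl)) ?_
    filter_upwards [ae_restrict_mem measurableSet_Ioc] with y hy
    rw [Real.norm_eq_abs]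
    exact (abs_sub _ _).trans (add_le_add (hK y hy) le_rfl)
  · have h1 : IntegrableOn (fun y : ℝ => C * y ^ (-2 : ℝ)) (Set.Ioi Y) :=
      (integrableOn_Ioi_rpow_of_lt (by norm_num) hY).const_mul C
    refine h1.mono' (hmeas.mono_measure (Measure.restrict_mono (Set.Ioi_subset_Ioi hY.le) le_rfl)) ?_
    filter_upwards [ae_restrict_mem measurableSet_Ioi] with y hy
    have hy0 : 0 < y := hY.trans hy
    rw [Real.norm_eq_abs, Real.rpow_neg hy0.le, Real.rpow_two, ← div_eq_mul_inv]
    exact h y (Set.mem_Ici.2 (le_of_lt hy))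

end Integrability

/-! ### The Laplace transform -/

/-- An integral of holomorphic functions that is locally uniformly dominated is holomorphic. -/
lemma differentiableOn_integral_of_dominated {α : Type*} [MeasurableSpace α] {μ : Measure α}
    {F : ℂ → α → ℂ} {U : Set ℂ} (hU : IsOpen U) (hm : ∀ s ∈ U, AEStronglyMeasurable (F s) μ)
    (hd : ∀ᵐ a ∂μ, DifferentiableOn ℂ (fun s => F s a) U)
    (hb : ∀ s₀ ∈ U, ∃ r > 0, ∃ bound : α → ℝ, Integrable bound μ ∧
      ∀ᵐ a ∂μ, ∀ s ∈ Metric.ball s₀ r ∩ U, ‖F s a‖ ≤ bound a) :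
    DifferentiableOn ℂ (fun s => ∫ a, F s a ∂μ) U := by
  intro s₀ hs₀
  obtain ⟨r₁, hr₁, bound, hbi, hbb⟩ := hb s₀ hs₀
  obtain ⟨r₂, hr₂, hball⟩ := Metric.isOpen_iff.1 hU s₀ hs₀
  set r := min r₁ r₂ with hr
  have hr0 : 0 < r := lt_min hr₁ hr₂
  have hsub : Metric.ball s₀ r ⊆ U := (Metric.ball_subset_ball (min_le_right _ _)).trans hball
  have hsub1 : Metric.ball s₀ r ⊆ Metric.ball s₀ r₁ := Metric.ball_subset_ball (min_le_left _ _)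
  have hF_int : Integrable (F s₀) μ := hbi.mono' (hm s₀ hs₀) (by
    filter_upwards [hbb] with a ha using ha s₀ ⟨Metric.mem_ball_self hr₁, hs₀⟩)
  have hderiv : ∀ᵐ a ∂μ, ∀ s ∈ Metric.ball s₀ (r / 2),
      HasDerivAt (fun s => F s a) (deriv (fun s => F s a) s) s := by
    filter_upwards [hd] with a ha s hs
    exact (ha.differentiableAt (hU.mem_nhds
      (hsub (Metric.ball_subset_ball (by linarith) hs)))).hasDerivAt
  have hmd : AEStronglyMeasurable (fun a => deriv (fun s => F s a) s₀) μ := by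
    have ht : Tendsto (fun n : ℕ => ((r / (n + 2) : ℝ) : ℂ)) atTop (𝓝[≠] 0) := by
      refine tendsto_nhdsWithin_iff.2 ⟨?_, Eventually.of_forall fun n => ?_⟩
      · rw [← Complex.ofReal_zero]
        refine (Complex.continuous_ofReal.tendsto 0).comp ?_
        refine Tendsto.div_atTop tendsto_const_nhds ?_
        exact tendsto_atTop_add_const_right _ _ tendsto_natCast_atTop_atTop
      · have : r / ((n : ℝ) + 2) ≠ 0 := by positivity
        exact Complex.ofReal_ne_zero.2 this
    refine aestronglyMeasurable_of_tendsto_ae atTop (f := fun (n : ℕ) a =>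
      ((r / (n + 2) : ℝ) : ℂ)⁻¹ • (F (s₀ + ((r / (n + 2) : ℝ) : ℂ)) a - F s₀ a)) (fun n => ?_) ?_
    · change AEStronglyMeasurable (((r / (n + 2) : ℝ) : ℂ)⁻¹ •
        (F (s₀ + ((r / (n + 2) : ℝ) : ℂ)) - F s₀)) μ
      refine ((hm _ (hsub ?_)).sub (hm s₀ hs₀)).const_smul _
      rw [Metric.mem_ball, dist_eq_norm, add_sub_cancel_left, Complex.norm_real, Real.norm_eq_abs,
        abs_of_pos (by positivity), div_lt_iff₀ (by positivity)]
      have : (0 : ℝ) ≤ n := n.cast_nonneg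
      nlinarith
    · filter_upwards [hderiv] with a ha
      have h := (ha s₀ (Metric.mem_ball_self (half_pos hr0))).tendsto_slope_zero
      exact h.comp ht
  refine ((hasDerivAt_integral_of_dominated_loc_of_deriv_le (μ := μ) (F := F)
    (F' := fun s a => deriv (fun s => F s a) s) (bound := fun a => bound a / (r / 4))
    (Metric.ball_mem_nhds s₀ (half_pos hr0)) ?_ hF_int hmd ?_ (hbi.div_const _)
    hderiv).2).differentiableAt.differentiableWithinAt
  · filter_upwards [hU.mem_nhds hs₀] with s hs using hm s hs
  · filter_upwards [hd, hbb] with a ha hba s hs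
    have hcb : Metric.closedBall s (r / 4) ⊆ Metric.ball s₀ r := by
      intro z hz
      have h1 := Metric.mem_closedBall.1 hz
      have h2 := Metric.mem_ball.1 hs
      rw [Metric.mem_ball]
      linarith [dist_triangle z s s₀]
    refine Complex.norm_deriv_le_of_forall_mem_sphere_norm_le (by positivity)
      (DifferentiableOn.diffContOnCl_ball (ha.mono (hsub)) hcb) fun z hz => ?_
    have hz' := hcb (Metric.sphere_subset_closedBall hz)
    exact hba z ⟨hsub1 hz', hsub hz'⟩

section Laplace

variable {p : ℝ} (hp : -(1 / 2) < p)

lemma cos_pos_of_mem {α : ℝ} (hα : α ∈ Set.Ioo 0 (Real.pi / 2)) : 0 < Real.cos α :=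
  Real.cos_pos_of_mem_Ioo ⟨by linarith [hα.1, Real.pi_pos], hα.2⟩

lemma div_cos_re {s : ℂ} {α : ℝ} : (s / Real.cos α).re = s.re / Real.cos α :=
  Complex.div_ofReal_re s (Real.cos α)

lemma continuousOn_arsinhPow_div_cos (p : ℝ) {s : ℂ} (hs : 0 ≤ s.re) :
    ContinuousOn (fun α : ℝ => arsinhPow p (s / Real.cos α)) (Set.Ioo 0 (Real.pi / 2)) := by
  intro α hα
  have hc := cos_pos_of_mem hα
  have hc' : (Real.cos α : ℂ) ≠ 0 := by exact_mod_cast hc.ne'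
  refine ContinuousAt.continuousWithinAt ?_
  refine ContinuousAt.comp (g := arsinhPow p) (f := fun α : ℝ => s / Real.cos α)
    (continuousAt_arsinhPow p ?_) ?_
  · rw [div_cos_re]
    positivity
  · exact continuousAt_const.div (Complex.continuous_ofReal.comp Real.continuous_cos).continuousAt hc'

include hp in
lemma norm_arsinhPow_le_linear {x : ℂ} (hx : 0 ≤ x.re) : ‖arsinhPow p x‖ ≤ 2 * ‖x‖ + 1 := by
  refine (norm_arsinhPow_le p hx).trans ?_
  have h1 : 1 ≤ 2 * ‖x‖ + 1 := by linarith [norm_nonneg x]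
  calc (2 * ‖x‖ + 1) ^ max (-(2 * p)) 0 ≤ (2 * ‖x‖ + 1) ^ (1 : ℝ) :=
        Real.rpow_le_rpow_of_exponent_le h1 (max_le (by linarith) zero_le_one)
    _ = _ := Real.rpow_one _

include hp in
lemma norm_cos_mul_arsinhPow_le {s : ℂ} (hs : 0 ≤ s.re) {α : ℝ}
    (hα : α ∈ Set.Ioo 0 (Real.pi / 2)) :
    ‖(Real.cos α : ℂ) * arsinhPow p (s / Real.cos α)‖ ≤ 2 * ‖s‖ + 1 := by
  have hc := cos_pos_of_mem hα
  have h1 := norm_arsinhPow_le_linear hp (x := s / Real.cos α) (by rw [div_cos_re]; positivity)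
  rw [norm_mul, Complex.norm_real, Real.norm_eq_abs, abs_of_pos hc]
  rw [norm_div, Complex.norm_real, Real.norm_eq_abs, abs_of_pos hc] at h1
  calc Real.cos α * ‖arsinhPow p (s / Real.cos α)‖
      ≤ Real.cos α * (2 * (‖s‖ / Real.cos α) + 1) := by gcongr
    _ = 2 * ‖s‖ + Real.cos α := by field_simp
    _ ≤ 2 * ‖s‖ + 1 := by linarith [Real.cos_le_one α]

/-- The integral that represents the Laplace transform of the limiting density. -/
noncomputable def arsinhInt (p : ℝ) (s : ℂ) : ℂ :=
  ∫ α in Set.Ioo 0 (Real.pi / 2), (Real.cos α : ℂ) * arsinhPow p (s / Real.cos α)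

lemma aestronglyMeasurable_cos_mul_arsinhPow (p : ℝ) {s : ℂ} (hs : 0 ≤ s.re) :
    AEStronglyMeasurable (fun α : ℝ => (Real.cos α : ℂ) * arsinhPow p (s / Real.cos α))
      (volume.restrict (Set.Ioo 0 (Real.pi / 2))) :=
  ((Complex.continuous_ofReal.comp Real.continuous_cos).continuousOn.mul
    (continuousOn_arsinhPow_div_cos p hs)).aestronglyMeasurable measurableSet_Ioo

include hp in
lemma integrableOn_cos_mul_arsinhPow {s : ℂ} (hs : 0 ≤ s.re) :
    IntegrableOn (fun α : ℝ => (Real.cos α : ℂ) * arsinhPow p (s / Real.cos α))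
      (Set.Ioo 0 (Real.pi / 2)) := by
  refine Integrable.mono' (g := fun _ => 2 * ‖s‖ + 1) (integrableOn_const (by simp) (by simp))
    (aestronglyMeasurable_cos_mul_arsinhPow p hs) ?_
  filter_upwards [ae_restrict_mem measurableSet_Ioo] with α hα
    using norm_cos_mul_arsinhPow_le hp hs hα

include hp in
lemma differentiableOn_arsinhInt : DifferentiableOn ℂ (arsinhInt p) {s | 0 < s.re} := by
  refine differentiableOn_integral_of_dominated (isOpen_lt continuous_const Complex.continuous_re)
    (fun s hs => aestronglyMeasurable_cos_mul_arsinhPow p (le_of_lt hs)) ?_ fun s₀ hs₀ => ?_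
  · filter_upwards [ae_restrict_mem measurableSet_Ioo] with α hα s hs
    have hc := cos_pos_of_mem hα
    have h1 : DifferentiableAt ℂ (fun s : ℂ => arsinhPow p (s / Real.cos α)) s :=
      DifferentiableAt.comp (g := arsinhPow p) (f := fun s : ℂ => s / Real.cos α) s
        (differentiableAt_arsinhPow p (by rw [div_cos_re]; exact div_pos hs hc))
        (differentiableAt_id.div_const _)
    exact (h1.const_mul _).differentiableWithinAt
  · refine ⟨1, one_pos, fun _ => 2 * (‖s₀‖ + 1) + 1, integrableOn_const (by simp) (by simp), ?_⟩
    filter_upwards [ae_restrict_mem measurableSet_Ioo] with α hα s hs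
    refine (norm_cos_mul_arsinhPow_le hp (le_of_lt hs.2) hα).trans ?_
    have h1 : ‖s - s₀‖ < 1 := by simpa [dist_eq_norm] using hs.1
    have h2 := norm_add_le (s - s₀) s₀
    rw [sub_add_cancel] at h2
    linarith

lemma norm_exp_neg_mul_le {s : ℂ} (hs : 0 ≤ s.re) {y : ℝ} (hy : 0 ≤ y) :
    ‖Complex.exp (-(s * y))‖ ≤ 1 := by
  rw [Complex.norm_exp, Real.exp_le_one_iff, Complex.neg_re, Complex.re_mul_ofReal]
  have := mul_nonneg hs hy
  linarith

/-- The Laplace transform of an integrable function is holomorphic in the right half plane. -/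
lemma differentiableOn_laplace {f : ℝ → ℝ} (hf : IntegrableOn f (Set.Ioi 0)) :
    DifferentiableOn ℂ (fun s : ℂ => ∫ y in Set.Ioi (0 : ℝ), (f y : ℂ) * Complex.exp (-(s * y)))
      {s | 0 < s.re} := by
  have hm : AEStronglyMeasurable (fun y => (f y : ℂ)) (volume.restrict (Set.Ioi 0)) :=
    Complex.continuous_ofReal.comp_aestronglyMeasurable hf.aestronglyMeasurable
  refine differentiableOn_integral_of_dominated (isOpen_lt continuous_const Complex.continuous_re)
    (fun s hs => hm.mul (Continuous.aestronglyMeasurable (by fun_prop))) ?_ fun s₀ hs₀ => ?_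
  · refine Eventually.of_forall fun y => ?_
    fun_prop
  · refine ⟨1, one_pos, fun y => ‖f y‖, hf.norm, ?_⟩
    filter_upwards [ae_restrict_mem measurableSet_Ioi] with y hy s hs
    rw [norm_mul, Complex.norm_real]
    exact mul_le_of_le_one_right (norm_nonneg _)
      (norm_exp_neg_mul_le (le_of_lt hs.2) (le_of_lt hy))

/-- The Laplace transform of the limiting density in the whole right half plane, by analytic
continuation from large real arguments. -/
lemma laplace_bulkLimit_sub_eq (hp : -(1 / 2) < p) {L : ℝ}
    (hL : IntegrableOn (fun y => bulkLimit p y - L) (Set.Ioi 0)) {s : ℂ} (hs : 0 < s.re) :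
    s * (∫ y in Set.Ioi (0 : ℝ), ((bulkLimit p y - L : ℝ) : ℂ) * Complex.exp (-(s * y))) + L =
      arsinhInt p s := by
  obtain ⟨X, hX1, hX⟩ := laplace_bulkLimit_eq_of_large hp
  have hopen : IsOpen {s : ℂ | 0 < s.re} := isOpen_lt continuous_const Complex.continuous_re
  have hf : AnalyticOnNhd ℂ (fun s : ℂ => s * (∫ y in Set.Ioi (0 : ℝ),
      ((bulkLimit p y - L : ℝ) : ℂ) * Complex.exp (-(s * y))) + L) {s | 0 < s.re} :=
    ((differentiableOn_id.mul (differentiableOn_laplace hL)).add_const _).analyticOnNhd hopen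
  have hg : AnalyticOnNhd ℂ (arsinhInt p) {s | 0 < s.re} :=
    (differentiableOn_arsinhInt hp).analyticOnNhd hopen
  have hreal : ∀ t : ℝ, X ≤ t → (t : ℂ) * (∫ y in Set.Ioi (0 : ℝ),
      ((bulkLimit p y - L : ℝ) : ℂ) * Complex.exp (-((t : ℂ) * y))) + L = arsinhInt p t := by
    intro t ht
    have ht0 : 0 < t := by linarith
    have h1 := hX t ht
    have e1 : ∫ y in Set.Ioi (0 : ℝ), ((bulkLimit p y - L : ℝ) : ℂ) * Complex.exp (-((t : ℂ) * y)) =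
        ((∫ y in Set.Ioi (0 : ℝ), (bulkLimit p y - L) * Real.exp (-(t * y)) : ℝ) : ℂ) := by
      rw [← integral_complex_ofReal]
      refine integral_congr_ae (Eventually.of_forall fun y => ?_)
      push_cast
      rfl
    have e2 : arsinhInt p t = ((∫ α in Set.Ioo 0 (Real.pi / 2),
        Real.cos α * expArsinh (t / Real.cos α) ^ (-(2 * p)) : ℝ) : ℂ) := by
      rw [← integral_complex_ofReal, arsinhInt]
      refine setIntegral_congr_fun measurableSet_Ioo fun α hα => ?_
      have hc := cos_pos_of_mem hα
      rw [← Complex.ofReal_div, arsinhPow_ofReal p (by positivity), ← Complex.ofReal_mul]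
    have i1 : IntegrableOn (fun y => (bulkLimit p y - L) * Real.exp (-(t * y))) (Set.Ioi 0) := by
      refine hL.norm.mono' (hL.aestronglyMeasurable.mul
        (Continuous.aestronglyMeasurable (by fun_prop))) ?_
      filter_upwards [ae_restrict_mem measurableSet_Ioi] with y hy
      have hy0 : (0 : ℝ) < y := hy
      rw [norm_mul, Real.norm_eq_abs (Real.exp _), Real.abs_exp]
      refine mul_le_of_le_one_right (norm_nonneg _) (Real.exp_le_one_iff.2 ?_)
      have := mul_pos ht0 hy0
      linarith
    have i2 : IntegrableOn (fun y : ℝ => L * Real.exp (-(t * y))) (Set.Ioi 0) := by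
      have := (integrableOn_exp_mul_Ioi (neg_lt_zero.2 ht0) 0).const_mul L
      simp only [neg_mul] at this
      exact this
    have e3 : ∫ y in Set.Ioi (0 : ℝ), L * Real.exp (-(t * y)) = L / t := by
      rw [integral_const_mul]
      have := integral_exp_mul_Ioi (neg_lt_zero.2 ht0) 0
      simp only [neg_mul, mul_zero, Real.exp_zero] at this
      rw [this, neg_div_neg_eq, mul_one_div]
    have e4 : ∫ y in Set.Ioi (0 : ℝ), bulkLimit p y * Real.exp (-(t * y)) =
        (∫ y in Set.Ioi (0 : ℝ), (bulkLimit p y - L) * Real.exp (-(t * y))) + L / t := by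
      rw [← e3, ← integral_add i1 i2]
      refine integral_congr_ae (Eventually.of_forall fun y => ?_)
      simp only
      ring
    rw [e4] at h1
    rw [e1, e2, ← h1]
    push_cast
    have : (t : ℂ) ≠ 0 := by exact_mod_cast ht0.ne'
    field_simp
  refine hf.eqOn_of_preconnected_of_frequently_eq hg
    (convex_halfSpace_re_gt 0).isPreconnected (z₀ := (X : ℂ))
    (show 0 < ((X : ℝ) : ℂ).re by simpa using (by linarith : 0 < X)) ?_ hs
  have ht : Tendsto (fun n : ℕ => ((X + 1 / ((n : ℝ) + 1) : ℝ) : ℂ)) atTop (𝓝[≠] (X : ℂ)) := by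
    refine tendsto_nhdsWithin_iff.2 ⟨?_, Eventually.of_forall fun n => ?_⟩
    · refine (Complex.continuous_ofReal.tendsto X).comp ?_
      simpa using (tendsto_one_div_add_atTop_nhds_zero_nat (𝕜 := ℝ)).const_add X
    · have : 0 < 1 / ((n : ℝ) + 1) := by positivity
      intro h
      have h2 := Complex.ofReal_injective (Set.mem_singleton_iff.1 h)
      linarith
  refine ht.frequently (Frequently.of_forall fun n => hreal _ ?_)
  have : 0 < 1 / ((n : ℝ) + 1) := by positivity
  linarith

lemma integral_cos_Ioo : ∫ α in Set.Ioo 0 (Real.pi / 2), Real.cos α = 1 := by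
  rw [← integral_Ioc_eq_integral_Ioo, ← intervalIntegral.integral_of_le (by positivity)]
  simp

/-- The limiting density tends to one at infinity: the mean density is recovered from the
behaviour of the Laplace transform at the origin. -/
lemma integrableOn_bulkLimit_sub_one (hp : -(1 / 2) < p) :
    IntegrableOn (fun y => bulkLimit p y - 1) (Set.Ioi 0) := by
  obtain ⟨L, hL⟩ := exists_integrableOn_bulkLimit_sub hp
  suffices h : L = 1 by rwa [h] at hL
  have hseq : Tendsto (fun n : ℕ => 1 / ((n : ℝ) + 1)) atTop (𝓝 0) :=
    tendsto_one_div_add_atTop_nhds_zero_nat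
  have hpos : ∀ n : ℕ, 0 < 1 / ((n : ℝ) + 1) := fun n => by positivity
  have hle : ∀ n : ℕ, 1 / ((n : ℝ) + 1) ≤ 1 := fun n => by
    rw [div_le_one (by positivity)]
    have : (0 : ℝ) ≤ n := n.cast_nonneg
    linarith
  have h1 : Tendsto (fun n : ℕ => ((1 / ((n : ℝ) + 1) : ℝ) : ℂ) * (∫ y in Set.Ioi (0 : ℝ),
      ((bulkLimit p y - L : ℝ) : ℂ) * Complex.exp (-(((1 / ((n : ℝ) + 1) : ℝ) : ℂ) * y))) + L)
      atTop (𝓝 L) := by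
    rw [show 𝓝 (L : ℂ) = 𝓝 (0 + (L : ℂ)) by rw [zero_add]]
    refine Tendsto.add_const _ ?_
    refine squeeze_zero_norm (a := fun n : ℕ => 1 / ((n : ℝ) + 1) *
      ∫ y in Set.Ioi (0 : ℝ), ‖bulkLimit p y - L‖) (fun n => ?_) ?_
    · rw [norm_mul, Complex.norm_real, Real.norm_eq_abs, abs_of_pos (hpos n)]
      refine mul_le_mul_of_nonneg_left ?_ (hpos n).le
      refine (norm_integral_le_integral_norm _).trans (integral_mono_of_nonneg
        (Eventually.of_forall fun y => norm_nonneg _) hL.norm ?_)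
      filter_upwards [ae_restrict_mem measurableSet_Ioi] with y hy
      rw [norm_mul, Complex.norm_real]
      refine mul_le_of_le_one_right (norm_nonneg _)
        (norm_exp_neg_mul_le ?_ (le_of_lt hy))
      rw [Complex.ofReal_re]
      exact (hpos n).le
    · simpa using hseq.mul_const (∫ y in Set.Ioi (0 : ℝ), ‖bulkLimit p y - L‖)
  have h2 : Tendsto (fun n : ℕ => arsinhInt p ((1 / ((n : ℝ) + 1) : ℝ) : ℂ)) atTop (𝓝 1) := by
    have hone : ∫ α in Set.Ioo 0 (Real.pi / 2), (Real.cos α : ℂ) * 1 = 1 := by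
      simp only [mul_one]
      rw [integral_complex_ofReal, integral_cos_Ioo, Complex.ofReal_one]
    rw [← hone]
    refine tendsto_integral_of_dominated_convergence (fun _ => 3)
      (fun n => aestronglyMeasurable_cos_mul_arsinhPow p ?_)
      (integrableOn_const (by simp) (by simp)) (fun n => ?_) ?_
    · rw [Complex.ofReal_re]
      exact (hpos n).le
    · filter_upwards [ae_restrict_mem measurableSet_Ioo] with α hα
      refine (norm_cos_mul_arsinhPow_le hp (by rw [Complex.ofReal_re]; exact (hpos n).le)
        hα).trans ?_
      rw [Complex.norm_real, Real.norm_eq_abs, abs_of_pos (hpos n)]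
      linarith [hle n]
    · refine Eventually.of_forall fun α => Tendsto.const_mul _ ?_
      rw [← arsinhPow_zero p]
      refine (continuousAt_arsinhPow p (x := 0) (by simp)).tendsto.comp ?_
      have := ((Complex.continuous_ofReal.tendsto 0).comp hseq).div_const (Real.cos α : ℂ)
      simpa [Function.comp_def] using this
  have h3 := tendsto_nhds_unique h1 (h2.congr fun n =>
    (laplace_bulkLimit_sub_eq hp hL (by rw [Complex.ofReal_re]; exact hpos n)).symm)
  exact_mod_cast h3

/-- The difference quotient `(1 - L(x)) / x` of `L(x) = (x + √(1 + x²))^{-2p}`; its value at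
`x = 0` is `0`, the limit of the function at infinity. -/
noncomputable def arsinhQuot (p : ℝ) (x : ℂ) : ℂ := (1 - arsinhPow p x) / x

lemma laplace_bulkLimit_sub_one_eq (hp : -(1 / 2) < p) {s : ℂ} (hs : 0 < s.re) :
    ∫ y in Set.Ioi (0 : ℝ), ((bulkLimit p y - 1 : ℝ) : ℂ) * Complex.exp (-(s * y)) =
      -∫ α in Set.Ioo 0 (Real.pi / 2), arsinhQuot p (s / Real.cos α) := by
  have h := laplace_bulkLimit_sub_eq hp (integrableOn_bulkLimit_sub_one hp) hs
  have hs0 : s ≠ 0 := fun h0 => by rw [h0] at hs; simp at hs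
  have hcosi : IntegrableOn (fun α : ℝ => (Real.cos α : ℂ)) (Set.Ioo 0 (Real.pi / 2)) :=
    ((Complex.continuous_ofReal.comp Real.continuous_cos).integrableOn_Icc).mono_set
      Set.Ioo_subset_Icc_self
  have h1 : ∫ α in Set.Ioo 0 (Real.pi / 2), (Real.cos α : ℂ) = 1 := by
    rw [integral_complex_ofReal, integral_cos_Ioo, Complex.ofReal_one]
  have h2 : s * ∫ α in Set.Ioo 0 (Real.pi / 2), arsinhQuot p (s / Real.cos α) =
      1 - arsinhInt p s := by
    rw [← h1, arsinhInt, ← integral_sub hcosi (integrableOn_cos_mul_arsinhPow hp hs.le),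
      ← integral_const_mul]
    refine setIntegral_congr_fun measurableSet_Ioo fun α hα => ?_
    have hc : (Real.cos α : ℂ) ≠ 0 := by exact_mod_cast (cos_pos_of_mem hα).ne'
    simp only [arsinhQuot]
    field_simp
  refine mul_left_cancel₀ hs0 ?_
  rw [mul_neg, h2]
  rw [Complex.ofReal_one] at h
  linear_combination h

/-- The boundary value of the Laplace transform on the imaginary axis. -/
lemma fourier_bulkLimit_sub_one_eq (hp : -(1 / 2) < p) {τ : ℝ} (hτ : 0 < τ) :
    ∫ y in Set.Ioi (0 : ℝ), ((bulkLimit p y - 1 : ℝ) : ℂ) * Complex.exp (Complex.I * τ * y) =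
      -∫ α in Set.Ioo 0 (Real.pi / 2), arsinhQuot p (-(Complex.I * τ) / Real.cos α) := by
  have hI := integrableOn_bulkLimit_sub_one hp
  set s : ℕ → ℂ := fun n => ((1 / ((n : ℝ) + 1) : ℝ) : ℂ) - Complex.I * τ with hs
  have hre : ∀ n, (s n).re = 1 / ((n : ℝ) + 1) := fun n => by
    simp only [hs, Complex.sub_re, Complex.ofReal_re, Complex.mul_re, Complex.I_re, Complex.I_im,
      Complex.ofReal_im]
    ring
  have hre0 : ∀ n, 0 < (s n).re := fun n => by rw [hre]; positivity
  have hlim : Tendsto s atTop (𝓝 (-(Complex.I * τ))) := by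
    have h1 : Tendsto (fun n : ℕ => ((1 / ((n : ℝ) + 1) : ℝ) : ℂ)) atTop (𝓝 ((0 : ℝ) : ℂ)) :=
      (Complex.continuous_ofReal.tendsto 0).comp tendsto_one_div_add_atTop_nhds_zero_nat
    have := h1.sub_const (Complex.I * τ)
    rwa [Complex.ofReal_zero, zero_sub] at this
  have hm : AEStronglyMeasurable (fun y => ((bulkLimit p y - 1 : ℝ) : ℂ))
      (volume.restrict (Set.Ioi 0)) :=
    Complex.continuous_ofReal.comp_aestronglyMeasurable hI.aestronglyMeasurable
  have h1 : Tendsto (fun n => ∫ y in Set.Ioi (0 : ℝ),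
      ((bulkLimit p y - 1 : ℝ) : ℂ) * Complex.exp (-(s n * y))) atTop
      (𝓝 (∫ y in Set.Ioi (0 : ℝ),
        ((bulkLimit p y - 1 : ℝ) : ℂ) * Complex.exp (Complex.I * τ * y))) := by
    refine tendsto_integral_of_dominated_convergence (fun y => ‖bulkLimit p y - 1‖)
      (fun n => hm.mul (Continuous.aestronglyMeasurable (by fun_prop))) hI.norm (fun n => ?_) ?_
    · filter_upwards [ae_restrict_mem measurableSet_Ioi] with y hy
      rw [norm_mul, Complex.norm_real]
      exact mul_le_of_le_one_right (norm_nonneg _)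
        (norm_exp_neg_mul_le (hre0 n).le (le_of_lt hy))
    · refine Eventually.of_forall fun y => Tendsto.const_mul _ ?_
      have h2 : Tendsto (fun n => -(s n * y)) atTop (𝓝 (Complex.I * τ * y)) := by
        have := (hlim.mul_const (y : ℂ)).neg
        rwa [neg_mul, neg_neg] at this
      exact (Complex.continuous_exp.tendsto _).comp h2
  have h2 : Tendsto (fun n => ∫ α in Set.Ioo 0 (Real.pi / 2), arsinhQuot p (s n / Real.cos α))
      atTop (𝓝 (∫ α in Set.Ioo 0 (Real.pi / 2),
        arsinhQuot p (-(Complex.I * τ) / Real.cos α))) := by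
    have hnorm : ∀ n, τ ≤ ‖s n‖ := fun n => by
      have h3 := Complex.abs_im_le_norm (s n)
      have h4 : (s n).im = -τ := by simp [hs]
      rw [h4, abs_neg, abs_of_pos hτ] at h3
      exact h3
    refine tendsto_integral_of_dominated_convergence (fun _ => 2 + 2 / τ) (fun n => ?_)
      (integrableOn_const (by simp) (by simp)) (fun n => ?_) ?_
    · refine ContinuousOn.aestronglyMeasurable ?_ measurableSet_Ioo
      refine (continuousOn_const.sub (continuousOn_arsinhPow_div_cos p (hre0 n).le)).div ?_ ?_
      · refine continuousOn_const.div
          (Complex.continuous_ofReal.comp Real.continuous_cos).continuousOn fun α hα => ?_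
        exact_mod_cast (cos_pos_of_mem hα).ne'
      · intro α hα
        have hc : (Real.cos α : ℂ) ≠ 0 := by exact_mod_cast (cos_pos_of_mem hα).ne'
        exact div_ne_zero (norm_pos_iff.1 (hτ.trans_le (hnorm n))) hc
    · filter_upwards [ae_restrict_mem measurableSet_Ioo] with α hα
      have hc := cos_pos_of_mem hα
      have hx : τ ≤ ‖s n / Real.cos α‖ := by
        rw [norm_div, Complex.norm_real, Real.norm_eq_abs, abs_of_pos hc, le_div_iff₀ hc]
        nlinarith [hnorm n, Real.cos_le_one α]
      have h3 := norm_arsinhPow_le_linear hp (x := s n / Real.cos α)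
        (by rw [div_cos_re]; have := hre0 n; positivity)
      have hx0 : 0 < ‖s n / Real.cos α‖ := hτ.trans_le hx
      rw [arsinhQuot, norm_div, div_le_iff₀ hx0]
      have h4 := norm_sub_le 1 (arsinhPow p (s n / Real.cos α))
      rw [norm_one] at h4
      have h5 : 2 ≤ 2 / τ * ‖s n / Real.cos α‖ := by
        rw [div_mul_eq_mul_div, le_div_iff₀ hτ]
        linarith
      linarith
    · filter_upwards [ae_restrict_mem measurableSet_Ioo] with α hα
      have hc : (Real.cos α : ℂ) ≠ 0 := by exact_mod_cast (cos_pos_of_mem hα).ne'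
      have h3 := hlim.div_const (Real.cos α : ℂ)
      have h4 := (continuousAt_arsinhPow p (x := -(Complex.I * τ) / Real.cos α)
        (by rw [div_cos_re]; simp)).tendsto.comp h3
      refine (h4.const_sub 1).div h3 (div_ne_zero (neg_ne_zero.2 (mul_ne_zero Complex.I_ne_zero ?_)) hc)
      exact_mod_cast hτ.ne'
  exact tendsto_nhds_unique (h1.congr fun n => laplace_bulkLimit_sub_one_eq hp (hre0 n)) h2.neg

end Laplace

/-! ### Deformation of the contour -/

section Contour

variable {p τ : ℝ}

lemma cos_add_mul_I_re (a b : ℝ) : (Complex.cos (a + b * Complex.I)).re = Real.cos a * Real.cosh b := by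
  rw [Complex.cos_add_mul_I, ← Complex.ofReal_cos, ← Complex.ofReal_cosh, ← Complex.ofReal_sin,
    ← Complex.ofReal_sinh]
  simp only [Complex.sub_re, Complex.mul_re, Complex.mul_im, Complex.ofReal_re,
    Complex.ofReal_im, Complex.I_re, Complex.I_im]
  ring

lemma cos_add_mul_I_im (a b : ℝ) : (Complex.cos (a + b * Complex.I)).im = -(Real.sin a * Real.sinh b) := by
  rw [Complex.cos_add_mul_I, ← Complex.ofReal_cos, ← Complex.ofReal_cosh, ← Complex.ofReal_sin,
    ← Complex.ofReal_sinh]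
  simp only [Complex.sub_im, Complex.mul_re, Complex.mul_im, Complex.ofReal_re,
    Complex.ofReal_im, Complex.I_re, Complex.I_im]
  ring

lemma sinh_le_norm_cos (a : ℝ) {b : ℝ} : Real.sinh b ≤ ‖Complex.cos (a + b * Complex.I)‖ := by
  refine le_of_sq_le_sq (?_ : _ ^ 2 ≤ _ ^ 2) (norm_nonneg _)
  rw [← Complex.normSq_eq_norm_sq, Complex.normSq_apply, cos_add_mul_I_re, cos_add_mul_I_im]
  have h1 := Real.sin_sq_add_cos_sq a
  have h2 := Real.cosh_sq b
  nlinarith [sq_nonneg (Real.cos a), sq_nonneg (Real.sinh b)]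

/-- The real part of `-iτ / cos z` is nonnegative in the half strip. -/
lemma neg_I_mul_div_re (c : ℂ) :
    (-(Complex.I * τ) / c).re = -(τ * c.im) / Complex.normSq c := by
  rw [Complex.div_re]
  simp

lemma norm_neg_I_mul (hτ : 0 < τ) : ‖-(Complex.I * (τ : ℂ))‖ = τ := by
  rw [norm_neg, norm_mul, Complex.norm_I, one_mul, Complex.norm_real, Real.norm_eq_abs,
    abs_of_pos hτ]

/-- A bound for the integrand that tends to zero with `c = cos z`. -/
lemma norm_arsinhQuot_le (hτ : 0 < τ) {c : ℂ} (hc : c.im ≤ 0) :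
    ‖arsinhQuot p (-(Complex.I * τ) / c)‖ ≤ (‖c‖ + ‖c‖ ^ (1 - max (-(2 * p)) 0) *
      (2 * τ + ‖c‖) ^ max (-(2 * p)) 0) / τ := by
  rcases eq_or_ne c 0 with rfl | hc0
  · rw [div_zero, arsinhQuot, div_zero, norm_zero]
    positivity
  have hcn : 0 < ‖c‖ := norm_pos_iff.2 hc0
  have hre : 0 ≤ (-(Complex.I * (τ : ℂ)) / c).re := by
    rw [neg_I_mul_div_re]
    refine div_nonneg ?_ (Complex.normSq_nonneg c)
    nlinarith
  have h1 := norm_arsinhPow_le p hre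
  set a := max (-(2 * p)) 0
  have hx : ‖-(Complex.I * (τ : ℂ)) / c‖ = τ / ‖c‖ := by rw [norm_div, norm_neg_I_mul hτ]
  rw [hx] at h1
  rw [arsinhQuot, norm_div, hx, div_div_eq_mul_div]
  refine div_le_div_of_nonneg_right ?_ hτ.le
  have h2 : (2 * (τ / ‖c‖) + 1) ^ a * ‖c‖ = ‖c‖ ^ (1 - a) * (2 * τ + ‖c‖) ^ a := by
    rw [show 2 * (τ / ‖c‖) + 1 = (2 * τ + ‖c‖) / ‖c‖ by field_simp,
      Real.div_rpow (by positivity) hcn.le, Real.rpow_sub hcn, Real.rpow_one]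
    ring
  have h3 := norm_sub_le 1 (arsinhPow p (-(Complex.I * τ) / c))
  rw [norm_one] at h3
  calc ‖1 - arsinhPow p (-(Complex.I * τ) / c)‖ * ‖c‖
      ≤ (1 + (2 * (τ / ‖c‖) + 1) ^ a) * ‖c‖ := by
        refine mul_le_mul_of_nonneg_right (h3.trans ?_) hcn.le
        linarith
    _ = _ := by rw [add_mul, one_mul, h2]

lemma continuousWithinAt_arsinhQuot_cos (hp : -(1 / 2) < p) (hτ : 0 < τ) {S : Set ℂ}
    (hS : ∀ z ∈ S, (Complex.cos z).im ≤ 0) {z : ℂ} (hz : z ∈ S) :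
    ContinuousWithinAt (fun z => arsinhQuot p (-(Complex.I * τ) / Complex.cos z)) S z := by
  by_cases hc0 : Complex.cos z = 0
  · have ha : 0 < 1 - max (-(2 * p)) 0 := by
      rw [sub_pos]
      exact max_lt (by linarith) one_pos
    have ha0 : 0 ≤ max (-(2 * p)) 0 := le_max_right _ _
    have hval : arsinhQuot p (-(Complex.I * τ) / Complex.cos z) = 0 := by
      rw [hc0, div_zero, arsinhQuot, div_zero]
    rw [ContinuousWithinAt, hval]
    refine squeeze_zero_norm' (a := fun z => (‖Complex.cos z‖ +
      ‖Complex.cos z‖ ^ (1 - max (-(2 * p)) 0) *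
      (2 * τ + ‖Complex.cos z‖) ^ max (-(2 * p)) 0) / τ) ?_ ?_
    · filter_upwards [self_mem_nhdsWithin] with w hw using norm_arsinhQuot_le hτ (hS w hw)
    · have hcont : Continuous fun z => (‖Complex.cos z‖ +
          ‖Complex.cos z‖ ^ (1 - max (-(2 * p)) 0) *
          (2 * τ + ‖Complex.cos z‖) ^ max (-(2 * p)) 0) / τ := by
        have hn : Continuous fun z => ‖Complex.cos z‖ := Complex.continuous_cos.norm
        exact (hn.add ((hn.rpow_const fun _ => Or.inr ha.le).mul
          ((continuous_const.add hn).rpow_const fun _ => Or.inr ha0))).div_const τ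
      have h := hcont.tendsto z
      rw [hc0, norm_zero, Real.zero_rpow ha.ne', zero_mul, add_zero, zero_div] at h
      exact h.mono_left nhdsWithin_le_nhds
  · have hre : 0 ≤ (-(Complex.I * (τ : ℂ)) / Complex.cos z).re := by
      rw [neg_I_mul_div_re]
      refine div_nonneg ?_ (Complex.normSq_nonneg _)
      nlinarith [hS z hz]
    have hx : -(Complex.I * (τ : ℂ)) / Complex.cos z ≠ 0 :=
      div_ne_zero (neg_ne_zero.2 (mul_ne_zero Complex.I_ne_zero (by exact_mod_cast hτ.ne'))) hc0
    have h1 : ContinuousAt (fun z => -(Complex.I * (τ : ℂ)) / Complex.cos z) z :=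
      continuousAt_const.div Complex.continuous_cos.continuousAt hc0
    have h2 : ContinuousAt (arsinhQuot p) (-(Complex.I * (τ : ℂ)) / Complex.cos z) :=
      (continuousAt_const.sub (continuousAt_arsinhPow p hre)).div continuousAt_id hx
    exact (ContinuousAt.comp (g := arsinhQuot p)
      (f := fun z => -(Complex.I * (τ : ℂ)) / Complex.cos z) h2 h1).continuousWithinAt

lemma tendsto_arsinhQuot_zero (p : ℝ) :
    Tendsto (arsinhQuot p) (𝓝[≠] 0) (𝓝 ((2 * p : ℝ) : ℂ)) := by
  have h := (hasDerivAt_arsinhPow_zero p).tendsto_slope_zero.neg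
  have e : -(((-(2 * p) : ℝ) : ℂ)) = ((2 * p : ℝ) : ℂ) := by push_cast; ring
  rw [e] at h
  refine h.congr fun x => ?_
  rw [zero_add, arsinhPow_zero, smul_eq_mul, arsinhQuot, div_eq_inv_mul]
  ring

/-- Cauchy's theorem in the rectangle `[0, π/2] × [0, Y]`. On the right edge the integrand is
real, so that it does not contribute to the real part. -/
lemma re_integral_arsinhQuot (hp : -(1 / 2) < p) (hτ : 0 < τ) (hτ1 : τ < 1) {Y : ℝ} (hY : 0 ≤ Y) :
    (∫ α in Set.Ioo 0 (Real.pi / 2), arsinhQuot p (-(Complex.I * τ) / Real.cos α)).re =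
      (∫ α in (0 : ℝ)..Real.pi / 2,
        arsinhQuot p (-(Complex.I * τ) / Complex.cos (α + Y * Complex.I))).re -
      ∫ b in (0 : ℝ)..Y,
        (1 - Real.cos (2 * p * Real.arcsin (τ / Real.cosh b))) * Real.cosh b / τ := by
  set f : ℂ → ℂ := fun z => arsinhQuot p (-(Complex.I * τ) / Complex.cos z) with hf
  have hpi : (0 : ℝ) ≤ Real.pi / 2 := by positivity
  set S : Set ℂ := Set.uIcc (0 : ℝ) (Real.pi / 2) ×ℂ Set.uIcc (0 : ℝ) Y with hS
  have hSim : ∀ z ∈ S, (Complex.cos z).im ≤ 0 := by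
    intro z hz
    rw [hS, Complex.mem_reProdIm, Set.uIcc_of_le hpi, Set.uIcc_of_le hY] at hz
    rw [← Complex.re_add_im z, cos_add_mul_I_im]
    have h1 := Real.sin_nonneg_of_nonneg_of_le_pi hz.1.1 (by linarith [hz.1.2, Real.pi_pos])
    have h2 := Real.sinh_nonneg_iff.2 hz.2.1
    have := mul_nonneg h1 h2
    linarith
  have hcont : ContinuousOn f S := fun z hz => continuousWithinAt_arsinhQuot_cos hp hτ hSim hz
  have hrect := Complex.integral_boundary_rect_eq_zero_of_continuousOn_of_differentiableOn f 0
    ((Real.pi / 2 : ℝ) + Y * Complex.I) (by simpa [hS] using hcont) (by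
      intro z hz
      rw [Complex.mem_reProdIm] at hz
      simp only [Complex.zero_re, Complex.zero_im, Complex.add_re, Complex.ofReal_re,
        Complex.mul_re, Complex.I_re, Complex.I_im, Complex.ofReal_im, Complex.add_im,
        Complex.mul_im, mul_zero, mul_one, zero_add, add_zero, sub_zero, min_eq_left hpi,
        max_eq_right hpi, min_eq_left hY, max_eq_right hY] at hz
      have him : (Complex.cos z).im < 0 := by
        rw [← Complex.re_add_im z, cos_add_mul_I_im]
        have h1 := Real.sin_pos_of_pos_of_lt_pi hz.1.1 (by linarith [hz.1.2, Real.pi_pos])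
        have h2 := Real.sinh_pos_iff.2 hz.2.1
        have := mul_pos h1 h2
        linarith
      have hc0 : Complex.cos z ≠ 0 := fun h => by rw [h] at him; simp at him
      have hre : 0 < (-(Complex.I * (τ : ℂ)) / Complex.cos z).re := by
        rw [neg_I_mul_div_re]
        refine div_pos ?_ (Complex.normSq_pos.2 hc0)
        nlinarith
      have hx : -(Complex.I * (τ : ℂ)) / Complex.cos z ≠ 0 := fun h => by
        rw [h] at hre; simp at hre
      have d1 : DifferentiableAt ℂ (fun z => -(Complex.I * (τ : ℂ)) / Complex.cos z) z :=
        (differentiableAt_const _).div Complex.differentiableAt_cos hc0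
      have d2 : DifferentiableAt ℂ (arsinhQuot p) (-(Complex.I * (τ : ℂ)) / Complex.cos z) :=
        ((differentiableAt_const _).sub (differentiableAt_arsinhPow p hre)).div
          differentiableAt_id hx
      exact (DifferentiableAt.comp (g := arsinhQuot p)
        (f := fun z => -(Complex.I * (τ : ℂ)) / Complex.cos z) z d2 d1).differentiableWithinAt)
  simp only [Complex.zero_re, Complex.zero_im, Complex.add_re, Complex.ofReal_re,
    Complex.mul_re, Complex.I_re, Complex.I_im, Complex.ofReal_im, Complex.add_im,
    Complex.mul_im, mul_zero, mul_one, zero_add, add_zero, sub_zero, Complex.ofReal_zero,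
    zero_mul, smul_eq_mul] at hrect
  have hbot : ∫ α in (0 : ℝ)..Real.pi / 2, f α =
      ∫ α in Set.Ioo 0 (Real.pi / 2), arsinhQuot p (-(Complex.I * τ) / Real.cos α) := by
    rw [intervalIntegral.integral_of_le hpi, integral_Ioc_eq_integral_Ioo]
    simp only [hf, Complex.ofReal_cos]
  have hright : ∫ b in (0 : ℝ)..Y, f ((Real.pi / 2 : ℝ) + b * Complex.I) =
      ((∫ b in (0 : ℝ)..Y, (1 - expArsinh (τ / Real.sinh b) ^ (-(2 * p))) / (τ / Real.sinh b) :
        ℝ) : ℂ) := by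
    rw [← intervalIntegral.integral_ofReal]
    refine intervalIntegral.integral_congr fun b hb => ?_
    rw [Set.uIcc_of_le hY] at hb
    have h1 : Complex.cos ((Real.pi / 2 : ℝ) + b * Complex.I) = -(Complex.I * Real.sinh b) := by
      apply Complex.ext
      · rw [cos_add_mul_I_re, Real.cos_pi_div_two, zero_mul, Complex.neg_re, Complex.I_mul_re,
          Complex.ofReal_im, neg_zero, neg_zero]
      · rw [cos_add_mul_I_im, Real.sin_pi_div_two, one_mul, Complex.neg_im, Complex.I_mul_im,
          Complex.ofReal_re]
    have h2 : -(Complex.I * (τ : ℂ)) / -(Complex.I * Real.sinh b) =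
        ((τ / Real.sinh b : ℝ) : ℂ) := by
      rw [neg_div_neg_eq, mul_div_mul_left _ _ Complex.I_ne_zero, Complex.ofReal_div]
    simp only [hf]
    rw [h1, h2, arsinhQuot, arsinhPow_ofReal p (div_nonneg hτ.le (Real.sinh_nonneg_iff.2 hb.1))]
    push_cast
    rfl
  have hleft : (Complex.I * ∫ b in (0 : ℝ)..Y, f (b * Complex.I)).re =
      -∫ b in (0 : ℝ)..Y,
        (1 - Real.cos (2 * p * Real.arcsin (τ / Real.cosh b))) * Real.cosh b / τ := by
    have hint : IntervalIntegrable (fun b : ℝ => Complex.I * f (b * Complex.I)) volume 0 Y := by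
      refine ContinuousOn.intervalIntegrable (continuousOn_const.mul
        (hcont.comp (Continuous.continuousOn (by fun_prop)) fun b hb => ?_))
      rw [hS, Complex.mem_reProdIm]
      simpa using hb
    rw [← intervalIntegral.integral_const_mul, ← intervalIntegral.integral_neg]
    have h0 := Complex.reCLM.intervalIntegral_comp_comm hint
    simp only [Complex.reCLM_apply] at h0
    rw [← h0]
    refine intervalIntegral.integral_congr fun b hb => ?_
    have hch := Real.one_le_cosh b
    have hch0 : 0 < Real.cosh b := by linarith
    have h1 : 0 ≤ τ / Real.cosh b := by positivity
    have h2 : τ / Real.cosh b < 1 := by rw [div_lt_one hch0]; linarith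
    have h3 : 0 ≤ Real.arcsin (τ / Real.cosh b) := Real.arcsin_nonneg.2 h1
    have h4 : Real.arcsin (τ / Real.cosh b) < Real.pi / 2 := Real.arcsin_lt_pi_div_two.2 h2
    have h5 := arsinhPow_neg_I_mul_sin p h3 h4
    rw [Real.sin_arcsin (by linarith) h2.le] at h5
    have h6 : -(Complex.I * (τ : ℂ)) / Complex.cos (b * Complex.I) =
        -(Complex.I * ((τ / Real.cosh b : ℝ) : ℂ)) := by
      rw [Complex.cos_mul_I, ← Complex.ofReal_cosh]
      push_cast
      ring
    simp only [hf]
    rw [h6, arsinhQuot, h5]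
    set θ : ℝ := 2 * p * Real.arcsin (τ / Real.cosh b)
    have hτc : (τ : ℂ) ≠ 0 := by exact_mod_cast hτ.ne'
    have hcc : (Real.cosh b : ℂ) ≠ 0 := by exact_mod_cast hch0.ne'
    have h7 : Complex.I * ((1 - Complex.exp (θ * Complex.I)) /
        -(Complex.I * ((τ / Real.cosh b : ℝ) : ℂ))) =
        ((-(Real.cosh b / τ) : ℝ) : ℂ) * (1 - Complex.exp (θ * Complex.I)) := by
      push_cast
      field_simp
    rw [h7, Complex.re_ofReal_mul, Complex.sub_re, Complex.exp_ofReal_mul_I_re, Complex.one_re]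
    ring
  have hre := congrArg Complex.re hrect
  rw [hbot, hright, Complex.sub_re, hleft, Complex.add_re, Complex.sub_re, Complex.mul_re,
    Complex.I_re, Complex.I_im, Complex.ofReal_im, Complex.zero_re] at hre
  linarith

/-- On the top edge the integrand tends to its value at the origin. -/
lemma tendsto_integral_top_edge (hp : -(1 / 2) < p) (hτ : 0 < τ) :
    Tendsto (fun Y : ℝ => ∫ α in (0 : ℝ)..Real.pi / 2,
      arsinhQuot p (-(Complex.I * τ) / Complex.cos (α + Y * Complex.I))) atTop
      (𝓝 ((p * Real.pi : ℝ) : ℂ)) := by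
  rw [Metric.tendsto_nhds]
  intro ε hε
  have hpi := Real.pi_pos
  have h1 := Metric.tendsto_nhds.1 (tendsto_arsinhQuot_zero p) (ε / Real.pi) (by positivity)
  rw [eventually_nhdsWithin_iff, Metric.eventually_nhds_iff] at h1
  obtain ⟨δ, hδ, h1⟩ := h1
  filter_upwards [eventually_gt_atTop (max 0 (τ / δ))] with Y hY
  have hY0 : 0 < Y := (le_max_left _ _).trans_lt hY
  have hYδ : τ / δ < Real.sinh Y :=
    ((le_max_right _ _).trans_lt hY).trans (Real.self_lt_sinh_iff.2 hY0)
  have hs0 : 0 < Real.sinh Y := Real.sinh_pos_iff.2 hY0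
  have hbound : ∀ α : ℝ, ‖arsinhQuot p (-(Complex.I * τ) / Complex.cos (α + Y * Complex.I)) -
      ((2 * p : ℝ) : ℂ)‖ ≤ ε / Real.pi := by
    intro α
    have h2 := sinh_le_norm_cos α (b := Y)
    have h3 : 0 < ‖Complex.cos (α + Y * Complex.I)‖ := hs0.trans_le h2
    rw [← dist_eq_norm]
    refine (h1 ?_ ?_).le
    · rw [dist_zero_right, norm_div, norm_neg_I_mul hτ, div_lt_iff₀ h3, mul_comm,
        ← div_lt_iff₀ hδ]
      exact hYδ.trans_le h2
    · exact div_ne_zero (neg_ne_zero.2 (mul_ne_zero Complex.I_ne_zero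
        (by exact_mod_cast hτ.ne'))) (norm_pos_iff.1 h3)
  have hcont : ContinuousOn (fun α : ℝ =>
      arsinhQuot p (-(Complex.I * τ) / Complex.cos (α + Y * Complex.I)))
      (Set.uIcc 0 (Real.pi / 2)) := by
    have h4 : ContinuousOn (fun z => arsinhQuot p (-(Complex.I * τ) / Complex.cos z))
        {z | (Complex.cos z).im ≤ 0} := fun z hz =>
      continuousWithinAt_arsinhQuot_cos hp hτ (fun w hw => hw) hz
    refine h4.comp (Continuous.continuousOn (by fun_prop)) fun α hα => ?_
    rw [Set.uIcc_of_le (by positivity)] at hα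
    rw [Set.mem_ofPred_eq, cos_add_mul_I_im]
    have := mul_nonneg (Real.sin_nonneg_of_nonneg_of_le_pi hα.1 (by linarith [hα.2])) hs0.le
    linarith
  have e1 : ((p * Real.pi : ℝ) : ℂ) = ∫ _ in (0 : ℝ)..Real.pi / 2, ((2 * p : ℝ) : ℂ) := by
    rw [intervalIntegral.integral_const, Complex.real_smul]
    push_cast
    ring
  rw [e1, dist_eq_norm, ← intervalIntegral.integral_sub hcont.intervalIntegrable (by simp)]
  refine (intervalIntegral.norm_integral_le_of_norm_le_const fun α _ => hbound α).trans_lt ?_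
  rw [sub_zero, abs_of_pos (by positivity)]
  field_simp
  linarith

lemma tendsto_integral_one_sub_cos (hp : -(1 / 2) < p) (hτ : 0 < τ) (hτ1 : τ < 1) :
    Tendsto (fun Y : ℝ => ∫ b in (0 : ℝ)..Y,
        (1 - Real.cos (2 * p * Real.arcsin (τ / Real.cosh b))) * Real.cosh b / τ) atTop
      (𝓝 (p * Real.pi -
        (∫ α in Set.Ioo 0 (Real.pi / 2), arsinhQuot p (-(Complex.I * τ) / Real.cos α)).re)) := by
  have h1 := (Complex.continuous_re.tendsto _).comp (tendsto_integral_top_edge hp hτ)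
  rw [Complex.ofReal_re] at h1
  refine (h1.sub_const _).congr' ?_
  filter_upwards [eventually_ge_atTop 0] with Y hY
  rw [re_integral_arsinhQuot hp hτ hτ1 hY]
  simp only [Function.comp]
  ring

end Contour

/-! ### The power series of `cos (2p arcsin w)` -/

/-- A solution of `f'' = -k² f` with vanishing initial data vanishes, by conservation of energy. -/
lemma eq_zero_of_oscillator {f f' : ℝ → ℝ} {k u : ℝ} (hu : 0 ≤ u)
    (h1 : ∀ v ∈ Set.Icc 0 u, HasDerivAt f (f' v) v)
    (h2 : ∀ v ∈ Set.Icc 0 u, HasDerivAt f' (-(k ^ 2 * f v)) v) (h0 : f 0 = 0) (h0' : f' 0 = 0) :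
    f u = 0 := by
  have hE : ∀ v ∈ Set.Icc 0 u, HasDerivAt (fun v => f' v ^ 2 + k ^ 2 * f v ^ 2) 0 v := by
    intro v hv
    refine (((h2 v hv).fun_pow 2).add (((h1 v hv).fun_pow 2).const_mul (k ^ 2))).congr_deriv ?_
    norm_num
    ring
  have hE0 := constant_of_has_deriv_right_zero
    (fun v hv => (hE v hv).continuousAt.continuousWithinAt)
    (fun v hv => (hE v ⟨hv.1, hv.2.le⟩).hasDerivWithinAt)
  have hf' : ∀ v ∈ Set.Icc 0 u, f' v = 0 := by
    intro v hv
    have h := hE0 v hv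
    simp only [h0, h0'] at h
    have h3 : 0 ≤ k ^ 2 * f v ^ 2 := by positivity
    have h4 : f' v ^ 2 = 0 := le_antisymm (by nlinarith) (sq_nonneg _)
    exact pow_eq_zero_iff two_ne_zero |>.1 h4
  have h := constant_of_has_deriv_right_zero
    (fun v hv => (h1 v hv).continuousAt.continuousWithinAt)
    (fun v hv => by
      have h5 := (h1 v ⟨hv.1, hv.2.le⟩).hasDerivWithinAt (s := Set.Ici v)
      rwa [hf' v ⟨hv.1, hv.2.le⟩] at h5) u ⟨hu, le_rfl⟩
  rw [h, h0]

/-- Taylor coefficients of `cos (2p arcsin w)` in powers of `w²`. -/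
noncomputable def cosArcsinCoeff (p : ℝ) (n : ℕ) : ℝ :=
  ∏ i ∈ Finset.range n, (4 * ((i : ℝ) ^ 2 - p ^ 2) / ((2 * i + 2) * (2 * i + 1)))

section CosArcsin

variable (p : ℝ)

lemma cosArcsinCoeff_succ (n : ℕ) : cosArcsinCoeff p (n + 1) =
    cosArcsinCoeff p n * (4 * ((n : ℝ) ^ 2 - p ^ 2) / ((2 * n + 2) * (2 * n + 1))) := by
  rw [cosArcsinCoeff, Finset.prod_range_succ, ← cosArcsinCoeff]

/-- The coefficients are bounded, since the modulus of their ratio is eventually at most one. -/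
lemma exists_abs_cosArcsinCoeff_le : ∃ K, 0 ≤ K ∧ ∀ n, |cosArcsinCoeff p n| ≤ K := by
  set N := ⌈|p|⌉₊
  have hN : |p| ≤ N := Nat.le_ceil _
  refine ⟨∑ i ∈ Finset.range (N + 1), |cosArcsinCoeff p i|,
    Finset.sum_nonneg fun i _ => abs_nonneg _, fun n => ?_⟩
  have hsmall : ∀ n ∈ Finset.range (N + 1), |cosArcsinCoeff p n| ≤
      ∑ i ∈ Finset.range (N + 1), |cosArcsinCoeff p i| := fun n hn =>
    Finset.single_le_sum (f := fun i => |cosArcsinCoeff p i|) (fun i _ => abs_nonneg _) hn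
  rcases le_total n N with h | h
  · exact hsmall n (Finset.mem_range.2 (by omega))
  · induction n, h using Nat.le_induction with
    | base => exact hsmall N (Finset.mem_range.2 (by omega))
    | succ n hn ih =>
      refine le_trans ?_ ih
      rw [cosArcsinCoeff_succ, abs_mul]
      refine mul_le_of_le_one_right (abs_nonneg _) ?_
      have hn' : |p| ≤ n := hN.trans (by exact_mod_cast hn)
      have hp2 : p ^ 2 ≤ (n : ℝ) ^ 2 := by
        rw [← sq_abs p]
        exact pow_le_pow_left₀ (abs_nonneg _) hn' 2
      have hn0 : (0 : ℝ) ≤ n := n.cast_nonneg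
      rw [abs_of_nonneg (div_nonneg (by linarith) (by positivity)), div_le_one (by positivity)]
      nlinarith [sq_nonneg p]

lemma summable_cosArcsinCoeff {R : ℝ} (hR0 : 0 ≤ R) (hR : R < 1) :
    Summable fun n => ‖cosArcsinCoeff p n‖ * R ^ n := by
  obtain ⟨K, -, hK⟩ := exists_abs_cosArcsinCoeff_le p
  refine Summable.of_nonneg_of_le (fun n => by positivity) (fun n => ?_)
    ((summable_geometric_of_lt_one hR0 hR).mul_left K)
  rw [Real.norm_eq_abs]
  have := hK n
  gcongr

lemma hasSum_cos_arcsin {w : ℝ} (hw0 : 0 ≤ w) (hw1 : w < 1) :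
    HasSum (fun n => cosArcsinCoeff p n * w ^ (2 * n)) (Real.cos (2 * p * Real.arcsin w)) := by
  set u := Real.arcsin w with hu
  have hu0 : 0 ≤ u := Real.arcsin_nonneg.2 hw0
  have hu1 : u < Real.pi / 2 := Real.arcsin_lt_pi_div_two.2 hw1
  have hsu : Real.sin u = w := Real.sin_arcsin (by linarith) hw1.le
  have hT1 : w ^ 2 < 1 := by nlinarith
  have hT0 : 0 ≤ w ^ 2 := by positivity
  set R := (w ^ 2 + 1) / 2 with hR
  set ρ := (3 * w ^ 2 + 1) / 4 with hρ
  have hρ0 : 0 < ρ := by positivity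
  have hρR : ρ < R := by rw [hρ, hR]; linarith
  have hTρ : w ^ 2 < ρ := by rw [hρ]; linarith
  have sC := summable_cosArcsinCoeff p (R := R) (by positivity) (by rw [hR]; linarith)
  have sC1 := summable_succ_mul_coeff_pow hρ0 hρR sC
  set H0 : ℝ → ℝ := fun t => ∑' k : ℕ, cosArcsinCoeff p k * t ^ k with hH0
  set H1 : ℝ → ℝ := fun t => ∑' k : ℕ, ((k : ℝ) + 1) * cosArcsinCoeff p (k + 1) * t ^ k
  set H2 : ℝ → ℝ := fun t => ∑' k : ℕ, ((k : ℝ) + 1) *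
        ((((k + 1 : ℕ) : ℝ) + 1) * cosArcsinCoeff p (k + 1 + 1)) * t ^ k
  have dH0 : ∀ t, |t| < ρ → HasDerivAt H0 (H1 t) t := fun t ht =>
    (hasDerivAt_tsum_mul_pow_succ sC (lt_trans ht hρR)).1
  have dH1 : ∀ t, |t| < ρ → HasDerivAt H1 (H2 t) t := fun t ht =>
    (hasDerivAt_tsum_mul_pow_succ sC1 (w := t) ht).1
  have ht : ∀ v ∈ Set.Icc 0 u, |Real.sin v ^ 2| < ρ := by
    intro v hv
    have h1 : Real.sin v ≤ w := by
      rw [← hsu]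
      exact Real.sin_le_sin_of_le_of_le_pi_div_two (by linarith [hv.1, Real.pi_pos]) hu1.le hv.2
    have h2 : 0 ≤ Real.sin v :=
      Real.sin_nonneg_of_nonneg_of_le_pi hv.1 (by linarith [hv.2, Real.pi_pos])
    rw [abs_of_nonneg (sq_nonneg _)]
    nlinarith
  have dsin : ∀ v, HasDerivAt (fun v => Real.sin v ^ 2) (2 * Real.sin v * Real.cos v) v := by
    intro v
    refine ((Real.hasDerivAt_sin v).fun_pow 2).congr_deriv ?_
    norm_num
  have d0 : ∀ v ∈ Set.Icc 0 u, HasDerivAt (fun v => H0 (Real.sin v ^ 2))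
      (H1 (Real.sin v ^ 2) * (2 * Real.sin v * Real.cos v)) v := fun v hv =>
    HasDerivAt.comp (h₂ := H0) (h := fun v : ℝ => Real.sin v ^ 2) v (dH0 _ (ht v hv)) (dsin v)
  have d1 : ∀ v ∈ Set.Icc 0 u, HasDerivAt (fun v => H1 (Real.sin v ^ 2))
      (H2 (Real.sin v ^ 2) * (2 * Real.sin v * Real.cos v)) v := fun v hv =>
    HasDerivAt.comp (h₂ := H1) (h := fun v : ℝ => Real.sin v ^ 2) v (dH1 _ (ht v hv)) (dsin v)
  have dlin : ∀ v : ℝ, HasDerivAt (fun v => 2 * p * v) (2 * p) v := fun v => by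
    simpa using (hasDerivAt_id v).const_mul (2 * p)
  have key := eq_zero_of_oscillator (k := 2 * p) hu0
    (f := fun v => H0 (Real.sin v ^ 2) - Real.cos (2 * p * v))
    (f' := fun v => H1 (Real.sin v ^ 2) * (2 * Real.sin v * Real.cos v) -
      -Real.sin (2 * p * v) * (2 * p))
    (fun v hv => (d0 v hv).sub (dlin v).cos)
    (fun v hv => by
      refine (((d1 v hv).mul (((Real.hasDerivAt_sin v).const_mul 2).mul
        (Real.hasDerivAt_cos v))).sub ((dlin v).sin.neg.mul_const (2 * p))).congr_deriv ?_
      have ode := hypergeometric_ode (c := cosArcsinCoeff p) (a := 4) (b := 2) (A := 4)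
        (B := 0) (C := -(4 * p ^ 2)) (fun k => by
          rw [cosArcsinCoeff_succ]
          field_simp
          ring) hρ0 hρR sC (ht v hv)
      change Real.sin v ^ 2 * (4 - 4 * Real.sin v ^ 2) * H2 (Real.sin v ^ 2) +
        (2 - (4 + 0) * Real.sin v ^ 2) * H1 (Real.sin v ^ 2) -
        -(4 * p ^ 2) * H0 (Real.sin v ^ 2) = 0 at ode
      have hsc := Real.sin_sq_add_cos_sq v
      simp only [Pi.mul_apply]
      generalize H0 (Real.sin v ^ 2) = a0 at ode ⊢
      generalize H1 (Real.sin v ^ 2) = a1 at ode ⊢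
      generalize H2 (Real.sin v ^ 2) = a2 at ode ⊢
      linear_combination ode + (4 * Real.sin v ^ 2 * a2 + 2 * a1) * hsc)
    (by
      simp only [hH0]
      rw [tsum_eq_single 0 fun k hk => by simp [hk]]
      simp [cosArcsinCoeff])
    (by simp)
  have hsum := (summable_mul_pow sC
    (show ‖w ^ 2‖ ≤ R by rw [Real.norm_eq_abs, abs_of_nonneg hT0]; linarith)).of_norm.hasSum
  rw [hsu, sub_eq_zero] at key
  rw [← key]
  simp only [pow_mul]
  exact hsum

end CosArcsin

/-! ### Integrals of odd powers of `1 / cosh` -/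

/-- The integral `∫_0^∞ cosh^{-(2n+1)}`. -/
noncomputable def sechInt (n : ℕ) : ℝ := ∫ b in Set.Ioi (0 : ℝ), 1 / Real.cosh b ^ (2 * n + 1)

lemma tendsto_sinh_atTop : Tendsto Real.sinh atTop atTop :=
  tendsto_atTop_mono' atTop ((eventually_ge_atTop 0).mono fun _ hx => Real.self_le_sinh_iff.2 hx)
    tendsto_id

lemma hasDerivAt_arctan_sinh (b : ℝ) :
    HasDerivAt (fun b => Real.arctan (Real.sinh b)) (1 / Real.cosh b) b := by
  refine ((Real.hasDerivAt_sinh b).arctan).congr_deriv ?_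
  have h := Real.cosh_sq b
  rw [add_comm, ← h]
  have := (Real.cosh_pos b).ne'
  field_simp

lemma tendsto_arctan_sinh :
    Tendsto (fun b => Real.arctan (Real.sinh b)) atTop (𝓝 (Real.pi / 2)) :=
  (Real.tendsto_arctan_atTop.mono_right nhdsWithin_le_nhds).comp tendsto_sinh_atTop

lemma integrableOn_one_div_cosh : IntegrableOn (fun b => 1 / Real.cosh b) (Set.Ioi 0) :=
  integrableOn_Ioi_deriv_of_nonneg' (fun b _ => hasDerivAt_arctan_sinh b)
    (fun b _ => (one_div_pos.2 (Real.cosh_pos b)).le) tendsto_arctan_sinh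

lemma one_div_cosh_pow_le (n : ℕ) (b : ℝ) :
    1 / Real.cosh b ^ (n + 1) ≤ 1 / Real.cosh b := by
  have h := Real.one_le_cosh b
  refine one_div_le_one_div_of_le (Real.cosh_pos b) ?_
  exact le_self_pow₀ h (Nat.succ_ne_zero n)

lemma integrableOn_one_div_cosh_pow (n : ℕ) :
    IntegrableOn (fun b => 1 / Real.cosh b ^ (n + 1)) (Set.Ioi 0) := by
  refine integrableOn_one_div_cosh.mono' ?_ (Eventually.of_forall fun b => ?_)
  · refine Continuous.aestronglyMeasurable (continuous_const.div (Real.continuous_cosh.pow _)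
      fun b => pow_ne_zero _ (Real.cosh_pos b).ne')
  · rw [Real.norm_eq_abs, abs_of_pos (one_div_pos.2 (pow_pos (Real.cosh_pos b) _))]
    exact one_div_cosh_pow_le n b

lemma sechInt_zero : sechInt 0 = Real.pi / 2 := by
  have h := integral_Ioi_of_hasDerivAt_of_nonneg' (a := 0) (fun b _ => hasDerivAt_arctan_sinh b)
    (fun b _ => (one_div_pos.2 (Real.cosh_pos b)).le) tendsto_arctan_sinh
  simpa [sechInt] using h

lemma sechInt_nonneg (n : ℕ) : 0 ≤ sechInt n :=
  integral_nonneg fun b => (one_div_pos.2 (pow_pos (Real.cosh_pos b) _)).le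

lemma sechInt_le (n : ℕ) : sechInt n ≤ Real.pi / 2 := by
  rw [← sechInt_zero]
  refine integral_mono (integrableOn_one_div_cosh_pow (2 * n))
    (integrableOn_one_div_cosh_pow (2 * 0)) fun b => ?_
  simpa using one_div_cosh_pow_le (2 * n) b

lemma sechInt_succ (n : ℕ) : (2 * n + 2) * sechInt (n + 1) = (2 * n + 1) * sechInt n := by
  have i1 := (integrableOn_one_div_cosh_pow (2 * (n + 1))).const_mul (2 * (n : ℝ) + 2)
  have i2 := (integrableOn_one_div_cosh_pow (2 * n)).const_mul (2 * (n : ℝ) + 1)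
  have h := integral_Ioi_of_hasDerivAt_of_tendsto' (a := 0) (m := 0)
    (f := fun b => Real.sinh b * (1 / Real.cosh b ^ (2 * n + 2)))
    (f' := fun b => (2 * (n : ℝ) + 2) * (1 / Real.cosh b ^ (2 * (n + 1) + 1)) -
      (2 * n + 1) * (1 / Real.cosh b ^ (2 * n + 1)))
    (fun b _ => by
      have hc := (Real.cosh_pos b).ne'
      have h1 : HasDerivAt (fun b => 1 / Real.cosh b ^ (2 * n + 2))
          (-((2 * (n : ℝ) + 2) * Real.sinh b / Real.cosh b ^ (2 * n + 3))) b := by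
        simp only [one_div]
        refine (((Real.hasDerivAt_cosh b).fun_pow (2 * n + 2)).fun_inv
          (pow_ne_zero _ hc)).congr_deriv ?_
        push_cast
        field_simp
        ring
      refine ((Real.hasDerivAt_sinh b).mul h1).congr_deriv ?_
      have h2 := Real.cosh_sq b
      have e1 : Real.cosh b ^ (2 * (n + 1) + 1) = Real.cosh b ^ (2 * n + 1) * Real.cosh b ^ 2 := by
        ring
      have e2 : Real.cosh b ^ (2 * n + 3) = Real.cosh b ^ (2 * n + 1) * Real.cosh b ^ 2 := by
        ring
      have e3 : Real.cosh b ^ (2 * n + 2) = Real.cosh b ^ (2 * n + 1) * Real.cosh b := by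
        ring
      rw [e1, e2, e3]
      have hcn := pow_ne_zero (2 * n + 1) hc
      field_simp
      linear_combination (2 * (n : ℝ) + 2) * h2)
    (i1.sub i2) (by
      have hlim : Tendsto (fun b => 1 / Real.sinh b) atTop (𝓝 0) := by
        simpa only [one_div, Function.comp_def] using tendsto_inv_atTop_zero.comp tendsto_sinh_atTop
      refine squeeze_zero' ?_ ?_ hlim
      · filter_upwards [eventually_ge_atTop 0] with b hb
        have := Real.sinh_nonneg_iff.2 hb
        have := Real.cosh_pos b
        positivity
      · filter_upwards [eventually_gt_atTop 0] with b hb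
        have h1 := Real.sinh_pos_iff.2 hb
        have h2 := Real.cosh_sq b
        have h3 := Real.one_le_cosh b
        have h4 : Real.cosh b ^ 2 ≤ Real.cosh b ^ (2 * n + 2) :=
          pow_le_pow_right₀ h3 (by omega)
        rw [mul_one_div, div_le_div_iff₀ (by positivity) h1]
        nlinarith)
  rw [integral_sub i1 i2, integral_const_mul, integral_const_mul] at h
  simp only [Real.sinh_zero, zero_mul, sub_zero] at h
  rw [sechInt, sechInt]
  linarith

/-- Termwise integration of the cosine series. -/
lemma hasSum_integral_one_sub_cos (p : ℝ) {τ : ℝ} (hτ : 0 < τ) (hτ1 : τ < 1) :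
    HasSum (fun n => -(cosArcsinCoeff p (n + 1) * τ ^ (2 * n + 1) * sechInt n))
      (∫ b in Set.Ioi (0 : ℝ),
        (1 - Real.cos (2 * p * Real.arcsin (τ / Real.cosh b))) * Real.cosh b / τ) ∧
    IntegrableOn (fun b =>
      (1 - Real.cos (2 * p * Real.arcsin (τ / Real.cosh b))) * Real.cosh b / τ) (Set.Ioi 0) := by
  obtain ⟨K, hK0, hK⟩ := exists_abs_cosArcsinCoeff_le p
  have hτ2 : τ ^ 2 < 1 := by nlinarith
  have hgeo := summable_geometric_of_lt_one (sq_nonneg τ) hτ2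
  set F : ℕ → ℝ → ℝ := fun n b =>
    -(cosArcsinCoeff p (n + 1) * τ ^ (2 * n + 1)) * (1 / Real.cosh b ^ (2 * n + 1)) with hF
  have hpt : ∀ b, HasSum (fun n => F n b)
      ((1 - Real.cos (2 * p * Real.arcsin (τ / Real.cosh b))) * Real.cosh b / τ) := by
    intro b
    have hc := Real.cosh_pos b
    have hw0 : 0 < τ / Real.cosh b := by positivity
    have hw1 : τ / Real.cosh b < 1 := by
      rw [div_lt_one hc]
      linarith [Real.one_le_cosh b]
    have h := (hasSum_nat_add_iff' 1).2 (hasSum_cos_arcsin p hw0.le hw1)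
    have h2 := h.mul_left (-(Real.cosh b / τ))
    rw [Finset.sum_range_one] at h2
    have e : -(Real.cosh b / τ) * (Real.cos (2 * p * Real.arcsin (τ / Real.cosh b)) -
        cosArcsinCoeff p 0 * (τ / Real.cosh b) ^ (2 * 0)) =
        (1 - Real.cos (2 * p * Real.arcsin (τ / Real.cosh b))) * Real.cosh b / τ := by
      simp only [cosArcsinCoeff, Finset.range_zero, Finset.prod_empty, mul_zero, pow_zero]
      ring
    rw [e] at h2
    refine h2.congr_fun fun n => ?_
    simp only [hF]
    rw [div_pow, show 2 * (n + 1) = 2 * n + 1 + 1 by ring, pow_succ τ (2 * n + 1),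
      pow_succ (Real.cosh b) (2 * n + 1)]
    field_simp
  have hFle : ∀ n b, ‖F n b‖ ≤ K * τ * (τ ^ 2) ^ n * (1 / Real.cosh b) := by
    intro n b
    have hc := Real.cosh_pos b
    have h1 := one_div_cosh_pow_le (2 * n) b
    have h2 : 0 < 1 / Real.cosh b ^ (2 * n + 1) := by positivity
    simp only [hF]
    rw [Real.norm_eq_abs, abs_mul, abs_neg, abs_mul, abs_of_pos (pow_pos hτ _), abs_of_pos h2]
    calc |cosArcsinCoeff p (n + 1)| * τ ^ (2 * n + 1) * (1 / Real.cosh b ^ (2 * n + 1))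
        ≤ K * τ ^ (2 * n + 1) * (1 / Real.cosh b) := by
          have := hK (n + 1)
          gcongr
      _ = _ := by ring
  have hint : ∀ n, IntegrableOn (F n) (Set.Ioi 0) := fun n =>
    (integrableOn_one_div_cosh_pow (2 * n)).const_mul _
  constructor
  · have h := hasSum_integral_of_summable_integral_norm (F := F)
      (μ := volume.restrict (Set.Ioi 0)) hint (by
        refine Summable.of_nonneg_of_le (fun n => integral_nonneg fun b => norm_nonneg _)
          (fun n => ?_) (hgeo.mul_left (K * τ * (Real.pi / 2)))
        calc ∫ b in Set.Ioi (0 : ℝ), ‖F n b‖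
            ≤ ∫ b in Set.Ioi (0 : ℝ), K * τ * (τ ^ 2) ^ n * (1 / Real.cosh b) :=
              integral_mono (hint n).norm (integrableOn_one_div_cosh.const_mul _) (hFle n)
          _ = K * τ * (τ ^ 2) ^ n * sechInt 0 := by
            rw [integral_const_mul, sechInt]
            simp
          _ = _ := by rw [sechInt_zero]; ring)
    simp only [(hpt _).tsum_eq] at h
    refine h.congr_fun fun n => ?_
    simp only [hF]
    rw [integral_const_mul, sechInt]
    ring
  · have hs : Summable fun n => K * τ * (τ ^ 2) ^ n := hgeo.mul_left _
    refine (integrableOn_one_div_cosh.const_mul (∑' n, K * τ * (τ ^ 2) ^ n)).mono' ?_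
      (Eventually.of_forall fun b => ?_)
    · have hcont : Continuous fun b => τ / Real.cosh b :=
        continuous_const.div Real.continuous_cosh fun b => (Real.cosh_pos b).ne'
      exact (((continuous_const.sub (Real.continuous_cos.comp (continuous_const.mul
        (Real.continuous_arcsin.comp hcont)))).mul Real.continuous_cosh).div_const
        τ).aestronglyMeasurable
    · rw [← (hpt b).tsum_eq, ← tsum_mul_right]
      exact tsum_of_norm_bounded (hs.mul_right _).hasSum fun n => hFle n b

/-! ### The Fourier transform of the truncated density -/

section Fourier

variable {p : ℝ} (hp : -(1 / 2) < p)

include hp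

lemma bulkLimit_neg (y : ℝ) : bulkLimit p (-y) = bulkLimit p y := by
  rcases eq_or_ne y 0 with rfl | hy
  · rw [neg_zero]
  · have h1 := hasSum_bulkFactor hp hy
    have h2 := hasSum_bulkFactor hp (neg_ne_zero.2 hy)
    simp only [(even_two_mul _).neg_pow] at h2
    rw [bulkLimit_eq hp, bulkLimit_eq hp, abs_neg, h2.unique h1]

lemma integrable_bulkLimit_sub_one : Integrable fun y => bulkLimit p y - 1 := by
  have h := integrableOn_bulkLimit_sub_one hp
  have h2 : IntegrableOn (fun y => bulkLimit p y - 1) (Set.Iio 0) := by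
    have h3 := (Measure.measurePreserving_neg (volume : Measure ℝ)).integrableOn_comp_preimage
      (Homeomorph.neg ℝ).measurableEmbedding (f := fun y => bulkLimit p y - 1) (s := Set.Ioi 0)
    have h4 := h3.2 h
    simpa [Function.comp_def, bulkLimit_neg hp] using h4
  rw [← integrableOn_univ, ← Set.Iic_union_Ioi (a := (0 : ℝ)), integrableOn_union,
    integrableOn_Iic_iff_integrableOn_Iio]
  exact ⟨h2, h⟩

/-- By evenness the Fourier transform is twice the real part of the half-line transform. -/
lemma fourier_bulkLimit_eq (σ : ℝ) :
    ∫ y : ℝ, ((bulkLimit p y - 1 : ℝ) : ℂ) * Complex.exp (Complex.I * σ * y) =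
      ((2 * (∫ y in Set.Ioi (0 : ℝ), ((bulkLimit p y - 1 : ℝ) : ℂ) *
        Complex.exp (Complex.I * σ * y)).re : ℝ) : ℂ) := by
  set g : ℝ → ℂ := fun y => ((bulkLimit p y - 1 : ℝ) : ℂ) * Complex.exp (Complex.I * σ * y) with hg
  have hgi : Integrable g := by
    have hI := integrable_bulkLimit_sub_one hp
    refine hI.norm.mono' ((Complex.continuous_ofReal.comp_aestronglyMeasurable
      hI.aestronglyMeasurable).mul (Continuous.aestronglyMeasurable (by fun_prop)))
      (Eventually.of_forall fun y => ?_)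
    rw [hg, norm_mul, Complex.norm_real, show Complex.I * (σ : ℂ) * y = ((σ * y : ℝ) : ℂ) *
      Complex.I by push_cast; ring, Complex.norm_exp_ofReal_mul_I, mul_one]
  have h1 : ∫ y in Set.Iic (0 : ℝ), g y = (starRingEnd ℂ) (∫ y in Set.Ioi (0 : ℝ), g y) := by
    have h2 := integral_comp_neg_Ioi (0 : ℝ) g
    rw [neg_zero] at h2
    rw [← h2, ← integral_conj]
    refine integral_congr_ae (Eventually.of_forall fun y => ?_)
    simp only [hg, map_mul, Complex.conj_ofReal, bulkLimit_neg hp]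
    rw [← Complex.exp_conj]
    simp
  rw [← intervalIntegral.integral_Iic_add_Ioi hgi.integrableOn hgi.integrableOn, h1, add_comm,
    Complex.add_conj]

lemma cJBulkDensity_eq {x : ℝ} (hx : x ≠ 0) :
    cJBulkDensity 2 p 0 x = bulkLimit p (2 * Real.pi * x) :=
  (tendsto_cJScaledDensity hp hx).limUnder_eq

lemma cJBulkDensity_ae_eq : ∀ᵐ x : ℝ, cJBulkDensity 2 p 0 x = bulkLimit p (2 * Real.pi * x) := by
  have h : ∀ᵐ x : ℝ, x ≠ 0 := by simp [ae_iff]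
  filter_upwards [h] with x hx using cJBulkDensity_eq hp hx

lemma integrable_cJBulkDensity_sub_one : Integrable fun x => cJBulkDensity 2 p 0 x - 1 := by
  have h := (integrable_bulkLimit_sub_one hp).comp_mul_left' (R := 2 * Real.pi) (by positivity)
  refine h.congr ?_
  filter_upwards [cJBulkDensity_ae_eq hp] with x hx
  rw [hx]

lemma cJFourier_eq (τ : ℝ) : cJFourier 2 p 0 τ =
    ((1 / Real.pi * (∫ y in Set.Ioi (0 : ℝ), ((bulkLimit p y - 1 : ℝ) : ℂ) *
        Complex.exp (Complex.I * (τ / (2 * Real.pi) : ℝ) * y)).re : ℝ) : ℂ) := by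
  have hpi := Real.pi_pos
  set g : ℝ → ℂ := fun y => ((bulkLimit p y - 1 : ℝ) : ℂ) *
    Complex.exp (Complex.I * (τ / (2 * Real.pi) : ℝ) * y) with hg
  have h1 : cJFourier 2 p 0 τ = ∫ x : ℝ, g (2 * Real.pi * x) := by
    refine integral_congr_ae ?_
    filter_upwards [cJBulkDensity_ae_eq hp] with x hx
    rw [hx, hg]
    have hpc : (Real.pi : ℂ) ≠ 0 := by exact_mod_cast hpi.ne'
    congr 2
    push_cast
    field_simp
  rw [h1, Measure.integral_comp_mul_left, hg, fourier_bulkLimit_eq hp, abs_of_pos (by positivity),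
    Complex.real_smul, ← Complex.ofReal_mul]
  congr 1
  field_simp

lemma cJFourier_abs (τ : ℝ) : cJFourier 2 p 0 |τ| = cJFourier 2 p 0 τ := by
  rcases abs_choice τ with h | h
  · rw [h]
  · rw [h, cJFourier_eq hp, cJFourier_eq hp]
    congr 2
    rw [← Complex.conj_re, ← integral_conj]
    congr 1
    refine integral_congr_ae (Eventually.of_forall fun y => ?_)
    simp only [map_mul, Complex.conj_ofReal]
    rw [← Complex.exp_conj]
    congr 2
    simp only [map_mul, Complex.conj_I, Complex.conj_ofReal]
    push_cast
    ring

/-- The Fourier transform for `0 < τ < 2π`. -/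
lemma hasSum_cJFourier_of_pos {τ : ℝ} (h0 : 0 < τ) (h1 : τ < 2 * Real.pi) :
    HasSum (fun n => -(1 / Real.pi) * (cosArcsinCoeff p (n + 1) *
      (τ / (2 * Real.pi)) ^ (2 * n + 1) * sechInt n)) ((cJFourier 2 p 0 τ).re + p) := by
  have hpi := Real.pi_pos
  set σ := τ / (2 * Real.pi)
  have hσ0 : 0 < σ := by positivity
  have hσ1 : σ < 1 := (div_lt_one (by positivity)).2 h1
  obtain ⟨hs, hi⟩ := hasSum_integral_one_sub_cos p hσ0 hσ1
  have ht := intervalIntegral_tendsto_integral_Ioi 0 hi tendsto_id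
  have he := tendsto_nhds_unique ht (tendsto_integral_one_sub_cos hp hσ0 hσ1)
  rw [he] at hs
  have h2 := hs.mul_left (1 / Real.pi)
  have h3 : 1 / Real.pi * (p * Real.pi - (∫ α in Set.Ioo 0 (Real.pi / 2),
      arsinhQuot p (-(Complex.I * σ) / Real.cos α)).re) = (cJFourier 2 p 0 τ).re + p := by
    rw [cJFourier_eq hp, Complex.ofReal_re]
    change _ = 1 / Real.pi * (∫ y in Set.Ioi (0 : ℝ), ((bulkLimit p y - 1 : ℝ) : ℂ) *
        Complex.exp (Complex.I * (σ : ℝ) * y)).re + p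
    rw [fourier_bulkLimit_sub_one_eq hp hσ0, Complex.neg_re]
    field_simp
    ring
  rw [h3] at h2
  refine h2.congr_fun fun n => ?_
  ring

lemma cJFourier_im (τ : ℝ) : (cJFourier 2 p 0 τ).im = 0 := by
  rw [cJFourier_eq hp, Complex.ofReal_im]

/-- Perfect screening. -/
lemma cJFourier_zero : cJFourier 2 p 0 0 = -p := by
  have hpi := Real.pi_pos
  have hI := integrable_cJBulkDensity_sub_one hp
  have hseq : Tendsto (fun n : ℕ => 1 / ((n : ℝ) + 1)) atTop (𝓝 0) :=
    tendsto_one_div_add_atTop_nhds_zero_nat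
  have hpos : ∀ n : ℕ, 0 < 1 / ((n : ℝ) + 1) := fun n => by positivity
  have hle : ∀ n : ℕ, 1 / ((n : ℝ) + 1) ≤ 1 := fun n => by
    rw [div_le_one (by positivity)]
    have : (0 : ℝ) ≤ n := n.cast_nonneg
    linarith
  have hc : Tendsto (fun n : ℕ => cJFourier 2 p 0 (1 / ((n : ℝ) + 1))) atTop
      (𝓝 (cJFourier 2 p 0 0)) := by
    refine tendsto_integral_of_dominated_convergence (fun x => ‖cJBulkDensity 2 p 0 x - 1‖)
      (fun n => (Complex.continuous_ofReal.comp_aestronglyMeasurable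
        hI.aestronglyMeasurable).mul (Continuous.aestronglyMeasurable (by fun_prop))) hI.norm
      (fun n => Eventually.of_forall fun x => ?_) (Eventually.of_forall fun x => ?_)
    · rw [norm_mul, Complex.norm_real, show Complex.I * ((1 / ((n : ℝ) + 1) : ℝ) : ℂ) * x =
        ((1 / ((n : ℝ) + 1) * x : ℝ) : ℂ) * Complex.I by push_cast; ring,
        Complex.norm_exp_ofReal_mul_I, mul_one]
    · refine Tendsto.const_mul _ ((Complex.continuous_exp.tendsto _).comp ?_)
      exact (((Complex.continuous_ofReal.tendsto 0).comp hseq).const_mul Complex.I).mul_const _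
  obtain ⟨K, hK0, hK⟩ := exists_abs_cosArcsinCoeff_le p
  have hre : Tendsto (fun n : ℕ => (cJFourier 2 p 0 (1 / ((n : ℝ) + 1))).re + p) atTop (𝓝 0) := by
    have hgeo := hasSum_geometric_of_lt_one (by norm_num : (0 : ℝ) ≤ 1 / 4) (by norm_num)
    refine squeeze_zero_norm (a := fun n : ℕ => K / 2 * (1 / ((n : ℝ) + 1)) * (1 - 1 / 4)⁻¹)
      (fun n => ?_) (by simpa using (hseq.const_mul (K / 2)).mul_const (1 - 1 / 4 : ℝ)⁻¹)
    have hpi3 := Real.pi_gt_three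
    have hs := hasSum_cJFourier_of_pos hp (hpos n) (by linarith [hle n])
    rw [← hs.tsum_eq]
    refine tsum_of_norm_bounded (hgeo.mul_left _) fun k => ?_
    set σ : ℝ := 1 / ((n : ℝ) + 1) / (2 * Real.pi) with hσ
    have hσ0 : 0 ≤ σ := by positivity
    have hσ1 : σ ≤ 1 / ((n : ℝ) + 1) := div_le_self (hpos n).le (by linarith)
    have hσ2 : σ ≤ 1 / 2 := by
      rw [hσ, div_le_div_iff₀ (by positivity) two_pos]
      nlinarith [hle n]
    have hσ4 : σ ^ 2 ≤ 1 / 4 := by nlinarith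
    rw [Real.norm_eq_abs, abs_mul, abs_mul, abs_mul, abs_neg, abs_of_pos (one_div_pos.2 hpi),
      abs_of_nonneg (pow_nonneg hσ0 _), abs_of_nonneg (sechInt_nonneg k), pow_succ, pow_mul]
    calc 1 / Real.pi * (|cosArcsinCoeff p (k + 1)| * ((σ ^ 2) ^ k * σ) * sechInt k)
        ≤ 1 / Real.pi * (K * ((1 / 4) ^ k * (1 / ((n : ℝ) + 1))) * (Real.pi / 2)) := by
          have := hK (k + 1)
          have := sechInt_le k
          have := sechInt_nonneg k
          gcongr
      _ = _ := by field_simp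
  have h2 := ((Complex.continuous_re.tendsto _).comp hc).add_const p
  have h3 := tendsto_nhds_unique h2 hre
  apply Complex.ext
  · rw [Complex.neg_re, Complex.ofReal_re]
    linarith
  · rw [cJFourier_im hp]; simp

end Fourier

/-! ### The coefficients of the expansion -/

lemma evenCoeff_succ (p : ℝ) (n : ℕ) : evenCoeff p (n + 2) = evenCoeff p (n + 1) *
    ((2 * n + 1) / (2 * n + 4) * (p ^ 2 - (n + 1) ^ 2) / Real.pi ^ 2) := by
  have hpi := Real.pi_pos.ne'
  rcases n with _ | m
  · simp [evenCoeff, Nat.doubleFactorial, Finset.prod_range_succ]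
    field_simp
    ring
  · rw [evenCoeff, evenCoeff, Finset.prod_range_succ,
      show 2 * (m + 1 + 2) - 3 = 2 * m + 1 + 2 by omega,
      show 2 * (m + 2) - 3 = 2 * m + 1 by omega,
      show 2 * (m + 1 + 2) = 2 * (m + 2) + 2 by ring,
      Nat.doubleFactorial_add_two, Nat.doubleFactorial_add_two (2 * (m + 2)), pow_add]
    have h1 : ((2 * (m + 2))‼ : ℝ) ≠ 0 := by
      exact_mod_cast (Nat.doubleFactorial_pos _).ne'
    push_cast
    field_simp
    ring

/-- The coefficient of `τ^{2n+1} sgn τ`. -/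
noncomputable def oddCoeff (p : ℝ) (n : ℕ) : ℝ :=
  Real.pi * (-1) ^ (n + 1) * evenCoeff p (n + 1) / ((2 * n + 1)! : ℝ)

lemma oddCoeff_succ (p : ℝ) (n : ℕ) : oddCoeff p (n + 1) = oddCoeff p n *
    ((2 * n + 1) * ((n + 1) ^ 2 - p ^ 2) /
      (Real.pi ^ 2 * ((2 * n + 4) * (2 * n + 2) * (2 * n + 3)))) := by
  have hpi := Real.pi_pos.ne'
  have hf : ((2 * n + 1)! : ℝ) ≠ 0 := by exact_mod_cast (Nat.factorial_pos _).ne'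
  rw [oddCoeff, oddCoeff, evenCoeff_succ, show 2 * (n + 1) + 1 = 2 * n + 1 + 1 + 1 by ring,
    Nat.factorial_succ (2 * n + 1 + 1), Nat.factorial_succ (2 * n + 1), pow_succ _ (n + 1)]
  push_cast
  rw [show 2 * (n : ℝ) + 1 + 1 + 1 = 2 * n + 3 by ring, show 2 * (n : ℝ) + 1 + 1 = 2 * n + 2 by ring]
  field_simp
  ring

lemma oddCoeff_zero (p : ℝ) : oddCoeff p 0 = p ^ 2 / (2 * Real.pi) := by
  have hpi := Real.pi_pos.ne'
  simp [oddCoeff, evenCoeff]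
  field_simp

lemma cosArcsinCoeff_mul_sechInt (p : ℝ) (n : ℕ) :
    -(1 / Real.pi) * (cosArcsinCoeff p (n + 1) * (1 / (2 * Real.pi)) ^ (2 * n + 1) * sechInt n) =
      oddCoeff p n := by
  have hpi := Real.pi_pos.ne'
  induction n with
  | zero =>
    rw [oddCoeff_zero, sechInt_zero, cosArcsinCoeff_succ]
    simp [cosArcsinCoeff]
    field_simp
    ring
  | succ n ih =>
    have hn : (2 * (n : ℝ) + 2) ≠ 0 := by positivity
    have hs : sechInt (n + 1) = (2 * n + 1) * sechInt n / (2 * n + 2) := by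
      rw [eq_div_iff hn]
      linarith [sechInt_succ n]
    rw [oddCoeff_succ, ← ih, hs, cosArcsinCoeff_succ p (n + 1),
      show 2 * (n + 1) + 1 = 2 * n + 1 + 2 by ring, pow_add]
    generalize (1 / (2 * Real.pi)) ^ (2 * n + 1) = u
    push_cast
    field_simp
    ring

lemma oddCoeff_ne_zero {p : ℝ} (hp : ∀ m : ℤ, p ≠ m) (n : ℕ) : oddCoeff p n ≠ 0 := by
  have hpi := Real.pi_pos
  induction n with
  | zero =>
    rw [oddCoeff_zero]
    have : p ≠ 0 := by simpa using hp 0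
    positivity
  | succ n ih =>
    rw [oddCoeff_succ]
    refine mul_ne_zero ih (div_ne_zero (mul_ne_zero (by positivity) ?_) (by positivity))
    intro h
    have h1 : ((n : ℝ) + 1 - p) * (n + 1 + p) = 0 := by linear_combination h
    rcases mul_eq_zero.1 h1 with h2 | h2
    · exact hp (n + 1) (by push_cast; linarith)
    · exact hp (-(n + 1)) (by push_cast; linarith)

/-- Ratio test: the odd series has radius of convergence at most `2π` unless it terminates. -/
lemma not_summable_oddCoeff {p : ℝ} (hp : ∀ m : ℤ, p ≠ m) {τ : ℝ} (hτ : 2 * Real.pi < |τ|) :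
    ¬ Summable fun n => oddCoeff p n * τ ^ (2 * n + 1) := by
  have hpi := Real.pi_pos
  have hτ0 : τ ≠ 0 := fun h => by rw [h, abs_zero] at hτ; linarith
  -- The ratio of consecutive terms as a function of `u = 1 / (n + 1)`.
  set r : ℝ → ℝ := fun u =>
    |(2 - u) * (1 - p ^ 2 * u ^ 2) / (Real.pi ^ 2 * ((2 + 2 * u) * 2 * (2 + u)))| * τ ^ 2 with hr
  have hr0 : r 0 = τ ^ 2 / (4 * Real.pi ^ 2) := by
    simp only [hr]
    rw [abs_of_pos (by norm_num; positivity)]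
    field_simp
    norm_num
  have hcont : ContinuousAt r 0 := by
    refine ContinuousAt.mul (ContinuousAt.abs (ContinuousAt.div (by fun_prop) (by fun_prop) ?_))
      continuousAt_const
    norm_num
  have hlim : Tendsto (fun n : ℕ => r (1 / ((n : ℝ) + 1))) atTop (𝓝 (r 0)) :=
    hcont.tendsto.comp tendsto_one_div_add_atTop_nhds_zero_nat
  refine not_summable_of_ratio_test_tendsto_gt_one (l := r 0) ?_ (hlim.congr fun n => ?_)
  · rw [hr0, lt_div_iff₀ (by positivity), one_mul, ← sq_abs τ]
    nlinarith
  · have h1 := oddCoeff_ne_zero hp n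
    rw [oddCoeff_succ, eq_div_iff (norm_ne_zero_iff.2 (mul_ne_zero h1 (pow_ne_zero _ hτ0))),
      show 2 * (n + 1) + 1 = 2 * n + 1 + 2 by ring, pow_add τ (2 * n + 1) 2, show oddCoeff p n * ((2 * (n : ℝ) + 1) * ((n + 1) ^ 2 - p ^ 2) /
        (Real.pi ^ 2 * ((2 * n + 4) * (2 * n + 2) * (2 * n + 3)))) * (τ ^ (2 * n + 1) * τ ^ 2) =
        ((2 * (n : ℝ) + 1) * ((n + 1) ^ 2 - p ^ 2) /
        (Real.pi ^ 2 * ((2 * n + 4) * (2 * n + 2) * (2 * n + 3)))) * τ ^ 2 *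
        (oddCoeff p n * τ ^ (2 * n + 1)) by ring, norm_mul _ (oddCoeff p n * τ ^ (2 * n + 1)),
      norm_mul _ (τ ^ 2), Real.norm_eq_abs, Real.norm_eq_abs (τ ^ 2), abs_of_nonneg (sq_nonneg τ)]
    simp only [hr]
    congr 3
    field_simp
    ring

section Expansion

variable {p : ℝ} (hp : -(1 / 2) < p)

include hp

/-- The expansion on `0 < |τ| < 2π`. -/
lemma hasSum_cJFourier {τ : ℝ} (h0 : τ ≠ 0) (h1 : |τ| < 2 * Real.pi) :
    HasSum (fun n => ((oddCoeff p n : ℝ) : ℂ) * (τ : ℂ) ^ (2 * n + 1) * (Real.sign τ : ℂ))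
      (cJFourier 2 p 0 τ + p) := by
  have hpi := Real.pi_pos
  have h := hasSum_cJFourier_of_pos hp (abs_pos.2 h0) h1
  rw [cJFourier_abs hp] at h
  have h2 : (((cJFourier 2 p 0 τ).re + p : ℝ) : ℂ) = cJFourier 2 p 0 τ + p := by
    rw [Complex.ofReal_add]
    congr 1
    apply Complex.ext
    · rw [Complex.ofReal_re]
    · rw [Complex.ofReal_im, cJFourier_im hp]
  rw [← h2]
  have h3 := Complex.hasSum_ofReal.2 h
  refine h3.congr_fun fun n => ?_
  have hs : τ ^ (2 * n + 1) * Real.sign τ = |τ| ^ (2 * n + 1) := by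
    rcases lt_or_gt_of_ne h0 with hneg | hpos
    · rw [Real.sign_of_neg hneg, abs_of_neg hneg, Odd.neg_pow (odd_two_mul_add_one n)]
      ring
    · rw [Real.sign_of_pos hpos, abs_of_pos hpos, mul_one]
  rw [mul_assoc, ← Complex.ofReal_pow, ← Complex.ofReal_mul, ← Complex.ofReal_mul, hs,
    ← cosArcsinCoeff_mul_sechInt]
  congr 1
  rw [div_pow, div_pow]
  ring

end Expansion

theorem mainTheorem10 (p : ℝ) (hp : -(1 / 2) < p) :
    (∀ x : ℝ, x ≠ 0 →
      Tendsto (fun N : ℕ => cJScaledDensity N 2 p 0 x) atTop (𝓝 (cJBulkDensity 2 p 0 x))) ∧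
    Integrable (fun x : ℝ => cJBulkDensity 2 p 0 x - 1) ∧
    ∃ h ht : ℕ → ℂ,
      HasSgnExpansion (cJFourier 2 p 0) h ht (2 * Real.pi) ∧
      (∀ j : ℕ, 1 ≤ j →
        h (2 * j - 1) =
          ((Real.pi * (-1) ^ j * evenCoeff p j / ((2 * j - 1)! : ℝ) : ℝ) : ℂ)) ∧
      (∀ j : ℕ, h (2 * j) = 0) ∧
      ht 0 = -(p : ℂ) ∧
      (∀ j : ℕ, 1 ≤ j → ht j = 0) ∧
      ((∀ m : ℤ, p ≠ m) →
        ∀ τ : ℝ, 2 * Real.pi < |τ| → ¬ Summable (fun j : ℕ => h j * (τ : ℂ) ^ j)) := by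
  refine ⟨fun x hx => ?_, integrable_cJBulkDensity_sub_one hp,
    fun j => if Even j then 0 else ((oddCoeff p (j / 2) : ℝ) : ℂ),
    fun j => if j = 0 then -(p : ℂ) else 0, ?_, ?_, ?_, ?_, ?_, ?_⟩
  · rw [cJBulkDensity_eq hp hx]
    exact tendsto_cJScaledDensity hp hx
  · intro τ hτ
    have hinj : Function.Injective fun n : ℕ => 2 * n + 1 := fun a b hab => by simpa using hab
    have hht : HasSum (fun j : ℕ => (if j = 0 then -(p : ℂ) else 0) * (τ : ℂ) ^ j) (-(p : ℂ)) := by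
      have := hasSum_single (f := fun j : ℕ => (if j = 0 then -(p : ℂ) else 0) * (τ : ℂ) ^ j) 0
        fun j hj => by simp [hj]
      simpa using this
    have hh : HasSum (fun j : ℕ => (if Even j then 0 else ((oddCoeff p (j / 2) : ℝ) : ℂ)) *
        (τ : ℂ) ^ j * (Real.sign τ : ℂ)) (cJFourier 2 p 0 τ + p) := by
      rcases eq_or_ne τ 0 with rfl | h0
      · rw [cJFourier_zero hp, neg_add_cancel]
        simp
      · rw [← hinj.hasSum_iff]
        · refine (hasSum_cJFourier hp h0 hτ).congr_fun fun n => ?_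
          simp only [Function.comp]
          rw [if_neg (Nat.not_even_iff_odd.2 (odd_two_mul_add_one n)),
            show (2 * n + 1) / 2 = n by omega]
        · intro j hj
          have hev : Even j := by
            by_contra hodd
            obtain ⟨k, hk⟩ := Nat.not_even_iff_odd.1 hodd
            exact hj ⟨k, hk.symm⟩
          rw [if_pos hev, zero_mul, zero_mul]
    exact ⟨hh.summable, hht.summable, by rw [hh.tsum_eq, hht.tsum_eq]; ring⟩
  · intro j hj
    obtain ⟨n, rfl⟩ := Nat.exists_eq_add_of_le' hj
    have e : 2 * (n + 1) - 1 = 2 * n + 1 := by omega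
    simp only [e]
    rw [if_neg (Nat.not_even_iff_odd.2 (odd_two_mul_add_one n)),
      show (2 * n + 1) / 2 = n by omega, oddCoeff]
  · intro j
    exact if_pos (even_two_mul j)
  · exact if_pos rfl
  · intro j hj
    exact if_neg (by omega)
  · intro hpm τ hτ hs
    have hinj : Function.Injective fun n : ℕ => 2 * n + 1 := fun a b hab => by simpa using hab
    refine not_summable_oddCoeff hpm hτ (Complex.summable_ofReal.1 ?_)
    refine (hs.comp_injective hinj).congr fun n => ?_
    simp only [Function.comp]
    rw [if_neg (Nat.not_even_iff_odd.2 (odd_two_mul_add_one n)),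
      show (2 * n + 1) / 2 = n by omega]
    push_cast
    rfl
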